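/- Let $(V,Q)$ be a nondegenerate complex quadratic space of finite dimension $n>2$, with bilinear form $B(x,y)=Q(x+y)-Q(x)-Q(y)$. Let $\mathcal O_V$ be the ring of polynomial functions on $V$, $I=(Q)\subset\mathcal O_V$, and $\mathcal O_C=\mathcal O_V/I$ the coordinate ring of the cone $C=\{Q=0\}$. Let $\mathcal D(C)=\bigcup_k\mathcal D^k(C)\subset\operatorname{End}_{\mathbb C}(\mathcal O_C)$ be the algebra of differential operators on $C$, where $\mathcal D^k(C)$ consists of the $D$ with $[f_0,[f_1,\dots,[f_k,D]\dots]]=0$ for all $f_0,\dots,f_k\in\mathcal O_C$. The group $\mathbb C^\times$ acts on $\mathcal O_C$ by $(\alpha\cdot f)(v)=f(\alpha v)$ and on $\mathcal D(C)$ by conjugation. Put $\mathcal D^{k,\ell}(C)=\{D\in\mathcal D^k(C):\alpha\cdot D=\alpha^\ell D\ \ \forall\alpha\in\mathbb C^\times\}$, $\tilde{\mathfrak s}=\mathcal D^{0,1}(C)\oplus\mathcal D^{1,0}(C)\oplus\mathcal D^{2,-1}(C)$ and $\mathfrak s=[\tilde{\mathfrak s},\tilde{\mathfrak s}]$. Let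 $V_2=\mathbb C^2$ with $Q_2(x,y)=xy$, $v_1=(1,0)$, $v_2=(0,1)$; let $\widetilde V=V\oplus V_2$, $\widetilde Q=Q\oplus Q_2$, with bilinear form $\widetilde B$, and $\mathfrak g=\mathfrak o(\widetilde V,\widetilde Q)$. Let $\mathbb C^\times$ act on $\mathfrak g$ through conjugation by the elements $a_\alpha\in O(\widetilde V,\widetilde Q)$ that are the identity on $V$ and send $v_1\mapsto\alpha v_1$, $v_2\mapsto\alpha^{-1}v_2$. Let $\mathfrak p=\{X\in\mathfrak g: Xv_1=0\}=\mathfrak l\oplus\mathfrak n$ be the Lie algebra of the stabilizer $P$ of $v_1$, where $\mathfrak l=\mathfrak o(V,Q)$ acts on $V$ and kills $V_2$, and $\mathfrak n=\{X\in\mathfrak p: X(v_1^\perp)\subset\mathbb C v_1\}$ is the Lie algebra of the unipotent radical of $P$. Let $\widetilde\psi:\mathfrak p\to\mathcal D(C)$ be the unique linear map such that * for $X\in\mathfrak l$, $\widetilde\psi(X)$ is the operator on $\mathcal O_C$ obtained by differentiating the action $(g\cdot f)(v)=f(g^{-1}v)$ of $O(V,Q)$ on polynomial functions; * for $X\in\mathfrak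 n$, $\widetilde\psi(X)$ is multiplication by the linear functional $v\mapsto\widetilde B(Xv_2,v)$ on $V$. Then there exists a unique $\mathbb C^\times$-equivariant morphism of complex Lie algebras $\psi:\mathfrak g\to\mathcal D(C)$ extending $\widetilde\psi$. Moreover, $\psi$ is injective, its image is equal to $\mathfrak s$, and the induced morphism of associative algebras $\mathcal U(\mathfrak g)\to\mathcal D(C)$ is surjective. -/

import Mathlib

/-! The commutator bracket on associative algebras. -/
attribute [local instance 100] LieRing.ofAssociativeRing

noncomputable section

namespace QuadCone

/-! ### Differential operators on a commutative algebra (Grothendieck) -/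

section DiffOp

variable {A : Type*} [CommRing A] [Algebra ℂ A]

/-- Multiplication by `f`, as an endomorphism of `A`. -/
abbrev mulOp (f : A) : Module.End ℂ A := LinearMap.mulLeft ℂ f

/-- `IsDiffOp k D` : `D` is a differential operator of order at most `k`, that is,
`[f₀, [f₁, … [f_k, D] … ]] = 0` for all `f₀, …, f_k` in `A`. -/
def IsDiffOp : ℕ → Module.End ℂ A → Prop
  | 0, D => ∀ f : A, mulOp f * D - D * mulOp f = 0
  | k + 1, D => ∀ f : A, IsDiffOp k (mulOp f * D - D * mulOp f)

theorem IsDiffOp.zero (k : ℕ) : IsDiffOp k (0 : Module.End ℂ A) := by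
  induction k with
  | zero => intro f; simp
  | succ k ih => intro f; simpa using ih

theorem IsDiffOp.add {k : ℕ} {D E : Module.End ℂ A} (hD : IsDiffOp k D) (hE : IsDiffOp k E) :
    IsDiffOp k (D + E) := by
  induction k generalizing D E with
  | zero =>
    intro f
    have h : mulOp f * (D + E) - (D + E) * mulOp f
      = (mulOp f * D - D * mulOp f) + (mulOp f * E - E * mulOp f) := by noncomm_ring
    rw [h, hD f, hE f, add_zero]
  | succ k ih =>
    intro f
    have h : mulOp f * (D + E) - (D + E) * mulOp f
      = (mulOp f * D - D * mulOp f) + (mulOp f * E - E * mulOp f) := by noncomm_ring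
    rw [h]
    exact ih (hD f) (hE f)

theorem IsDiffOp.smul {k : ℕ} {D : Module.End ℂ A} (c : ℂ) (hD : IsDiffOp k D) :
    IsDiffOp k (c • D) := by
  induction k generalizing D with
  | zero =>
    intro f
    rw [mul_smul_comm, smul_mul_assoc, ← smul_sub, hD f, smul_zero]
  | succ k ih =>
    intro f
    rw [mul_smul_comm, smul_mul_assoc, ← smul_sub]
    exact ih (hD f)

theorem IsDiffOp.succ {k : ℕ} {D : Module.End ℂ A} (hD : IsDiffOp k D) : IsDiffOp (k + 1) D := by
  induction k generalizing D with
  | zero => intro f; rw [hD f]; exact IsDiffOp.zero 0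
  | succ k ih => intro f; exact ih (hD f)

theorem IsDiffOp.mono {j k : ℕ} (h : j ≤ k) {D : Module.End ℂ A} (hD : IsDiffOp j D) :
    IsDiffOp k D := by
  induction h with
  | refl => exact hD
  | step _ ih => exact ih.succ

theorem isDiffOp_mulOp (g : A) : IsDiffOp 0 (mulOp g) := by
  intro f
  ext a
  simp [mul_left_comm]

theorem IsDiffOp.mul {j k : ℕ} {D E : Module.End ℂ A} (hD : IsDiffOp j D) (hE : IsDiffOp k E) :
    IsDiffOp (j + k) (D * E) := by
  have key : ∀ (m j k : ℕ) (D E : Module.End ℂ A), j + k = m → IsDiffOp j D → IsDiffOp k E →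
      IsDiffOp m (D * E) := by
    intro m
    induction m with
    | zero =>
      intro j k D E h hD hE
      obtain ⟨rfl, rfl⟩ : j = 0 ∧ k = 0 := by omega
      intro f
      have h : mulOp f * (D * E) - (D * E) * mulOp f
        = (mulOp f * D - D * mulOp f) * E + D * (mulOp f * E - E * mulOp f) := by noncomm_ring
      rw [h, hD f, hE f]; simp
    | succ m ih =>
      intro j k D E h hD hE f
      have h' : mulOp f * (D * E) - (D * E) * mulOp f
        = (mulOp f * D - D * mulOp f) * E + D * (mulOp f * E - E * mulOp f) := by noncomm_ring
      rw [h']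
      refine IsDiffOp.add ?_ ?_
      · cases j with
        | zero => rw [hD f, zero_mul]; exact IsDiffOp.zero m
        | succ j => exact ih j k _ _ (by omega) (hD f) hE
      · cases k with
        | zero => rw [hE f, mul_zero]; exact IsDiffOp.zero m
        | succ k => exact ih j k _ _ (by omega) hD (hE f)
  exact key _ j k D E rfl hD hE

variable (A) in
/-- The algebra of differential operators on `A`: those of order at most `k` for some `k`. -/
def diffOps : Subalgebra ℂ (Module.End ℂ A) where
  carrier := {D | ∃ k, IsDiffOp k D}
  mul_mem' := by
    rintro D E ⟨j, hD⟩ ⟨k, hE⟩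
    exact ⟨j + k, hD.mul hE⟩
  add_mem' := by
    rintro D E ⟨j, hD⟩ ⟨k, hE⟩
    exact ⟨max j k, (hD.mono (le_max_left j k)).add (hE.mono (le_max_right j k))⟩
  algebraMap_mem' c := by
    refine ⟨0, ?_⟩
    have h : algebraMap ℂ (Module.End ℂ A) c = c • mulOp (1 : A) := by
      ext a; simp [Algebra.smul_def]
    rw [h]
    exact (isDiffOp_mulOp 1).smul c

/-- Conjugation by an algebra automorphism preserves the order of differential operators. -/
theorem IsDiffOp.conj {k : ℕ} {D : Module.End ℂ A} (s t : A →ₐ[ℂ] A) (hst : ∀ a, s (t a) = a)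
    (hD : IsDiffOp k D) :
    IsDiffOp k (s.toLinearMap ∘ₗ D ∘ₗ t.toLinearMap) := by
  have h : ∀ (D : Module.End ℂ A) (f : A),
      mulOp f * (s.toLinearMap ∘ₗ D ∘ₗ t.toLinearMap) - (s.toLinearMap ∘ₗ D ∘ₗ t.toLinearMap) * mulOp f
      = s.toLinearMap ∘ₗ (mulOp (t f) * D - D * mulOp (t f)) ∘ₗ t.toLinearMap := by
    intro D f
    ext a
    simp [hst]
  induction k generalizing D with
  | zero => intro f; rw [h, hD (t f)]; simp
  | succ k ih => intro f; rw [h]; exact ih (hD (t f))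

end DiffOp

/-! ### Polynomial functions on `V` and on the cone -/

section Cone

variable (V : Type*) [AddCommGroup V] [Module ℂ V]

/-- The ring `𝒪_V` of polynomial functions on `V`, generated by the linear functionals. -/
def polyFun : Subalgebra ℂ (V → ℂ) :=
  Algebra.adjoin ℂ (Set.range fun (φ : Module.Dual ℂ V) (v : V) => φ v)

variable {V}

/-- A linear functional as a polynomial function. -/
def linPoly : Module.Dual ℂ V →ₗ[ℂ] polyFun V where
  toFun φ := ⟨fun v => φ v, Algebra.subset_adjoin ⟨φ, rfl⟩⟩
  map_add' _ _ := rfl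
  map_smul' _ _ := rfl

@[simp] theorem linPoly_apply (φ : Module.Dual ℂ V) (v : V) : (linPoly φ).1 v = φ v := rfl

theorem comp_smul_mem_polyFun (α : ℂ) (f : V → ℂ) (hf : f ∈ polyFun V) :
    (fun v => f (α • v)) ∈ polyFun V := by
  induction hf using Algebra.adjoin_induction with
  | mem x hx =>
    obtain ⟨φ, rfl⟩ := hx
    exact Algebra.subset_adjoin ⟨α • φ, by funext v; simp⟩
  | algebraMap r => exact (polyFun V).algebraMap_mem r
  | add f g _ _ hf hg => exact (polyFun V).add_mem hf hg
  | mul f g _ _ hf hg => exact (polyFun V).mul_mem hf hg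

/-- Rescaling on `𝒪_V`: `(α · f)(v) = f (α v)`. -/
def scaleV (α : ℂ) : polyFun V →ₐ[ℂ] polyFun V where
  toFun f := ⟨fun v => f.1 (α • v), comp_smul_mem_polyFun α f.1 f.2⟩
  map_one' := rfl
  map_mul' _ _ := rfl
  map_zero' := rfl
  map_add' _ _ := rfl
  commutes' _ := rfl

theorem quadraticForm_mem_polyFun [FiniteDimensional ℂ V] (Q : QuadraticForm ℂ V) :
    (fun v => Q v) ∈ polyFun V := by
  let b := Module.finBasis ℂ V
  have h : (fun v => Q v) = ∑ i, ∑ j, (QuadraticMap.associated (R := ℂ) Q (b i) (b j)) •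
      ((linPoly (b.coord i)).1 * (linPoly (b.coord j)).1) := by
    funext v
    have h1 : Q v = QuadraticMap.associated (R := ℂ) Q v v :=
      (QuadraticMap.associated_eq_self_apply ℂ Q v).symm
    rw [h1]
    conv_lhs => rw [← b.sum_repr v]
    simp only [map_sum, LinearMap.sum_apply, map_smul, LinearMap.smul_apply, Finset.sum_apply,
      Pi.smul_apply, Pi.mul_apply, linPoly_apply, Module.Basis.coord_apply, smul_eq_mul]
    simp only [Finset.mul_sum]
    rw [Finset.sum_comm]
    refine Finset.sum_congr rfl fun i _ => Finset.sum_congr rfl fun j _ => ?_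
    ring
  rw [h]
  exact Subalgebra.sum_mem _ fun i _ => Subalgebra.sum_mem _ fun j _ =>
    Subalgebra.smul_mem _ (Subalgebra.mul_mem _ (linPoly _).2 (linPoly _).2) _

variable [FiniteDimensional ℂ V] (Q : QuadraticForm ℂ V)

/-- `Q` as a polynomial function. -/
def quadPoly : polyFun V := ⟨fun v => Q v, quadraticForm_mem_polyFun Q⟩

/-- The ideal `I` of `𝒪_V` generated by `Q`. -/
def coneIdeal : Ideal (polyFun V) := Ideal.span {quadPoly Q}

/-- The ring `𝒪_C = 𝒪_V / I` of polynomial functions on the cone `C = {Q = 0}`. -/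
def ConeRing : Type _ := polyFun V ⧸ coneIdeal Q

instance : CommRing (ConeRing Q) := inferInstanceAs (CommRing (polyFun V ⧸ coneIdeal Q))

instance : Algebra ℂ (ConeRing Q) := inferInstanceAs (Algebra ℂ (polyFun V ⧸ coneIdeal Q))

/-- The quotient map `𝒪_V → 𝒪_C`. -/
def coneMk : polyFun V →ₐ[ℂ] ConeRing Q := Ideal.Quotient.mkₐ ℂ (coneIdeal Q)

theorem coneMk_surjective : Function.Surjective (coneMk Q) := Ideal.Quotient.mk_surjective

/-- The algebra `𝒟(C)` of differential operators on the cone. -/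
def coneDiffOps : Subalgebra ℂ (Module.End ℂ (ConeRing Q)) := diffOps (ConeRing Q)

instance : LieRing (coneDiffOps Q) := LieRing.ofAssociativeRing

instance : LieAlgebra ℂ (coneDiffOps Q) := LieAlgebra.ofAssociativeAlgebra

/-! ### The action of `ℂˣ` by rescaling and the grading of `𝒟(C)` -/

theorem scaleV_mem (α : ℂ) (f : polyFun V) (hf : f ∈ coneIdeal Q) :
    scaleV α f ∈ coneIdeal Q := by
  obtain ⟨g, rfl⟩ := Ideal.mem_span_singleton'.1 hf
  refine Ideal.mem_span_singleton'.2 ⟨(α * α) • scaleV α g, ?_⟩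
  ext v
  change (α * α) * g.1 (α • v) * Q v = g.1 (α • v) * Q (α • v)
  rw [QuadraticMap.map_smul, smul_eq_mul]
  ring

/-- Rescaling on `𝒪_C`. -/
def scaleC (α : ℂ) : ConeRing Q →ₐ[ℂ] ConeRing Q :=
  Ideal.quotientMapₐ (coneIdeal Q) (scaleV α) fun f hf => scaleV_mem Q α f hf

theorem scaleC_mul_cancel {α β : ℂ} (h : β * α = 1) (a : ConeRing Q) :
    scaleC Q α (scaleC Q β a) = a := by
  obtain ⟨f, rfl⟩ := coneMk_surjective Q a
  change coneMk Q (scaleV α (scaleV β f)) = coneMk Q f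
  congr 1
  ext v
  change f.1 (β • α • v) = f.1 v
  rw [smul_smul, h, one_smul]

/-- The induced action of `ℂˣ` on `𝒟(C)`: `(α · D)(f) = α · D(α⁻¹ · f)`. -/
def scaleD (α : ℂˣ) : coneDiffOps Q →ₗ[ℂ] coneDiffOps Q where
  toFun D := ⟨(scaleC Q (α : ℂ)).toLinearMap ∘ₗ D.1 ∘ₗ (scaleC Q ((α⁻¹ : ℂˣ) : ℂ)).toLinearMap, by
    obtain ⟨k, hk⟩ := D.2
    exact ⟨k, hk.conj _ _ (scaleC_mul_cancel Q (by simp))⟩⟩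
  map_add' D E := Subtype.ext (LinearMap.ext fun a =>
    map_add (scaleC Q (α : ℂ)) (D.1 _) (E.1 _))
  map_smul' c D := Subtype.ext (LinearMap.ext fun a =>
    map_smul (scaleC Q (α : ℂ)) c (D.1 _))

/-- `𝒟^{k,ℓ}(C)`: the operators of order at most `k` and of weight `ℓ` under rescaling. -/
def gradedPiece (k : ℕ) (l : ℤ) : Submodule ℂ (coneDiffOps Q) where
  carrier := {D | IsDiffOp k D.1 ∧ ∀ α : ℂˣ, scaleD Q α D = ((α ^ l : ℂˣ) : ℂ) • D}
  zero_mem' := ⟨IsDiffOp.zero k, fun α => by simp⟩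
  add_mem' := by
    rintro D E ⟨hD, hD'⟩ ⟨hE, hE'⟩
    exact ⟨hD.add hE, fun α => by rw [map_add, hD', hE', smul_add]⟩
  smul_mem' := by
    rintro c D ⟨hD, hD'⟩
    exact ⟨hD.smul c, fun α => by rw [map_smul, hD', smul_comm]⟩

/-- `𝔰̃ = 𝒟^{0,1}(C) ⊕ 𝒟^{1,0}(C) ⊕ 𝒟^{2,-1}(C)`. -/
def sTilde : Submodule ℂ (coneDiffOps Q) :=
  gradedPiece Q 0 1 ⊔ gradedPiece Q 1 0 ⊔ gradedPiece Q 2 (-1)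

/-- `𝔰 = [𝔰̃, 𝔰̃]`, the linear span of the commutators of elements of `𝔰̃`. -/
def sAlg : Submodule ℂ (coneDiffOps Q) :=
  Submodule.span ℂ {D | ∃ x ∈ sTilde Q, ∃ y ∈ sTilde Q, D = ⁅x, y⁆}

end Cone

/-! ### The orthogonal Lie algebras -/

section Orthogonal

variable {V : Type*} [AddCommGroup V] [Module ℂ V] (Q : QuadraticForm ℂ V)

/-- The orthogonal Lie algebra of a quadratic space: the endomorphisms that are skew with respect
to the bilinear form `B(x, y) = Q(x + y) - Q(x) - Q(y)`. -/
abbrev orth {W : Type*} [AddCommGroup W] [Module ℂ W] (q : QuadraticForm ℂ W) :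
    LieSubalgebra ℂ (Module.End ℂ W) :=
  skewAdjointLieSubalgebra q.polarBilin

theorem mem_orth {W : Type*} [AddCommGroup W] [Module ℂ W] (q : QuadraticForm ℂ W)
    (X : Module.End ℂ W) :
    X ∈ orth q ↔ ∀ x y, q.polarBilin (X x) y = - q.polarBilin x (X y) := by
  have h : X ∈ orth q ↔ X ∈ q.polarBilin.skewAdjointSubmodule := Iff.rfl
  rw [h, LinearMap.mem_skewAdjointSubmodule]
  refine forall_congr' fun x => forall_congr' fun y => ?_
  change q.polarBilin (X x) y = q.polarBilin x (-(X y)) ↔ _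
  rw [map_neg]

/-- The hyperbolic plane `V₂ = ℂ²` with `Q₂(x, y) = x y`. -/
def hypPlane : QuadraticForm ℂ (ℂ × ℂ) :=
  QuadraticMap.linMulLin (LinearMap.fst ℂ ℂ ℂ) (LinearMap.snd ℂ ℂ ℂ)

/-- `(Ṽ, Q̃) = (V ⊕ V₂, Q ⊕ Q₂)`. -/
def extForm : QuadraticForm ℂ (V × (ℂ × ℂ)) := Q.prod hypPlane

/-- The bilinear form `B̃` of `Q̃`. -/
abbrev extBilin : LinearMap.BilinForm ℂ (V × (ℂ × ℂ)) := (extForm Q).polarBilin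

variable (V) in
/-- The isotropic vector `v₁ = (1, 0)` of `V₂`, in `Ṽ`. -/
def vOne : V × (ℂ × ℂ) := (0, (1, 0))

variable (V) in
/-- The isotropic vector `v₂ = (0, 1)` of `V₂`, in `Ṽ`. -/
def vTwo : V × (ℂ × ℂ) := (0, (0, 1))

/-- `B̃` in coordinates. -/
theorem extBilin_apply (x y : V × (ℂ × ℂ)) :
    extBilin Q x y = Q.polarBilin x.1 y.1 + (x.2.1 * y.2.2 + x.2.2 * y.2.1) := by
  simp only [extBilin, extForm, hypPlane, QuadraticMap.polarBilin_apply_apply, QuadraticMap.polar,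
    QuadraticMap.prod_apply, QuadraticMap.linMulLin_apply, LinearMap.fst_apply,
    LinearMap.snd_apply, Prod.fst_add, Prod.snd_add]
  ring

/-- `𝔤 = 𝔬(Ṽ, Q̃)`. -/
abbrev gAlg : LieSubalgebra ℂ (Module.End ℂ (V × (ℂ × ℂ))) := orth (extForm Q)

/-- `𝔭`, the Lie algebra of the stabilizer `P` of `v₁` in `O(Ṽ, Q̃)`. -/
def pAlg : LieSubalgebra ℂ (gAlg Q) where
  carrier := {X | X.1 (vOne V) = 0}
  zero_mem' := rfl
  add_mem' := by
    intro X Y hX hY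
    change X.1 (vOne V) + Y.1 (vOne V) = 0
    rw [show X.1 (vOne V) = 0 from hX, show Y.1 (vOne V) = 0 from hY, add_zero]
  smul_mem' := by
    intro c X hX
    change c • X.1 (vOne V) = 0
    rw [show X.1 (vOne V) = 0 from hX, smul_zero]
  lie_mem' := by
    intro X Y hX hY
    change X.1 (Y.1 (vOne V)) - Y.1 (X.1 (vOne V)) = 0
    rw [show X.1 (vOne V) = 0 from hX, show Y.1 (vOne V) = 0 from hY, map_zero, map_zero, sub_zero]

/-- `𝔫`, the Lie algebra of the unipotent radical `N` of `P`: `N` is the subgroup of the elements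
of `P` that act trivially on `v₁^⊥ / ℂ v₁`. -/
def nAlg : Submodule ℂ (pAlg Q) where
  carrier := {X | ∀ w, extBilin Q (vOne V) w = 0 → X.1.1 w ∈ Submodule.span ℂ {vOne V}}
  zero_mem' := fun _ _ => Submodule.zero_mem _
  add_mem' := fun hX hY w hw => Submodule.add_mem _ (hX w hw) (hY w hw)
  smul_mem' := fun c _ hX w hw => Submodule.smul_mem _ c (hX w hw)

/-- The inclusion `ι_𝔬` of `𝔩 = 𝔬(V, Q)` into `𝔭`: `X` acts on `V` and kills `V₂`. -/
def lIncl : orth Q →ₗ[ℂ] pAlg Q where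
  toFun X := ⟨⟨LinearMap.prodMap X.1 0, by
    rw [mem_orth]
    intro x y
    change extBilin Q _ _ = - extBilin Q _ _
    rw [extBilin_apply, extBilin_apply]
    simpa using (mem_orth Q X.1).1 X.2 x.1 y.1⟩, by
      change LinearMap.prodMap X.1 0 (vOne V) = 0
      simp [vOne]⟩
  map_add' X Y := by
    ext : 2
    refine LinearMap.ext fun x => ?_
    change (X.1 x.1 + Y.1 x.1, (0 : ℂ × ℂ)) = (X.1 x.1, 0) + (Y.1 x.1, 0)
    simp
  map_smul' c X := by
    ext : 2
    refine LinearMap.ext fun x => ?_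
    change (c • X.1 x.1, (0 : ℂ × ℂ)) = c • (X.1 x.1, (0 : ℂ × ℂ))
    simp

variable (V) in
/-- The element of `A` with `ρ(a) = α`: the identity on `V`, with `v₁ ↦ α v₁`, `v₂ ↦ α⁻¹ v₂`. -/
def torusElt (α : ℂˣ) : Module.End ℂ (V × (ℂ × ℂ)) :=
  LinearMap.prodMap LinearMap.id
    (LinearMap.prodMap ((α : ℂ) • LinearMap.id) (((α⁻¹ : ℂˣ) : ℂ) • LinearMap.id))

theorem torusElt_isometry (α : ℂˣ) (x y : V × (ℂ × ℂ)) :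
    extBilin Q (torusElt V α x) (torusElt V α y) = extBilin Q x y := by
  rw [extBilin_apply, extBilin_apply]
  simp only [torusElt, LinearMap.prodMap_apply, LinearMap.id_apply, LinearMap.smul_apply,
    smul_eq_mul, Units.val_inv_eq_inv_val]
  field_simp [α.ne_zero]

theorem torusElt_cancel (α : ℂˣ) (x : V × (ℂ × ℂ)) :
    torusElt V α (torusElt V α⁻¹ x) = x := by
  simp [torusElt]

/-- The action of `ℂˣ` on `𝔤` by conjugation through `ρ⁻¹ : ℂˣ → A`. -/
def scaleG (α : ℂˣ) : gAlg Q →ₗ[ℂ] gAlg Q where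
  toFun X := ⟨torusElt V α * X.1 * torusElt V α⁻¹, by
    rw [mem_orth]
    intro x y
    have h1 := torusElt_isometry Q α (X.1 (torusElt V α⁻¹ x)) (torusElt V α⁻¹ y)
    have h2 := torusElt_isometry Q α (torusElt V α⁻¹ x) (X.1 (torusElt V α⁻¹ y))
    rw [torusElt_cancel] at h1 h2
    have h3 := (mem_orth _ X.1).1 X.2 (torusElt V α⁻¹ x) (torusElt V α⁻¹ y)
    exact h1.trans (h3.trans (congrArg Neg.neg h2.symm))⟩
  map_add' X Y := by
    ext : 1
    change torusElt V α * (X.1 + Y.1) * torusElt V α⁻¹ = _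
    rw [mul_add, add_mul]
    rfl
  map_smul' c X := by
    ext : 1
    change torusElt V α * (c • X.1) * torusElt V α⁻¹ = _
    rw [mul_smul_comm, smul_mul_assoc]
    rfl

end Orthogonal

/-! ### The map `ψ̃ : 𝔭 → 𝒟(C)` -/

section PsiTilde

variable {V : Type*} [AddCommGroup V] [Module ℂ V]

theorem polyFun_hasLineDerivAt (f : V → ℂ) (hf : f ∈ polyFun V) (v w : V) :
    HasLineDerivAt ℂ f (lineDeriv ℂ f v w) v w := by
  suffices h : LineDifferentiableAt ℂ f v w from h.hasLineDerivAt
  change DifferentiableAt ℂ (fun t : ℂ => f (v + t • w)) 0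
  induction hf using Algebra.adjoin_induction with
  | mem x hx =>
    obtain ⟨φ, rfl⟩ := hx
    simp only [map_add, map_smul, smul_eq_mul]
    fun_prop
  | algebraMap r =>
    change DifferentiableAt ℂ (fun t : ℂ => r) 0
    fun_prop
  | add f g _ _ hf hg => exact hf.add hg
  | mul f g _ _ hf hg => exact hf.mul hg

theorem lineDeriv_poly_add {f g : V → ℂ} (hf : f ∈ polyFun V) (hg : g ∈ polyFun V) (v w : V) :
    lineDeriv ℂ (f + g) v w = lineDeriv ℂ f v w + lineDeriv ℂ g v w :=
  (HasDerivAt.add (polyFun_hasLineDerivAt f hf v w) (polyFun_hasLineDerivAt g hg v w)).deriv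

theorem lineDeriv_poly_mul {f g : V → ℂ} (hf : f ∈ polyFun V) (hg : g ∈ polyFun V) (v w : V) :
    lineDeriv ℂ (f * g) v w = lineDeriv ℂ f v w * g v + f v * lineDeriv ℂ g v w := by
  have h := (HasDerivAt.mul (polyFun_hasLineDerivAt f hf v w)
    (polyFun_hasLineDerivAt g hg v w)).deriv
  simp only [zero_smul, add_zero] at h
  exact h

theorem lineDeriv_poly_lin (φ : Module.Dual ℂ V) (v w : V) :
    lineDeriv ℂ (fun x => φ x) v w = φ w := by
  simp [lineDeriv]

theorem lineDeriv_poly_const (r : ℂ) (v w : V) :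
    lineDeriv ℂ (algebraMap ℂ (V → ℂ) r) v w = 0 := by
  change deriv (fun t : ℂ => r) 0 = 0
  simp

theorem lineDeriv_mem_polyFun (X : Module.End ℂ V) (f : V → ℂ) (hf : f ∈ polyFun V) :
    (fun v => lineDeriv ℂ f v (-(X v))) ∈ polyFun V := by
  induction hf using Algebra.adjoin_induction with
  | mem x hx =>
    obtain ⟨φ, rfl⟩ := hx
    simp only [lineDeriv_poly_lin]
    exact Algebra.subset_adjoin ⟨φ ∘ₗ (-X), rfl⟩
  | algebraMap r =>
    simp only [lineDeriv_poly_const]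
    exact (polyFun V).zero_mem
  | add f g hf hg hf' hg' =>
    have h : (fun v => lineDeriv ℂ (f + g) v (-(X v)))
      = (fun v => lineDeriv ℂ f v (-(X v))) + fun v => lineDeriv ℂ g v (-(X v)) := by
      funext v; exact lineDeriv_poly_add hf hg _ _
    rw [h]
    exact (polyFun V).add_mem hf' hg'
  | mul f g hf hg hf' hg' =>
    have h : (fun v => lineDeriv ℂ (f * g) v (-(X v)))
      = (fun v => lineDeriv ℂ f v (-(X v))) * g + f * fun v => lineDeriv ℂ g v (-(X v)) := by
      funext v; exact lineDeriv_poly_mul hf hg _ _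
    rw [h]
    exact (polyFun V).add_mem ((polyFun V).mul_mem hf' hg) ((polyFun V).mul_mem hf hg')

/-- The derivative of the action `(g · f)(v) = f (g⁻¹ v)` on regular functions on `V`, in the
direction `X`: `(X · f)(v)` is the derivative of `f` at `v` along `- X v`. -/
def vecField (X : Module.End ℂ V) : Derivation ℂ (polyFun V) (polyFun V) :=
  Derivation.mk'
    { toFun := fun f => ⟨fun v => lineDeriv ℂ f.1 v (-(X v)), lineDeriv_mem_polyFun X f.1 f.2⟩
      map_add' := fun f g => by
        ext v; exact lineDeriv_poly_add f.2 g.2 _ _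
      map_smul' := fun c f => by
        ext v
        have h := lineDeriv_poly_mul ((polyFun V).algebraMap_mem c) f.2 v (-(X v))
        rw [lineDeriv_poly_const, zero_mul, zero_add, ← Algebra.smul_def] at h
        exact h }
    (fun f g => by
      ext v
      change lineDeriv ℂ (f.1 * g.1) v (-(X v)) = f.1 v * lineDeriv ℂ g.1 v (-(X v))
        + g.1 v * lineDeriv ℂ f.1 v (-(X v))
      rw [lineDeriv_poly_mul f.2 g.2]
      ring)

theorem vecField_apply (X : Module.End ℂ V) (f : polyFun V) (v : V) :
    (vecField X f).1 v = lineDeriv ℂ f.1 v (-(X v)) := rfl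

theorem vecField_linPoly (X : Module.End ℂ V) (φ : Module.Dual ℂ V) :
    vecField X (linPoly φ) = linPoly (-(φ ∘ₗ X)) := by
  ext v
  rw [vecField_apply]
  refine (lineDeriv_poly_lin φ v (-(X v))).trans ?_
  simp

/-- A derivation of `𝒪_V` is determined by its values on linear functionals. -/
theorem derivation_ext {D E : Derivation ℂ (polyFun V) (polyFun V)}
    (h : ∀ φ, D (linPoly φ) = E (linPoly φ)) : D = E := by
  ext1 f
  obtain ⟨f, hf⟩ := f
  induction hf using Algebra.adjoin_induction with
  | mem x hx =>
    obtain ⟨φ, rfl⟩ := hx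
    exact h φ
  | algebraMap r =>
    exact (D.map_algebraMap r).trans (E.map_algebraMap r).symm
  | add f g hf hg hf' hg' =>
    have := congrArg₂ (· + ·) hf' hg'
    simpa only [← map_add] using! this
  | mul f g hf hg hf' hg' =>
    have h1 := D.leibniz ⟨f, hf⟩ ⟨g, hg⟩
    have h2 := E.leibniz ⟨f, hf⟩ ⟨g, hg⟩
    rw [hf', hg'] at h1
    exact h1.trans h2.symm

variable (Q : QuadraticForm ℂ V)

/-- `X ↦ (v ↦ B̃(X v₂, v))`, which on `𝔫` is the isomorphism `f_{v₂} : 𝔫 → V*`. -/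
def fTwo : pAlg Q →ₗ[ℂ] Module.Dual ℂ V where
  toFun X := extBilin Q (X.1.1 (vTwo V)) ∘ₗ LinearMap.inl ℂ V (ℂ × ℂ)
  map_add' X Y := by
    change extBilin Q (X.1.1 (vTwo V) + Y.1.1 (vTwo V)) ∘ₗ _ = _
    rw [map_add, LinearMap.add_comp]
  map_smul' c X := by
    change extBilin Q (c • X.1.1 (vTwo V)) ∘ₗ _ = _
    rw [map_smul, LinearMap.smul_comp]
    rfl

/-- The component in `𝔩 = 𝔬(V, Q)` of an element of `𝔭 = 𝔩 ⊕ 𝔫`: its compression to `V`. -/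
def leviPart : pAlg Q →ₗ[ℂ] orth Q where
  toFun X := ⟨LinearMap.fst ℂ V (ℂ × ℂ) ∘ₗ X.1.1 ∘ₗ LinearMap.inl ℂ V (ℂ × ℂ), by
    rw [mem_orth]
    intro x y
    have h : extBilin Q (X.1.1 (x, 0)) (y, 0) = - extBilin Q (x, 0) (X.1.1 (y, 0)) :=
      (mem_orth _ X.1.1).1 X.1.2 (x, 0) (y, 0)
    rw [extBilin_apply, extBilin_apply] at h
    simpa using h⟩
  map_add' X Y := by ext v; rfl
  map_smul' c X := by ext v; rfl

theorem leviPart_lIncl (X : orth Q) : leviPart Q (lIncl Q X) = X := rfl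

theorem fTwo_lIncl (X : orth Q) : fTwo Q (lIncl Q X) = 0 := by
  ext v
  change extBilin Q (LinearMap.prodMap X.1 0 (vTwo V)) (v, 0) = 0
  rw [extBilin_apply]
  simp [vTwo]

theorem leviPart_nAlg (X : pAlg Q) (hX : X ∈ nAlg Q) : leviPart Q X = 0 := by
  ext v
  obtain ⟨c, hc⟩ := Submodule.mem_span_singleton.1 (hX (v, 0) (by
    rw [extBilin_apply]; simp [vOne]))
  change (X.1.1 (v, 0)).1 = 0
  rw [← hc]
  simp [vOne]

/-- `𝔭` is spanned by `𝔩` and `𝔫`. -/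
theorem sub_leviPart_mem (X : pAlg Q) : X - lIncl Q (leviPart Q X) ∈ nAlg Q := by
  have hskew : ∀ x y, extBilin Q (X.1.1 x) y = - extBilin Q x (X.1.1 y) :=
    (mem_orth _ X.1.1).1 X.1.2
  have hv : X.1.1 (vOne V) = 0 := X.2
  intro w hw
  have hw2 : w.2.2 = 0 := by
    rw [extBilin_apply] at hw; simpa [vOne] using hw
  have h2 : (X.1.1 w).2.2 = 0 := by
    have h := hskew (vOne V) w
    rw [hv, extBilin_apply, extBilin_apply] at h
    simpa [vOne] using h
  have hw' : w = (w.1, 0) + w.2.1 • vOne V := by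
    refine Prod.ext ?_ (Prod.ext ?_ ?_) <;> simp [vOne, hw2]
  have h1 : (X.1.1 w).1 = (X.1.1 (w.1, 0)).1 := by
    conv_lhs => rw [hw', map_add, map_smul, hv, smul_zero, add_zero]
  refine Submodule.mem_span_singleton.2 ⟨(X.1.1 w).2.1, ?_⟩
  change _ = X.1.1 w - ((X.1.1 (w.1, 0)).1, (0 : ℂ × ℂ))
  refine Prod.ext ?_ (Prod.ext ?_ ?_) <;> simp [vOne, h1, h2]

variable [FiniteDimensional ℂ V]

theorem vecField_quadPoly (X : orth Q) : vecField X.1 (quadPoly Q) = 0 := by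
  ext v
  rw [vecField_apply]
  have h0 : Q.polarBilin v (X.1 v) = 0 := by
    have h := (mem_orth Q X.1).1 X.2 v v
    have h' : Q.polarBilin (X.1 v) v = Q.polarBilin v (X.1 v) := QuadraticMap.polar_comm Q _ _
    rw [h'] at h
    linear_combination h / 2
  have h1 : ∀ t : ℂ, Q (v + t • (-(X.1 v))) = Q v + t * t * Q (X.1 v) := by
    intro t
    rw [QuadraticMap.map_add Q]
    have : QuadraticMap.polar Q v (t • (-(X.1 v))) = 0 := by
      change Q.polarBilin v (t • (-(X.1 v))) = 0
      rw [map_smul, map_neg, h0]; simp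
    rw [this, QuadraticMap.map_smul, QuadraticMap.map_neg, smul_eq_mul, add_zero]
  change deriv (fun t : ℂ => Q (v + t • (-(X.1 v)))) 0 = 0
  simp only [h1]
  have h : HasDerivAt (fun t : ℂ => Q v + t * t * Q (X.1 v)) 0 0 := by
    simpa using (((hasDerivAt_id (0 : ℂ)).mul (hasDerivAt_id (0 : ℂ))).mul_const
      (Q (X.1 v))).const_add (Q v)
  exact h.deriv

theorem vecField_mem (X : orth Q) (f : polyFun V) (hf : f ∈ coneIdeal Q) :
    vecField X.1 f ∈ coneIdeal Q := by
  obtain ⟨g, rfl⟩ := Ideal.mem_span_singleton'.1 hf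
  rw [Derivation.leibniz, vecField_quadPoly, smul_zero, zero_add, smul_eq_mul]
  exact Ideal.mul_mem_right _ _ (Ideal.mem_span_singleton_self _)

/-- The operator on `𝒪_C` induced by `X ∈ 𝔬(V, Q)`. -/
def coneField (X : orth Q) : Module.End ℂ (ConeRing Q) where
  toFun := Submodule.mapQ ((coneIdeal Q).restrictScalars ℂ) ((coneIdeal Q).restrictScalars ℂ)
    (vecField X.1).toLinearMap fun f hf => vecField_mem Q X f hf
  map_add' a b := map_add _ a b
  map_smul' c a := map_smul _ c a

theorem coneField_mk (X : orth Q) (f : polyFun V) :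
    coneField Q X (coneMk Q f) = coneMk Q (vecField X.1 f) := rfl

theorem coneField_isDiffOp (X : orth Q) : IsDiffOp 1 (coneField Q X) := by
  intro a
  have h : mulOp a * coneField Q X - coneField Q X * mulOp a = mulOp (-(coneField Q X a)) := by
    refine LinearMap.ext fun b => ?_
    obtain ⟨f, rfl⟩ := coneMk_surjective Q a
    obtain ⟨g, rfl⟩ := coneMk_surjective Q b
    simp only [LinearMap.sub_apply, Module.End.mul_apply, LinearMap.mulLeft_apply, coneField_mk,
      ← map_mul, Derivation.leibniz, smul_eq_mul]
    simp only [map_mul, map_add]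
    ring
  rw [h]
  exact isDiffOp_mulOp _

/-- `ι_𝒟 : 𝔩 = 𝔬(V, Q) → 𝒟(C)`. -/
def iotaD : orth Q →ₗ[ℂ] coneDiffOps Q where
  toFun X := ⟨coneField Q X, 1, coneField_isDiffOp Q X⟩
  map_add' X Y := by
    ext a
    obtain ⟨f, rfl⟩ := coneMk_surjective Q a
    have h : vecField (X + Y).1 = vecField X.1 + vecField Y.1 := by
      refine derivation_ext fun φ => ?_
      rw [Derivation.add_apply, vecField_linPoly, vecField_linPoly, vecField_linPoly, ← map_add]
      congr 1
      ext v
      change -(φ (X.1 v + Y.1 v)) = -(φ (X.1 v)) + -(φ (Y.1 v))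
      rw [map_add]; ring
    change coneField Q (X + Y) _ = coneField Q X _ + coneField Q Y _
    rw [coneField_mk, coneField_mk, coneField_mk, h, ← map_add]
    rfl
  map_smul' c X := by
    ext a
    obtain ⟨f, rfl⟩ := coneMk_surjective Q a
    have h : vecField (c • X).1 = c • vecField X.1 := by
      refine derivation_ext fun φ => ?_
      rw [Derivation.smul_apply, vecField_linPoly, vecField_linPoly, ← map_smul]
      congr 1
      ext v
      change -(φ (c • X.1 v)) = c • -(φ (X.1 v))
      rw [map_smul, smul_neg]
    change coneField Q (c • X) _ = c • coneField Q X _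
    rw [coneField_mk, coneField_mk, h]
    rfl

/-- The embedding `V* ⊂ 𝒟(C)`: multiplication by linear functionals. -/
def dualD : Module.Dual ℂ V →ₗ[ℂ] coneDiffOps Q where
  toFun φ := ⟨mulOp (coneMk Q (linPoly φ)), 0, isDiffOp_mulOp _⟩
  map_add' φ χ := by
    ext a
    change coneMk Q (linPoly (φ + χ)) * a = coneMk Q (linPoly φ) * a
      + coneMk Q (linPoly χ) * a
    rw [map_add, map_add, add_mul]
  map_smul' c φ := by
    ext a
    change coneMk Q (linPoly (c • φ)) * a
      = c • (coneMk Q (linPoly φ) * a)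
    rw [map_smul, ← smul_mul_assoc]
    rfl

/-- The linear map `ψ̃ : 𝔭 = 𝔩 ⊕ 𝔫 → 𝒟(C)`, equal to `ι_𝒟` on `𝔩` and to `f_{v₂}` on `𝔫`. -/
def psiTilde : pAlg Q →ₗ[ℂ] coneDiffOps Q :=
  iotaD Q ∘ₗ leviPart Q + dualD Q ∘ₗ fTwo Q

theorem psiTilde_lIncl (X : orth Q) : psiTilde Q (lIncl Q X) = iotaD Q X := by
  simp [psiTilde, leviPart_lIncl, fTwo_lIncl]

theorem psiTilde_nAlg (X : pAlg Q) (hX : X ∈ nAlg Q) : psiTilde Q X = dualD Q (fTwo Q X) := by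
  simp [psiTilde, leviPart_nAlg Q X hX]

/-- `ψ̃` is the only linear map that equals `ι_𝒟` on `𝔩` and `f_{v₂}` on `𝔫`. -/
theorem psiTilde_unique (χ : pAlg Q →ₗ[ℂ] coneDiffOps Q)
    (h1 : ∀ X, χ (lIncl Q X) = iotaD Q X)
    (h2 : ∀ X ∈ nAlg Q, χ X = dualD Q (fTwo Q X)) : χ = psiTilde Q := by
  refine LinearMap.ext fun X => ?_
  have h : X = lIncl Q (leviPart Q X) + (X - lIncl Q (leviPart Q X)) := by abel
  rw [h, map_add, map_add, h1, psiTilde_lIncl, h2 _ (sub_leviPart_mem Q X),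
    psiTilde_nAlg Q _ (sub_leviPart_mem Q X)]

/-- `ψ : 𝔤 → 𝒟(C)` is a `ℂˣ`-equivariant morphism of Lie algebras that extends `ψ̃`. -/
def IsEquivariantExtension (ψ : gAlg Q →ₗ⁅ℂ⁆ coneDiffOps Q) : Prop :=
  (∀ X : pAlg Q, ψ X.1 = psiTilde Q X) ∧
    ∀ (α : ℂˣ) (X : gAlg Q), ψ (scaleG Q α X) = scaleD Q α (ψ X)

end PsiTilde

end QuadCone

end

/-!
The morphism `ψ` is written down explicitly. In coordinates, an element of `𝔬(Ṽ, Q̃)` consists of a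
rotation `Y ∈ 𝔬(V, Q)`, vectors `a`, `b` in `V` and a scalar `c`; it acts on `𝒪_C` by the vector
field of `Y`, multiplication by `B(a, ·)`, the multiple `c (E + n / 2 - 1)` of the shifted Euler
operator, and the second-order operator `P_b = (E + n / 2 - 1) ∂_b - ½ B(b, ·) Δ`, which preserves
the ideal `(Q)` exactly because of the shift `n / 2 - 1`. An operator on `𝒪_C` is determined by its
value at `1` and its commutators with the linear functionals (`end_ext`), so every relation among
these operators follows from the formulas for their commutators with `B(a, ·)`, above all
`[P_b, B(a, ·)] = B(b, a) (E + n / 2 - 1) + (b ∧ a)`. The same principle gives uniqueness: the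
difference of two extensions sends the part of `𝔤` of weight `-1` to derivatives in constant
directions, and none of those is defined on the cone.

The image of `ψ` is `𝔰` because `𝔬(Ṽ, Q̃)` is perfect and `𝔰̃` is the image of `ψ` plus the scalars;
the latter is a computation of `𝒟^{1,0}(C)` and `𝒟^{2,-1}(C)` through commutators with linear
functionals (`eq_of_weight_zero`, `eq_confOp_of_weight_neg_one`).

For the surjectivity of `𝒰(𝔤) → 𝒟(C)`, let `N` be the subalgebra generated by the functionals
`B(a, ·)` and the operators `P_b`. An operator `D` of order `k + 1` lies in `N` if all operators of
order `k` do, for the following reasons.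

* Euler's identity for the symbol of `D` (`isDiffOp_eulerDefect`) says that `(k + 1) B(u, ·) D`
  equals `∑ i, (e i ∧ u) [D, B(e i, ·)]` up to an operator of order `k`.
  Hence `B(u, ·) D` and `D B(u, ·)` are in `N`, for all `u`.
* Therefore `(∑ P_{e i} B(e i, ·)) D` and `D (∑ B(e i, ·) P_{e i})` are in `N`. Both sums are
  quadratic polynomials in `E` with known roots, so modulo `N` the operator `D` is a combination of
  operators on which left and right multiplication by `E` are scalar, and the weights, the
  differences of these scalars, are among `-n / 2`, `-2` and `2 - n`.
* For `x` isotropic, `P_x` commutes with `B(x, ·)`, which is not a zero divisor on the cone. As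
  `ad P_x` is nilpotent on `B(x, ·) D ∈ N`, it is nilpotent on `D`, and then so is `ad P_u` for some
  anisotropic `u`, a sum of two isotropic vectors. In the `𝔰𝔩₂`-triple formed by `B(u, ·)`, `P_u` and
  `E + n / 2 - 1`, a vector killed by the first and nilpotently acted upon by the second has a
  weight in `{0, 1/2, 1, …}` (`mem_of_sl2`). Negative weights are excluded, so `D ∈ N`
  (`mem_of_mem_primSub`).
-/

noncomputable section

namespace QuadCone

/-! ### Polynomial functions: restriction to lines, grading, partial derivatives -/

section PolyFun

variable {V : Type*} [AddCommGroup V] [Module ℂ V]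

/-- To prove a property of a polynomial function, check it on constants and linear functionals
and show that it passes to sums and products. -/
theorem polyFun_induction {p : polyFun V → Prop} (hC : ∀ r : ℂ, p (algebraMap ℂ _ r))
    (hlin : ∀ φ, p (linPoly φ)) (hadd : ∀ f g, p f → p g → p (f + g))
    (hmul : ∀ f g, p f → p g → p (f * g)) (f : polyFun V) : p f := by
  obtain ⟨f, hf⟩ := f
  induction hf using Algebra.adjoin_induction with
  | mem x hx => obtain ⟨φ, rfl⟩ := hx; exact hlin φ
  | algebraMap r => exact hC r
  | add f g hf hg hf' hg' => exact hadd _ _ hf' hg'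
  | mul f g hf hg hf' hg' => exact hmul _ _ hf' hg'

theorem polyFun_line (f : polyFun V) (v w : V) :
    ∃ p : Polynomial ℂ, ∀ t : ℂ, f.1 (v + t • w) = p.eval t := by
  induction f using polyFun_induction with
  | hC r => exact ⟨Polynomial.C r, fun t => by rw [Polynomial.eval_C]; rfl⟩
  | hlin φ =>
    refine ⟨Polynomial.C (φ v) + Polynomial.C (φ w) * Polynomial.X, fun t => ?_⟩
    rw [linPoly_apply, map_add, map_smul, smul_eq_mul, Polynomial.eval_add, Polynomial.eval_mul,
      Polynomial.eval_C, Polynomial.eval_C, Polynomial.eval_X, mul_comm]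
  | hadd f g hf hg =>
    obtain ⟨p, hp⟩ := hf
    obtain ⟨q, hq⟩ := hg
    refine ⟨p + q, fun t => ?_⟩
    rw [Polynomial.eval_add, ← hp, ← hq]; rfl
  | hmul f g hf hg =>
    obtain ⟨p, hp⟩ := hf
    obtain ⟨q, hq⟩ := hg
    refine ⟨p * q, fun t => ?_⟩
    rw [Polynomial.eval_mul, ← hp, ← hq]; rfl

/-- If a product of two polynomial functions vanishes on a line and the second factor does not
vanish identically there, then the first one does. -/
theorem polyFun_eq_zero_on_line {f g : polyFun V} {v w : V}
    (h : ∀ t : ℂ, f.1 (v + t • w) * g.1 (v + t • w) = 0) {s : ℂ} (hg : g.1 (v + s • w) ≠ 0)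
    (t : ℂ) : f.1 (v + t • w) = 0 := by
  obtain ⟨p, hp⟩ := polyFun_line f v w
  obtain ⟨q, hq⟩ := polyFun_line g v w
  have h0 : p * q = 0 := Polynomial.funext fun t => by
    rw [Polynomial.eval_mul, ← hp, ← hq, h]; simp
  have hq0 : q ≠ 0 := by
    rintro rfl
    exact hg (by rw [hq]; simp)
  rw [hp, (mul_eq_zero.1 h0).resolve_right hq0, Polynomial.eval_zero]

variable (V) in
/-- The linear functionals, as a subspace of `𝒪_V`; its `m`-th power is the space of homogeneous
polynomial functions of degree `m`. -/
def linSub : Submodule ℂ (polyFun V) := LinearMap.range (linPoly (V := V))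

theorem homogeneous_apply_smul {m : ℕ} {f : polyFun V} (hf : f ∈ linSub V ^ m) (α : ℂ) (v : V) :
    f.1 (α • v) = α ^ m * f.1 v := by
  induction hf using Submodule.pow_induction_on_left' with
  | algebraMap r => rw [pow_zero, one_mul]; rfl
  | add x y i hx hy h1 h2 =>
    change x.1 _ + y.1 _ = _ * (x.1 _ + y.1 _)
    rw [h1, h2]; ring
  | mem_mul m hm i x hx ih =>
    obtain ⟨φ, rfl⟩ := hm
    change φ _ * x.1 _ = _ * (φ _ * x.1 _)
    rw [ih, map_smul, smul_eq_mul, Nat.succ_eq_add_one]; ring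

theorem exists_homogeneous_sum (f : polyFun V) :
    ∃ (N : ℕ) (F : ℕ → polyFun V), (∀ m, F m ∈ linSub V ^ m) ∧
      f = ∑ m ∈ Finset.range N, F m := by
  have key : f ∈ ⨆ m : ℕ, linSub V ^ m := by
    induction f using polyFun_induction with
    | hC r =>
      refine Submodule.mem_iSup_of_mem 0 ?_
      rw [pow_zero]
      exact Submodule.algebraMap_mem r
    | hlin φ =>
      refine Submodule.mem_iSup_of_mem 1 ?_
      rw [pow_one]
      exact ⟨φ, rfl⟩
    | hadd f g hf hg => exact Submodule.add_mem _ hf hg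
    | hmul f g hf hg =>
      have h := Submodule.mul_mem_mul hf hg
      rw [Submodule.iSup_mul] at h
      simp only [Submodule.mul_iSup, ← pow_add] at h
      exact (iSup_le fun i => iSup_le fun j => le_iSup (fun m : ℕ => linSub V ^ m) (i + j)) h
  obtain ⟨F, hF, hs⟩ := (Submodule.mem_iSup_iff_exists_finsupp _ _).1 key
  refine ⟨F.support.sup id + 1, F, hF, ?_⟩
  rw [← hs, Finsupp.sum]
  refine Finset.sum_subset (fun m hm => ?_) fun m _ hm => by simpa using hm
  exact Finset.mem_range.2 (Nat.lt_succ_of_le (Finset.le_sup (f := id) hm))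

theorem lineDeriv_const_mem_polyFun (b : V) (f : V → ℂ) (hf : f ∈ polyFun V) :
    (fun v => lineDeriv ℂ f v b) ∈ polyFun V := by
  induction hf using Algebra.adjoin_induction with
  | mem x hx =>
    obtain ⟨φ, rfl⟩ := hx
    simp only [lineDeriv_poly_lin]
    exact (polyFun V).algebraMap_mem (φ b)
  | algebraMap r =>
    simp only [lineDeriv_poly_const]
    exact (polyFun V).zero_mem
  | add f g hf hg hf' hg' =>
    have h : (fun v => lineDeriv ℂ (f + g) v b)
      = (fun v => lineDeriv ℂ f v b) + fun v => lineDeriv ℂ g v b := by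
      funext v; exact lineDeriv_poly_add hf hg _ _
    rw [h]
    exact (polyFun V).add_mem hf' hg'
  | mul f g hf hg hf' hg' =>
    have h : (fun v => lineDeriv ℂ (f * g) v b)
      = (fun v => lineDeriv ℂ f v b) * g + f * fun v => lineDeriv ℂ g v b := by
      funext v; exact lineDeriv_poly_mul hf hg _ _
    rw [h]
    exact (polyFun V).add_mem ((polyFun V).mul_mem hf' hg) ((polyFun V).mul_mem hf hg')

/-- The derivative `∂_b` of polynomial functions in the constant direction `b`. -/
def constField (b : V) : Derivation ℂ (polyFun V) (polyFun V) :=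
  Derivation.mk'
    { toFun := fun f => ⟨fun v => lineDeriv ℂ f.1 v b, lineDeriv_const_mem_polyFun b f.1 f.2⟩
      map_add' := fun f g => by
        ext v; exact lineDeriv_poly_add f.2 g.2 _ _
      map_smul' := fun c f => by
        ext v
        have h := lineDeriv_poly_mul ((polyFun V).algebraMap_mem c) f.2 v b
        rw [lineDeriv_poly_const, zero_mul, zero_add, ← Algebra.smul_def] at h
        exact h }
    (fun f g => by
      ext v
      change lineDeriv ℂ (f.1 * g.1) v b = f.1 v * lineDeriv ℂ g.1 v b
        + g.1 v * lineDeriv ℂ f.1 v b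
      rw [lineDeriv_poly_mul f.2 g.2]
      ring)

theorem constField_linPoly (b : V) (φ : Module.Dual ℂ V) :
    constField b (linPoly φ) = algebraMap ℂ _ (φ b) := by
  ext v
  exact lineDeriv_poly_lin φ v b

variable (V) in
/-- The Euler derivation `E` of `𝒪_V`. -/
def eulerField : Derivation ℂ (polyFun V) (polyFun V) := vecField (-1)

theorem eulerField_linPoly (φ : Module.Dual ℂ V) : eulerField V (linPoly φ) = linPoly φ := by
  rw [eulerField, vecField_linPoly]
  congr 1
  ext v
  simp

/-- A polynomial function vanishing on a hyperplane `φ = 0` is divisible by `φ`. -/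
theorem exists_eq_linPoly_mul {φ : Module.Dual ℂ V} (hφ : φ ≠ 0) (g : polyFun V)
    (hg : ∀ v, φ v = 0 → g.1 v = 0) : ∃ h : polyFun V, g = linPoly φ * h := by
  obtain ⟨w, hw⟩ : ∃ w, φ w = 1 := by
    obtain ⟨w, hw⟩ : ∃ w, φ w ≠ 0 := by
      by_contra! h
      exact hφ (LinearMap.ext h)
    exact ⟨(φ w)⁻¹ • w, by simp [hw]⟩
  -- modulo `φ`, every polynomial function is its pullback along the projection to the hyperplane
  have key : ∀ f : polyFun V, ∃ h : polyFun V,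
      ∀ v, f.1 v - f.1 (v - φ v • w) = φ v * h.1 v := by
    intro f
    induction f using polyFun_induction with
    | hC r =>
      refine ⟨0, fun v => ?_⟩
      change r - r = φ v * 0
      ring
    | hlin χ =>
      refine ⟨algebraMap ℂ _ (χ w), fun v => ?_⟩
      change χ v - χ (v - φ v • w) = φ v * χ w
      rw [map_sub, map_smul, smul_eq_mul]; ring
    | hadd f g hf hg =>
      obtain ⟨h, hh⟩ := hf
      obtain ⟨k, hk⟩ := hg
      refine ⟨h + k, fun v => ?_⟩
      change (f.1 v + g.1 v) - (f.1 _ + g.1 _) = φ v * (h.1 v + k.1 v)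
      linear_combination hh v + hk v
    | hmul f g hf hg =>
      obtain ⟨h, hh⟩ := hf
      obtain ⟨k, hk⟩ := hg
      refine ⟨h * g + f * k - linPoly φ * h * k, fun v => ?_⟩
      change f.1 v * g.1 v - f.1 _ * g.1 _
        = φ v * (h.1 v * g.1 v + f.1 v * k.1 v - φ v * h.1 v * k.1 v)
      have e1 : f.1 (v - φ v • w) = f.1 v - φ v * h.1 v := by linear_combination -(hh v)
      have e2 : g.1 (v - φ v • w) = g.1 v - φ v * k.1 v := by linear_combination -(hk v)
      rw [e1, e2]; ring
  obtain ⟨h, hh⟩ := key g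
  refine ⟨h, ?_⟩
  ext v
  change g.1 v = φ v * h.1 v
  rw [← hh, hg (v - φ v • w) (by simp [hw]), sub_zero]

end PolyFun

/-! ### The equation of the cone and its ideal -/

section Ideal

variable {V : Type*} [AddCommGroup V] [Module ℂ V] [FiniteDimensional ℂ V] (Q : QuadraticForm ℂ V)

theorem mem_coneIdeal_iff {f : polyFun V} :
    f ∈ coneIdeal Q ↔ ∃ g : polyFun V, ∀ v, f.1 v = g.1 v * Q v := by
  rw [coneIdeal, Ideal.mem_span_singleton']
  refine exists_congr fun g => ⟨fun h v => ?_, fun h => ?_⟩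
  · rw [← h]; rfl
  · ext v; exact (h v).symm

theorem coneMk_eq_zero_iff {f : polyFun V} : coneMk Q f = 0 ↔ f ∈ coneIdeal Q :=
  Ideal.Quotient.eq_zero_iff_mem

variable {Q}

/-- A linear functional plus a constant is nonzero on the cone, unless both vanish: a multiple
of `Q` vanishes to second order at the origin. -/
theorem lin_add_const_eq_zero {φ : Module.Dual ℂ V} {s : ℂ}
    (h : coneMk Q (linPoly φ) + algebraMap ℂ _ s = 0) : φ = 0 ∧ s = 0 := by
  rw [← (coneMk Q).commutes, ← map_add, coneMk_eq_zero_iff, mem_coneIdeal_iff] at h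
  obtain ⟨g, hg⟩ := h
  have hg' : ∀ v, φ v + s = g.1 v * Q v := hg
  have hs : s = 0 := by simpa using hg' 0
  refine ⟨LinearMap.ext fun v => ?_, hs⟩
  obtain ⟨p, hp⟩ := polyFun_line g 0 v
  have h1 : Polynomial.X * (Polynomial.C (φ v) - Polynomial.X * Polynomial.C (Q v) * p) = 0 := by
    refine Polynomial.funext fun t => ?_
    have h2 := hg' (0 + t • v)
    rw [hp, hs, zero_add, QuadraticMap.map_smul, map_smul, smul_eq_mul, smul_eq_mul] at h2
    simp only [Polynomial.eval_mul, Polynomial.eval_sub, Polynomial.eval_X, Polynomial.eval_C,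
      Polynomial.eval_zero]
    linear_combination h2
  have h3 := (mul_eq_zero.1 h1).resolve_left Polynomial.X_ne_zero
  simpa using congrArg (Polynomial.eval 0) h3

/-- A quadratic form in the ideal of the cone is a multiple of `Q`. -/
theorem quadratic_mem_coneIdeal {f : polyFun V} (hf : f ∈ coneIdeal Q)
    (h2 : ∀ (α : ℂ) v, f.1 (α • v) = α ^ 2 * f.1 v) : ∃ s : ℂ, ∀ v, f.1 v = s * Q v := by
  obtain ⟨g, hg⟩ := (mem_coneIdeal_iff Q).1 hf
  refine ⟨g.1 0, fun v => ?_⟩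
  obtain ⟨p, hp⟩ := polyFun_line g 0 v
  have h1 : Polynomial.X ^ 2 * (Polynomial.C (f.1 v) - p * Polynomial.C (Q v)) = 0 := by
    refine Polynomial.funext fun t => ?_
    have h3 := hg (0 + t • v)
    rw [hp, zero_add, QuadraticMap.map_smul, h2, smul_eq_mul] at h3
    simp only [Polynomial.eval_mul, Polynomial.eval_sub, Polynomial.eval_X, Polynomial.eval_C,
      Polynomial.eval_zero, Polynomial.eval_pow]
    linear_combination h3
  have h3 := congrArg (Polynomial.eval 0)
    ((mul_eq_zero.1 h1).resolve_left (pow_ne_zero 2 Polynomial.X_ne_zero))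
  have h4 : g.1 0 = p.eval 0 := by simpa using hp 0
  simp only [Polynomial.eval_mul, Polynomial.eval_sub, Polynomial.eval_C,
    Polynomial.eval_zero] at h3
  rw [h4]
  linear_combination h3

end Ideal

/-! ### Isotropic vectors and orthonormal bases -/

section Isotropic

variable {V : Type*} [AddCommGroup V] [Module ℂ V] {Q : QuadraticForm ℂ V}

theorem polarBilin_comm (Q : QuadraticForm ℂ V) (x y : V) :
    Q.polarBilin x y = Q.polarBilin y x := QuadraticMap.polar_comm Q x y

theorem polarBilin_self (Q : QuadraticForm ℂ V) (x : V) : Q.polarBilin x x = 2 * Q x := by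
  rw [QuadraticMap.polarBilin_apply_apply, QuadraticMap.polar_self, two_nsmul, two_mul]

theorem quadForm_add (Q : QuadraticForm ℂ V) (x y : V) :
    Q (x + y) = Q x + Q y + Q.polarBilin x y := QuadraticMap.map_add Q x y

theorem eq_zero_of_polarBilin (hQ : Q.polarBilin.Nondegenerate) {x : V}
    (h : ∀ y, Q.polarBilin x y = 0) : x = 0 := hQ.1 x h

variable [FiniteDimensional ℂ V]

theorem exists_isotropic (hn : 2 < Module.finrank ℂ V) : ∃ x : V, x ≠ 0 ∧ Q x = 0 := by
  let b := Module.finBasis ℂ V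
  set v := b ⟨0, by omega⟩ with hv
  set w := b ⟨1, by omega⟩ with hw
  by_cases h : Q w = 0
  · exact ⟨w, b.ne_zero _, h⟩
  obtain ⟨t, ht⟩ := exists_quadratic_eq_zero (b := Q.polarBilin v w) (c := Q v) h (by
    obtain ⟨s, hs⟩ := IsAlgClosed.exists_pow_nat_eq
      (discrim (Q w) (Q.polarBilin v w) (Q v)) two_pos
    exact ⟨s, by rw [← hs, sq]⟩)
  refine ⟨v + t • w, fun h0 => ?_, ?_⟩
  · have h1 := congrArg (fun z => b.repr z ⟨0, by omega⟩) h0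
    simp [hv, hw] at h1
  · rw [quadForm_add, QuadraticMap.map_smul, map_smul, smul_eq_mul, smul_eq_mul]
    linear_combination ht

theorem exists_hyperbolic_pair (hQ : Q.polarBilin.Nondegenerate)
    (hn : 2 < Module.finrank ℂ V) : ∃ x y : V, Q x = 0 ∧ Q y = 0 ∧ Q.polarBilin x y = 1 := by
  obtain ⟨x, hx0, hx⟩ := exists_isotropic (Q := Q) hn
  obtain ⟨y, hy⟩ : ∃ y, Q.polarBilin x y ≠ 0 := by
    by_contra! h
    exact hx0 (eq_zero_of_polarBilin hQ h)
  obtain ⟨z, hz⟩ : ∃ z, Q.polarBilin x z = 1 := ⟨(Q.polarBilin x y)⁻¹ • y, by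
    rw [map_smul, smul_eq_mul, inv_mul_cancel₀ hy]⟩
  refine ⟨x, z - Q z • x, hx, ?_, ?_⟩
  · rw [sub_eq_add_neg, ← neg_smul, quadForm_add, QuadraticMap.map_smul, map_smul, hx,
      polarBilin_comm Q z x, hz]
    simp
  · rw [map_sub, map_smul, polarBilin_self, hx, hz]
    simp

/-- In dimension greater than two, the orthogonal complement of an isotropic vector is not totally
isotropic. -/
theorem exists_orthogonal_anisotropic (hQ : Q.polarBilin.Nondegenerate)
    (hn : 2 < Module.finrank ℂ V) {x y : V} (hxy : Q.polarBilin x y = 1) :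
    ∃ v, Q.polarBilin x v = 0 ∧ Q v ≠ 0 := by
  by_contra! h
  -- a vector orthogonal to `x` and `y`
  obtain ⟨w, hw, hw0⟩ : ∃ w ∈ LinearMap.ker ((Q.polarBilin x).prod (Q.polarBilin y)), w ≠ 0 := by
    refine (Submodule.ne_bot_iff _).1 (LinearMap.ker_ne_bot_of_finrank_lt ?_)
    simpa using hn
  have hw1 : Q.polarBilin x w = 0 := congrArg Prod.fst hw
  have hw2 : Q.polarBilin y w = 0 := congrArg Prod.snd hw
  refine hw0 (eq_zero_of_polarBilin hQ fun v => ?_)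
  set v' := v - Q.polarBilin x v • y with hv'
  have h1 : Q.polarBilin x v' = 0 := by
    rw [hv', map_sub, map_smul, hxy]; simp
  have h2 := h (w + v') (by rw [map_add, hw1, h1, add_zero])
  rw [quadForm_add, h w hw1, h v' h1, zero_add, zero_add, hv', map_sub, map_smul,
    polarBilin_comm Q w y, hw2, smul_zero, sub_zero] at h2
  exact h2

theorem exists_orthonormal_basis (hQ : Q.polarBilin.Nondegenerate) :
    ∃ e : Module.Basis (Fin (Module.finrank ℂ V)) ℂ V,
      ∀ i j, Q.polarBilin (e i) (e j) = if i = j then 1 else 0 := by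
  have hs : LinearMap.IsSymm Q.polarBilin := ⟨fun x y => polarBilin_comm Q x y⟩
  obtain ⟨v, hv⟩ := LinearMap.BilinForm.exists_orthogonal_basis hs
  have hne : ∀ i, Q.polarBilin (v i) (v i) ≠ 0 := fun i h0 => by
    refine v.ne_zero i (eq_zero_of_polarBilin hQ fun y => ?_)
    have : Q.polarBilin (v i) = 0 := v.ext fun j => by
      by_cases hij : i = j
      · rw [← hij, h0]; rfl
      · exact hv hij
    rw [this]; rfl
  choose s hs using fun i => IsAlgClosed.exists_pow_nat_eq (Q.polarBilin (v i) (v i)) two_pos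
  have hs0 : ∀ i, s i ≠ 0 := fun i h0 => hne i (by rw [← hs, h0]; simp)
  refine ⟨v.unitsSMul fun i => (Units.mk0 (s i) (hs0 i))⁻¹, fun i j => ?_⟩
  rw [Module.Basis.unitsSMul_apply, Module.Basis.unitsSMul_apply]
  simp only [Units.smul_def, map_smul, LinearMap.smul_apply, smul_eq_mul, Units.val_inv_eq_inv_val,
    Units.val_mk0]
  split_ifs with h
  · subst h
    have := hs0 i
    rw [← hs]
    field_simp
  · have h0 : Q.polarBilin (v i) (v j) = 0 := hv h
    rw [h0]; simp

end Isotropic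

/-! ### The coordinate ring of the cone -/

section Ring

variable {V : Type*} [AddCommGroup V] [Module ℂ V] [FiniteDimensional ℂ V] (Q : QuadraticForm ℂ V)

/-- The class in `𝒪_C` of the linear functional `B(a, ·)`. -/
def ell : V →ₗ[ℂ] ConeRing Q := (coneMk Q).toLinearMap ∘ₗ linPoly ∘ₗ Q.polarBilin

theorem ell_apply (a : V) : ell Q a = coneMk Q (linPoly (Q.polarBilin a)) := rfl

variable {Q}

theorem exists_ell (hQ : Q.polarBilin.Nondegenerate) (φ : Module.Dual ℂ V) :
    ∃ a, coneMk Q (linPoly φ) = ell Q a := by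
  refine ⟨(LinearMap.BilinForm.toDual Q.polarBilin hQ).symm φ, ?_⟩
  rw [ell_apply]
  congr 2
  ext v
  exact (LinearMap.BilinForm.apply_toDual_symm_apply (hB := hQ) φ v).symm

theorem ell_add_const_eq_zero (hQ : Q.polarBilin.Nondegenerate) {a : V} {s : ℂ}
    (h : ell Q a + algebraMap ℂ _ s = 0) : a = 0 ∧ s = 0 := by
  obtain ⟨h1, h2⟩ := lin_add_const_eq_zero h
  exact ⟨eq_zero_of_polarBilin hQ fun y => by rw [h1]; rfl, h2⟩

theorem ell_injective (hQ : Q.polarBilin.Nondegenerate) : Function.Injective (ell Q) := by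
  rw [injective_iff_map_eq_zero]
  intro a h
  exact (ell_add_const_eq_zero hQ (s := 0) (by rw [h, map_zero, add_zero])).1

/-- To prove a property of a function on the cone, check it on constants and linear functionals
and show that it passes to sums and products. -/
theorem coneRing_induction (hQ : Q.polarBilin.Nondegenerate) {p : ConeRing Q → Prop}
    (hC : ∀ r : ℂ, p (algebraMap ℂ _ r)) (hlin : ∀ a, p (ell Q a))
    (hadd : ∀ f g, p f → p g → p (f + g)) (hmul : ∀ f g, p f → p g → p (f * g))
    (f : ConeRing Q) : p f := by
  obtain ⟨f, rfl⟩ := coneMk_surjective Q f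
  induction f using polyFun_induction with
  | hC r => rw [(coneMk Q).commutes]; exact hC r
  | hlin φ =>
    obtain ⟨a, ha⟩ := exists_ell hQ φ
    rw [ha]; exact hlin a
  | hadd f g hf hg => rw [map_add]; exact hadd _ _ hf hg
  | hmul f g hf hg => rw [map_mul]; exact hmul _ _ hf hg

/-- `B(x, ·)` is not a zero divisor on the cone for `x ≠ 0`: if `B(x, ·) f = Q g`, then `g`
vanishes on the hyperplane `x^⊥`, on which `Q` is not identically zero. -/
theorem ell_mul_eq_zero (hQ : Q.polarBilin.Nondegenerate) (hn : 2 < Module.finrank ℂ V)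
    {x y : V} (hxy : Q.polarBilin x y = 1) {f : ConeRing Q}
    (h : ell Q x * f = 0) : f = 0 := by
  obtain ⟨f, rfl⟩ := coneMk_surjective Q f
  rw [ell_apply, ← map_mul, coneMk_eq_zero_iff, mem_coneIdeal_iff] at h
  obtain ⟨g, hg⟩ := h
  have hg' : ∀ v, Q.polarBilin x v * f.1 v = g.1 v * Q v := hg
  obtain ⟨v₀, hv₀, hv₀'⟩ := exists_orthogonal_anisotropic hQ hn hxy
  have hgx : ∀ v, Q.polarBilin x v = 0 → g.1 v = 0 := by
    intro v hv
    have h1 : ∀ t : ℂ, g.1 (v₀ + t • (v - v₀)) * (quadPoly Q).1 (v₀ + t • (v - v₀)) = 0 := by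
      intro t
      change g.1 _ * Q _ = 0
      rw [← hg', map_add, map_smul, map_sub, hv, hv₀]; simp
    have h2 := polyFun_eq_zero_on_line h1 (s := 0) (by simpa [quadPoly] using hv₀') 1
    simpa using h2
  have hx0 : Q.polarBilin x ≠ 0 := fun h0 => by
    rw [h0] at hxy; simp at hxy
  obtain ⟨k, hk⟩ := exists_eq_linPoly_mul hx0 g hgx
  rw [coneMk_eq_zero_iff, mem_coneIdeal_iff]
  refine ⟨k, fun v => ?_⟩
  have hk' : ∀ w, g.1 w = Q.polarBilin x w * k.1 w := fun w => by rw [hk]; rfl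
  have h1 : ∀ t : ℂ, (f - k * quadPoly Q).1 (v + t • y) *
      (linPoly (Q.polarBilin x)).1 (v + t • y) = 0 := by
    intro t
    change (f.1 (v + t • y) - k.1 (v + t • y) * Q (v + t • y)) * Q.polarBilin x (v + t • y) = 0
    linear_combination hg' (v + t • y) + Q (v + t • y) * hk' (v + t • y)
  have h2 := polyFun_eq_zero_on_line h1 (s := 1 - Q.polarBilin x v) (by
    rw [linPoly_apply, map_add, map_smul, hxy]; simp) 0
  rw [zero_smul, add_zero] at h2
  change f.1 v - k.1 v * Q v = 0 at h2
  linear_combination h2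

end Ring

/-! ### Weights of functions on the cone -/

section Weights

variable {V : Type*} [AddCommGroup V] [Module ℂ V] [FiniteDimensional ℂ V] {Q : QuadraticForm ℂ V}

/-- The powers of a variable unit are linearly independent functions. -/
theorem eq_zero_of_weight {W : Type*} [AddCommGroup W] [Module ℂ W] (N : ℕ) (c : ℕ → W) (l : ℤ)
    (h : ∀ α : ℂˣ, ∑ m ∈ Finset.range N, (α : ℂ) ^ m • c m
      = ((α ^ l : ℂˣ) : ℂ) • ∑ m ∈ Finset.range N, c m)
    {m : ℕ} (hm : m < N) (hml : (m : ℤ) ≠ l) : c m = 0 := by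
  rw [← Module.forall_dual_apply_eq_zero_iff ℂ]
  intro χ
  set s := ∑ m ∈ Finset.range N, χ (c m) with hs
  -- negative powers are cleared by a common factor
  have h1 : (∑ m ∈ Finset.range N, Polynomial.C (χ (c m)) * Polynomial.X ^ (m + (-l).toNat))
      - Polynomial.C s * Polynomial.X ^ l.toNat = 0 := by
    refine Polynomial.eq_zero_of_infinite_isRoot _ (Set.Infinite.mono (s := {0}ᶜ) ?_
      (Set.finite_singleton 0).infinite_compl)
    intro α (hα : α ≠ 0)
    have h2 := congrArg χ (h (Units.mk0 α hα))
    simp only [map_sum, map_smul, smul_eq_mul, Units.val_mk0, ← hs] at h2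
    have h3 : (((Units.mk0 α hα) ^ l : ℂˣ) : ℂ) * α ^ (-l).toNat = α ^ l.toNat := by
      rw [Units.val_zpow_eq_zpow_val, Units.val_mk0, ← zpow_natCast, ← zpow_natCast,
        ← zpow_add₀ hα]
      congr 1
      omega
    simp only [Set.mem_ofPred_eq, Polynomial.IsRoot, Polynomial.eval_sub, Polynomial.eval_mul,
      Polynomial.eval_finsetSum, Polynomial.eval_pow, Polynomial.eval_X, Polynomial.eval_C]
    have h4 : ∀ m, χ (c m) * α ^ (m + (-l).toNat) = α ^ m * χ (c m) * α ^ (-l).toNat := fun m => by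
      rw [pow_add]; ring
    simp only [h4]
    rw [← Finset.sum_mul, h2, ← h3]
    ring
  have h5 := congrArg (fun p => Polynomial.coeff p (m + (-l).toNat)) h1
  simp only [Polynomial.coeff_sub, Polynomial.finsetSum_coeff, Polynomial.coeff_C_mul,
    Polynomial.coeff_X_pow, add_left_inj, Polynomial.coeff_zero, mul_ite, mul_one, mul_zero] at h5
  rw [if_neg (by omega), Finset.sum_ite_eq, if_pos (Finset.mem_range.2 hm), sub_zero] at h5
  exact h5

theorem scaleC_homogeneous {m : ℕ} {f : polyFun V} (hf : f ∈ linSub V ^ m) (α : ℂ) :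
    scaleC Q α (coneMk Q f) = α ^ m • coneMk Q f := by
  rw [← map_smul]
  change coneMk Q (scaleV α f) = _
  congr 1
  ext v
  exact homogeneous_apply_smul hf α v

/-- A function on the cone of weight `l` is zero, or `l` is a natural number and it is the class
of a homogeneous polynomial function of degree `l`. -/
theorem eq_coneMk_of_weight {l : ℤ} {a : ConeRing Q}
    (h : ∀ α : ℂˣ, scaleC Q (α : ℂ) a = ((α ^ l : ℂˣ) : ℂ) • a) :
    a = 0 ∨ ∃ m : ℕ, (m : ℤ) = l ∧ ∃ f ∈ linSub V ^ m, a = coneMk Q f := by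
  obtain ⟨f, rfl⟩ := coneMk_surjective Q a
  obtain ⟨N, F, hF, rfl⟩ := exists_homogeneous_sum f
  simp only [map_sum, scaleC_homogeneous (hF _)] at h
  have h0 : ∀ m < N, (m : ℤ) ≠ l → coneMk Q (F m) = 0 := fun m hm hml =>
    eq_zero_of_weight N (fun m => coneMk Q (F m)) l h hm hml
  rw [map_sum]
  by_cases hl : ∃ m < N, (m : ℤ) = l
  · obtain ⟨m, hm, hml⟩ := hl
    refine Or.inr ⟨m, hml, F m, hF m, Finset.sum_eq_single_of_mem m (Finset.mem_range.2 hm) ?_⟩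
    intro j hj hjm
    exact h0 j (Finset.mem_range.1 hj) (by omega)
  · push Not at hl
    exact Or.inl (Finset.sum_eq_zero fun m hm =>
      h0 m (Finset.mem_range.1 hm) (hl m (Finset.mem_range.1 hm)))

theorem eq_zero_of_neg_weight {l : ℤ} (hl : l < 0) {a : ConeRing Q}
    (h : ∀ α : ℂˣ, scaleC Q (α : ℂ) a = ((α ^ l : ℂˣ) : ℂ) • a) : a = 0 := by
  obtain h | ⟨m, hm, -⟩ := eq_coneMk_of_weight h
  · exact h
  · omega

theorem eq_const_of_weight_zero {a : ConeRing Q}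
    (h : ∀ α : ℂˣ, scaleC Q (α : ℂ) a = a) : ∃ s, a = algebraMap ℂ _ s := by
  obtain h | ⟨m, hm, f, hf, rfl⟩ := eq_coneMk_of_weight (l := 0) (a := a) fun α => by
      rw [h, zpow_zero, Units.val_one, one_smul]
  · exact ⟨0, by rw [h, map_zero]⟩
  · obtain rfl : m = 0 := by omega
    rw [pow_zero] at hf
    obtain ⟨s, rfl⟩ := Submodule.mem_one.1 hf
    exact ⟨s, (coneMk Q).commutes s⟩

theorem eq_ell_of_weight_one (hQ : Q.polarBilin.Nondegenerate) {a : ConeRing Q}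
    (h : ∀ α : ℂˣ, scaleC Q (α : ℂ) a = (α : ℂ) • a) : ∃ b, a = ell Q b := by
  obtain h | ⟨m, hm, f, hf, rfl⟩ := eq_coneMk_of_weight (l := 1) (a := a) fun α => by
      rw [h, zpow_one]
  · exact ⟨0, by rw [h, map_zero]⟩
  · obtain rfl : m = 1 := by omega
    rw [pow_one] at hf
    obtain ⟨φ, rfl⟩ := hf
    exact exists_ell hQ φ

theorem scaleC_ell (α : ℂ) (a : V) : scaleC Q α (ell Q a) = α • ell Q a := by
  have h := scaleC_homogeneous (Q := Q) (m := 1) (f := linPoly (Q.polarBilin a))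
    (by rw [pow_one]; exact ⟨_, rfl⟩) α
  rwa [pow_one] at h

end Weights

section Wedge

variable {V : Type*} [AddCommGroup V] [Module ℂ V] {Q : QuadraticForm ℂ V}

variable (Q) in
/-- The rotation `v ↦ B(b, v) a - B(a, v) b` in `𝔬(V, Q)`. -/
def wedge (b a : V) : orth Q :=
  ⟨(Q.polarBilin b).smulRight a - (Q.polarBilin a).smulRight b, by
    rw [mem_orth]
    intro x y
    simp only [LinearMap.sub_apply, LinearMap.smulRight_apply, map_sub, map_smul,
      LinearMap.smul_apply, smul_eq_mul, polarBilin_comm Q x a, polarBilin_comm Q x b]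
    ring⟩

theorem wedge_apply (b a v : V) :
    (wedge Q b a).1 v = Q.polarBilin b v • a - Q.polarBilin a v • b := rfl

theorem wedge_self (a : V) : wedge Q a a = 0 := by
  ext v
  change (wedge Q a a).1 v = 0
  rw [wedge_apply, sub_self]

theorem wedge_zero_left (a : V) : wedge Q 0 a = 0 := by
  ext v
  change (wedge Q 0 a).1 v = 0
  rw [wedge_apply]; simp

theorem wedge_zero_right (b : V) : wedge Q b 0 = 0 := by
  ext v
  change (wedge Q b 0).1 v = 0
  rw [wedge_apply]; simp

theorem vecField_wedge (b a : V) (f : polyFun V) :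
    vecField (wedge Q b a).1 f = linPoly (Q.polarBilin a) * constField b f
      - linPoly (Q.polarBilin b) * constField a f := by
  have h : vecField (wedge Q b a).1 = linPoly (Q.polarBilin a) • constField b
      - linPoly (Q.polarBilin b) • constField a := by
    refine derivation_ext fun φ => ?_
    rw [vecField_linPoly, Derivation.sub_apply, Derivation.smul_apply, Derivation.smul_apply,
      constField_linPoly, constField_linPoly]
    ext v
    change -(φ ((wedge Q b a).1 v)) = Q.polarBilin a v * φ b - Q.polarBilin b v * φ a
    rw [wedge_apply, map_sub, map_smul, map_smul, smul_eq_mul, smul_eq_mul]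
    ring
  rw [h]
  rfl

end Wedge

/-! ### Operators on the cone: commutators with linear functionals -/

section Operators

variable {V : Type*} [AddCommGroup V] [Module ℂ V] [FiniteDimensional ℂ V] (Q : QuadraticForm ℂ V)

/-- Multiplication by the linear functional `B(a, ·)` on `𝒪_C`. -/
def xOp : V →ₗ[ℂ] Module.End ℂ (ConeRing Q) := LinearMap.mul ℂ (ConeRing Q) ∘ₗ ell Q

theorem xOp_eq_mulOp (a : V) : xOp Q a = mulOp (ell Q a) := rfl

theorem xOp_apply (a : V) (f : ConeRing Q) : xOp Q a f = ell Q a * f := rfl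

variable {Q}

theorem xOp_mul_comm (a b : V) : xOp Q a * xOp Q b = xOp Q b * xOp Q a :=
  LinearMap.ext fun f => mul_left_comm (ell Q a) (ell Q b) f

theorem lie_xOp_xOp (a b : V) : ⁅xOp Q a, xOp Q b⁆ = 0 := by
  rw [Ring.lie_def, xOp_mul_comm, sub_self]

/-- An operator that commutes with the linear functionals is multiplication by a function. -/
theorem eq_mulOp_of_lie_xOp (hQ : Q.polarBilin.Nondegenerate) {D : Module.End ℂ (ConeRing Q)}
    (h : ∀ a, ⁅D, xOp Q a⁆ = 0) : D = mulOp (D 1) := by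
  have key : ∀ f g : ConeRing Q, D (f * g) = f * D g := by
    intro f
    induction f using coneRing_induction hQ with
    | hC r => intro g; rw [← Algebra.smul_def, ← Algebra.smul_def, map_smul]
    | hlin a =>
      intro g
      exact sub_eq_zero.1 (LinearMap.congr_fun (h a) g)
    | hadd f f' hf hf' => intro g; rw [add_mul, map_add, hf, hf', add_mul]
    | hmul f f' hf hf' => intro g; rw [mul_assoc, hf, hf', mul_assoc]
  ext f
  rw [LinearMap.mulLeft_apply, mul_comm, ← key, mul_one]

/-- An operator on `𝒪_C` is determined by its value at `1` and its commutators with the linear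
functionals. -/
theorem end_ext (hQ : Q.polarBilin.Nondegenerate) {D D' : Module.End ℂ (ConeRing Q)}
    (h1 : D 1 = D' 1) (h : ∀ a, ⁅D, xOp Q a⁆ = ⁅D', xOp Q a⁆) : D = D' := by
  rw [← sub_eq_zero]
  rw [eq_mulOp_of_lie_xOp hQ (D := D - D') fun a => by rw [sub_lie, h, sub_self]]
  rw [LinearMap.sub_apply, h1, sub_self]
  exact LinearMap.mulLeft_zero_eq_zero ℂ _

/-- The operator on `𝒪_C` induced by an operator on `𝒪_V` that preserves the ideal of the cone. -/
def descend (T : Module.End ℂ (polyFun V)) (hT : ∀ f ∈ coneIdeal Q, T f ∈ coneIdeal Q) :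
    Module.End ℂ (ConeRing Q) where
  toFun := Submodule.mapQ ((coneIdeal Q).restrictScalars ℂ) ((coneIdeal Q).restrictScalars ℂ) T hT
  map_add' a b := map_add _ a b
  map_smul' c a := map_smul _ c a

theorem lie_coneField_xOp (Y : orth Q) (a : V) :
    ⁅coneField Q Y, xOp Q a⁆ = xOp Q (Y.1 a) := by
  ext f
  obtain ⟨f, rfl⟩ := coneMk_surjective Q f
  rw [Ring.lie_def]
  simp only [LinearMap.sub_apply, Module.End.mul_apply, xOp_apply, ell_apply, coneField_mk,
    ← map_mul, ← map_sub, Derivation.leibniz, smul_eq_mul]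
  rw [vecField_linPoly]
  have h : -(Q.polarBilin a ∘ₗ Y.1) = Q.polarBilin (Y.1 a) := by
    ext v
    change -(Q.polarBilin a (Y.1 v)) = _
    exact ((mem_orth Q Y.1).1 Y.2 a v).symm
  rw [h]
  congr 1
  ring

theorem coneField_one (Y : orth Q) : coneField Q Y 1 = 0 := by
  rw [← map_one (coneMk Q), coneField_mk, Derivation.map_one_eq_zero, map_zero]

end Operators

/-! ### The Euler operator and the second-order operators -/

section Conformal

variable {V : Type*} [AddCommGroup V] [Module ℂ V] {Q : QuadraticForm ℂ V}
variable {ι : Type*} [Fintype ι]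

theorem eulerField_mul_lin (φ : Module.Dual ℂ V) (f : polyFun V) :
    eulerField V (linPoly φ * f) = linPoly φ * f + linPoly φ * eulerField V f := by
  rw [Derivation.leibniz, eulerField_linPoly, smul_eq_mul, smul_eq_mul]; ring

theorem constField_mul_lin (b : V) (φ : Module.Dual ℂ V) (f : polyFun V) :
    constField b (linPoly φ * f) = linPoly φ * constField b f + algebraMap ℂ _ (φ b) * f := by
  rw [Derivation.leibniz, constField_linPoly, smul_eq_mul, smul_eq_mul, mul_comm f]

theorem derivation_sum_apply (D : ι → Derivation ℂ (polyFun V) (polyFun V)) (f : polyFun V) :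
    (∑ i, D i) f = ∑ i, D i f := by
  have h := map_sum (Derivation.coeFnAddMonoidHom (R := ℂ) (A := polyFun V) (M := polyFun V))
    D Finset.univ
  exact (congrFun h f).trans (Finset.sum_apply f _ _)

/-- The Laplace operator `∑ ∂_{e i}²` of a basis `e` (taken orthonormal in what follows). -/
def laplace (e : Module.Basis ι ℂ V) : Module.End ℂ (polyFun V) :=
  ∑ i, (constField (e i)).toLinearMap ∘ₗ (constField (e i)).toLinearMap

theorem laplace_apply (e : Module.Basis ι ℂ V) (f : polyFun V) :
    laplace e f = ∑ i, constField (e i) (constField (e i) f) := by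
  rw [laplace, LinearMap.sum_apply]; rfl

theorem sum_polarBilin_smul [DecidableEq ι] {e : Module.Basis ι ℂ V}
    (he : ∀ i j, Q.polarBilin (e i) (e j) = if i = j then 1 else 0) (v : V) :
    ∑ i, Q.polarBilin (e i) v • e i = v := by
  conv_rhs => rw [← e.sum_repr v]
  refine Finset.sum_congr rfl fun i _ => ?_
  congr 1
  conv_lhs => rw [← e.sum_repr v, map_sum]
  simp [he]

theorem sum_polarBilin_mul [DecidableEq ι] {e : Module.Basis ι ℂ V}
    (he : ∀ i j, Q.polarBilin (e i) (e j) = if i = j then 1 else 0) (v w : V) :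
    ∑ i, Q.polarBilin (e i) v * Q.polarBilin (e i) w = Q.polarBilin v w := by
  conv_rhs => rw [← sum_polarBilin_smul he v]
  simp

theorem sum_linPoly_mul_constField [DecidableEq ι] {e : Module.Basis ι ℂ V}
    (he : ∀ i j, Q.polarBilin (e i) (e j) = if i = j then 1 else 0) (f : polyFun V) :
    ∑ i, linPoly (Q.polarBilin (e i)) * constField (e i) f = eulerField V f := by
  have h : ∑ i, linPoly (Q.polarBilin (e i)) • constField (e i) = eulerField V := by
    refine derivation_ext fun φ => ?_
    rw [eulerField_linPoly, derivation_sum_apply]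
    simp only [Derivation.smul_apply, constField_linPoly]
    ext v
    rw [AddSubmonoidClass.coe_finsetSum, Finset.sum_apply]
    change ∑ i, Q.polarBilin (e i) v * φ (e i) = φ v
    conv_rhs => rw [← sum_polarBilin_smul he v]
    simp
  rw [← h, derivation_sum_apply]
  rfl

theorem laplace_mul_lin [DecidableEq ι] {e : Module.Basis ι ℂ V}
    (he : ∀ i j, Q.polarBilin (e i) (e j) = if i = j then 1 else 0) (a : V) (f : polyFun V) :
    laplace e (linPoly (Q.polarBilin a) * f)
      = linPoly (Q.polarBilin a) * laplace e f + 2 * constField a f := by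
  have h : constField a f = ∑ i, algebraMap ℂ _ (Q.polarBilin a (e i)) * constField (e i) f := by
    have h1 : constField a = ∑ i, algebraMap ℂ (polyFun V) (Q.polarBilin a (e i)) •
        constField (e i) := by
      refine derivation_ext fun φ => ?_
      rw [derivation_sum_apply]
      simp only [Derivation.smul_apply, constField_linPoly, smul_eq_mul, ← map_mul, ← map_sum]
      congr 1
      conv_lhs => rw [← sum_polarBilin_smul he a]
      simp [polarBilin_comm Q a]
    rw [h1, derivation_sum_apply]
    rfl
  rw [laplace_apply, laplace_apply, h, Finset.mul_sum, Finset.mul_sum, ← Finset.sum_add_distrib]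
  refine Finset.sum_congr rfl fun i _ => ?_
  have h2 : constField (e i) (algebraMap ℂ _ (Q.polarBilin a (e i)) * f)
      = algebraMap ℂ _ (Q.polarBilin a (e i)) * constField (e i) f := by
    rw [← Algebra.smul_def, Derivation.map_smul, Algebra.smul_def]
  rw [constField_mul_lin, map_add, constField_mul_lin, h2]
  ring

variable [FiniteDimensional ℂ V]

theorem sum_linPoly_sq [DecidableEq ι] {e : Module.Basis ι ℂ V}
    (he : ∀ i j, Q.polarBilin (e i) (e j) = if i = j then 1 else 0) :
    ∑ i, linPoly (Q.polarBilin (e i)) * linPoly (Q.polarBilin (e i)) = 2 * quadPoly Q := by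
  ext v
  have h := sum_polarBilin_mul he v v
  rw [polarBilin_self] at h
  rw [AddSubmonoidClass.coe_finsetSum, Finset.sum_apply]
  exact h

theorem laplace_mul_quadPoly [DecidableEq ι] {e : Module.Basis ι ℂ V}
    (he : ∀ i j, Q.polarBilin (e i) (e j) = if i = j then 1 else 0) (f : polyFun V) :
    laplace e (quadPoly Q * f) = quadPoly Q * laplace e f + 2 * eulerField V f
      + (Fintype.card ι : polyFun V) * f := by
  have h2 : (2 : polyFun V) * laplace e (quadPoly Q * f) =
      2 * (quadPoly Q * laplace e f + 2 * eulerField V f + (Fintype.card ι : polyFun V) * f) := by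
    have h3 : (2 : polyFun V) * laplace e (quadPoly Q * f)
        = laplace e ((2 * quadPoly Q) * f) := by
      rw [two_mul, two_mul, add_mul, map_add]
    rw [h3, ← sum_linPoly_sq he, Finset.sum_mul, map_sum]
    simp only [mul_assoc, laplace_mul_lin he, constField_mul_lin, he, if_true, map_one, one_mul,
      mul_add, Finset.sum_add_distrib]
    simp only [mul_left_comm _ (2 : polyFun V), ← Finset.mul_sum]
    simp only [sum_linPoly_mul_constField he]
    simp only [← mul_assoc, ← Finset.sum_mul, sum_linPoly_sq he, Finset.sum_const,
      Finset.card_univ, nsmul_eq_mul]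
    ring
  ext v
  have h4 := congrFun (congrArg Subtype.val h2) v
  exact mul_left_cancel₀ (two_ne_zero (α := ℂ)) h4

end Conformal

section ConeOperators

variable {V : Type*} [AddCommGroup V] [Module ℂ V] [FiniteDimensional ℂ V] {Q : QuadraticForm ℂ V}
variable {ι : Type*} [Fintype ι] [DecidableEq ι] {e : Module.Basis ι ℂ V}

theorem constField_quadPoly (he : ∀ i j, Q.polarBilin (e i) (e j) = if i = j then 1 else 0)
    (b : V) : constField b (quadPoly Q) = linPoly (Q.polarBilin b) := by
  have h := congrArg (constField b) (sum_linPoly_sq he)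
  rw [two_mul, map_add, map_sum] at h
  simp only [constField_mul_lin, constField_linPoly] at h
  ext v
  have h1 := congrFun (congrArg Subtype.val h) v
  rw [AddSubmonoidClass.coe_finsetSum, Finset.sum_apply] at h1
  have h2 : ∑ i, (Q.polarBilin (e i) v * Q.polarBilin (e i) b
      + Q.polarBilin (e i) b * Q.polarBilin (e i) v)
      = (constField b (quadPoly Q)).1 v + (constField b (quadPoly Q)).1 v := h1
  rw [Finset.sum_add_distrib, sum_polarBilin_mul he, sum_polarBilin_mul he,
    polarBilin_comm Q v b] at h2
  change _ = Q.polarBilin b v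
  linear_combination -h2 / 2

theorem eulerField_quadPoly (he : ∀ i j, Q.polarBilin (e i) (e j) = if i = j then 1 else 0) :
    eulerField V (quadPoly Q) = 2 * quadPoly Q := by
  rw [← sum_linPoly_mul_constField he, ← sum_linPoly_sq he]
  simp only [constField_quadPoly he]

variable (V) in
/-- The number `n / 2 - 1`, where `n = dim V`. -/
def shift : ℂ := (Module.finrank ℂ V : ℂ) / 2 - 1

variable (Q e) in
/-- The operator `(E + n / 2 - 1) ∂_b - ½ B(b, ·) Δ` on `𝒪_V`. The constant `n / 2 - 1` is the one
for which it preserves the ideal of the cone. -/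
def polyConf (b : V) : Module.End ℂ (polyFun V) :=
  ((eulerField V).toLinearMap + algebraMap ℂ _ (shift V)) * (constField b).toLinearMap
    - (2⁻¹ : ℂ) • (LinearMap.mulLeft ℂ (linPoly (Q.polarBilin b)) * laplace e)

omit [FiniteDimensional ℂ V] [DecidableEq ι] in
theorem polyConf_apply (b : V) (f : polyFun V) :
    polyConf Q e b f = eulerField V (constField b f) + algebraMap ℂ _ (shift V) * constField b f
      - algebraMap ℂ _ 2⁻¹ * (linPoly (Q.polarBilin b) * laplace e f) := by
  rw [← Algebra.smul_def, ← Algebra.smul_def]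
  rfl

/-- The operator `polyConf` preserves the ideal of the cone: the terms not divisible by `Q` cancel
because `1 + (n / 2 - 1) = n / 2`. -/
theorem polyConf_mul_quadPoly (he : ∀ i j, Q.polarBilin (e i) (e j) = if i = j then 1 else 0)
    (b : V) (g : polyFun V) :
    polyConf Q e b (quadPoly Q * g) = quadPoly Q * (polyConf Q e b g + 2 * constField b g) := by
  have hn : algebraMap ℂ (polyFun V) (shift V)
      = algebraMap ℂ _ 2⁻¹ * (Fintype.card ι : polyFun V) - 1 := by
    rw [← map_natCast (algebraMap ℂ (polyFun V)), ← map_mul, ← map_one (algebraMap ℂ (polyFun V)),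
      ← map_sub, shift, Module.finrank_eq_card_basis e]
    congr 1
    ring
  have h2 : algebraMap ℂ (polyFun V) 2⁻¹ * 2 = 1 := by
    rw [← map_ofNat (algebraMap ℂ (polyFun V)), ← map_mul]
    norm_num
  have h3 : ∀ f, constField b (quadPoly Q * f)
      = quadPoly Q * constField b f + linPoly (Q.polarBilin b) * f := fun f => by
    rw [Derivation.leibniz, constField_quadPoly he, smul_eq_mul, smul_eq_mul, mul_comm f]
  have h4 : ∀ f, eulerField V (quadPoly Q * f)
      = quadPoly Q * eulerField V f + 2 * quadPoly Q * f := fun f => by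
    rw [Derivation.leibniz, eulerField_quadPoly he, smul_eq_mul, smul_eq_mul, mul_comm f]
  rw [polyConf_apply, polyConf_apply, h3, map_add, h4, eulerField_mul_lin,
    laplace_mul_quadPoly he, hn]
  linear_combination (-linPoly (Q.polarBilin b) * eulerField V g) * h2

theorem polyConf_mem (he : ∀ i j, Q.polarBilin (e i) (e j) = if i = j then 1 else 0) (b : V) :
    ∀ f ∈ coneIdeal Q, polyConf Q e b f ∈ coneIdeal Q := by
  intro f hf
  obtain ⟨g, rfl⟩ := Ideal.mem_span_singleton'.1 hf
  rw [mul_comm, polyConf_mul_quadPoly he]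
  exact Ideal.mul_mem_right _ _ (Ideal.mem_span_singleton_self _)

theorem eulerField_mem (he : ∀ i j, Q.polarBilin (e i) (e j) = if i = j then 1 else 0) :
    ∀ f ∈ coneIdeal Q, (eulerField V).toLinearMap f ∈ coneIdeal Q := by
  intro f hf
  obtain ⟨g, rfl⟩ := Ideal.mem_span_singleton'.1 hf
  change eulerField V _ ∈ _
  rw [Derivation.leibniz, eulerField_quadPoly he, smul_eq_mul, smul_eq_mul]
  exact Ideal.add_mem _ (Ideal.mul_mem_left _ _ (Ideal.mul_mem_left _ _
    (Ideal.mem_span_singleton_self _))) (Ideal.mul_mem_right _ _ (Ideal.mem_span_singleton_self _))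

/-- The Euler operator on `𝒪_C`. -/
def eulerOp (he : ∀ i j, Q.polarBilin (e i) (e j) = if i = j then 1 else 0) :
    Module.End ℂ (ConeRing Q) :=
  descend _ (eulerField_mem he)

/-- The operator `E + n / 2 - 1` on `𝒪_C`. -/
def hOp (he : ∀ i j, Q.polarBilin (e i) (e j) = if i = j then 1 else 0) :
    Module.End ℂ (ConeRing Q) :=
  eulerOp he + algebraMap ℂ _ (shift V)

/-- The second-order operator `P_b` on `𝒪_C` induced by `(E + n / 2 - 1) ∂_b - ½ B(b, ·) Δ`. -/
def confOp (he : ∀ i j, Q.polarBilin (e i) (e j) = if i = j then 1 else 0) (b : V) :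
    Module.End ℂ (ConeRing Q) :=
  descend _ (polyConf_mem he b)

variable (Q) in
/-- The operator on `𝒪_C` induced by `Y ∈ 𝔬(V, Q)`, as a linear function of `Y`. -/
def fieldOp : orth Q →ₗ[ℂ] Module.End ℂ (ConeRing Q) :=
  (coneDiffOps Q).val.toLinearMap ∘ₗ iotaD Q

variable (he : ∀ i j, Q.polarBilin (e i) (e j) = if i = j then 1 else 0)

theorem lie_fieldOp_xOp (Y : orth Q) (a : V) : ⁅fieldOp Q Y, xOp Q a⁆ = xOp Q (Y.1 a) :=
  lie_coneField_xOp Y a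

theorem fieldOp_one (Y : orth Q) : fieldOp Q Y 1 = 0 := coneField_one Y

theorem eulerOp_one : eulerOp he 1 = 0 := by
  rw [← map_one (coneMk Q)]
  change coneMk Q (eulerField V 1) = 0
  rw [Derivation.map_one_eq_zero, map_zero]

theorem hOp_one : hOp he 1 = algebraMap ℂ _ (shift V) := by
  rw [hOp, LinearMap.add_apply, eulerOp_one, zero_add, Module.algebraMap_end_apply,
    Algebra.algebraMap_eq_smul_one]

theorem confOp_one (b : V) : confOp he b 1 = 0 := by
  rw [← map_one (coneMk Q)]
  change coneMk Q (polyConf Q e b 1) = 0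
  rw [polyConf_apply, laplace_apply]
  simp only [Derivation.map_one_eq_zero, map_zero, Finset.sum_const_zero, mul_zero, add_zero,
    sub_zero]

theorem lie_eulerOp_xOp (a : V) : ⁅eulerOp he, xOp Q a⁆ = xOp Q a := by
  ext f
  obtain ⟨f, rfl⟩ := coneMk_surjective Q f
  change coneMk Q (eulerField V (linPoly (Q.polarBilin a) * f))
    - coneMk Q (linPoly (Q.polarBilin a) * eulerField V f) = coneMk Q (linPoly (Q.polarBilin a) * f)
  rw [eulerField_mul_lin, map_add, add_sub_cancel_right]

theorem lie_algebraMap (s : ℂ) (D : Module.End ℂ (ConeRing Q)) :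
    ⁅algebraMap ℂ (Module.End ℂ (ConeRing Q)) s, D⁆ = 0 := by
  rw [Ring.lie_def, Algebra.commutes, sub_self]

theorem lie_hOp_xOp (a : V) : ⁅hOp he, xOp Q a⁆ = xOp Q a := by
  rw [hOp, add_lie, lie_algebraMap, add_zero, lie_eulerOp_xOp]

theorem lie_confOp_xOp (b a : V) : ⁅confOp he b, xOp Q a⁆
    = Q.polarBilin b a • hOp he + fieldOp Q (wedge Q b a) := by
  ext f
  obtain ⟨f, rfl⟩ := coneMk_surjective Q f
  change coneMk Q (polyConf Q e b (linPoly (Q.polarBilin a) * f))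
    - coneMk Q (linPoly (Q.polarBilin a) * polyConf Q e b f)
    = Q.polarBilin b a • (coneMk Q (eulerField V f) + shift V • coneMk Q f)
      + coneMk Q (vecField (wedge Q b a).1 f)
  rw [vecField_wedge, ← map_smul, ← map_add, ← map_smul, ← map_add, ← map_sub]
  congr 1
  rw [polyConf_apply, polyConf_apply, constField_mul_lin, map_add, eulerField_mul_lin,
    laplace_mul_lin he, Algebra.smul_def, Algebra.smul_def, ← Algebra.smul_def _ f,
    Derivation.map_smul, Algebra.smul_def, Algebra.smul_def, polarBilin_comm Q a b]
  have h2 : algebraMap ℂ (polyFun V) 2⁻¹ * 2 = 1 := by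
    rw [← map_ofNat (algebraMap ℂ (polyFun V)), ← map_mul]
    norm_num
  linear_combination (-linPoly (Q.polarBilin b) * constField a f) * h2

variable (hQ : Q.polarBilin.Nondegenerate)
include hQ

theorem confOp_add (b b' : V) : confOp he (b + b') = confOp he b + confOp he b' := by
  refine end_ext hQ (by rw [LinearMap.add_apply]; simp only [confOp_one, add_zero]) fun a => ?_
  have h : wedge Q (b + b') a = wedge Q b a + wedge Q b' a := by
    ext v
    change (wedge Q (b + b') a).1 v = (wedge Q b a).1 v + (wedge Q b' a).1 v
    simp only [wedge_apply, map_add, LinearMap.add_apply]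
    module
  rw [add_lie, lie_confOp_xOp, lie_confOp_xOp, lie_confOp_xOp, h, map_add, map_add,
    LinearMap.add_apply]
  module

theorem confOp_smul (s : ℂ) (b : V) : confOp he (s • b) = s • confOp he b := by
  refine end_ext hQ (by rw [LinearMap.smul_apply]; simp only [confOp_one, smul_zero]) fun a => ?_
  have h : wedge Q (s • b) a = s • wedge Q b a := by
    ext v
    change (wedge Q (s • b) a).1 v = s • (wedge Q b a).1 v
    simp only [wedge_apply, map_smul, LinearMap.smul_apply]
    module
  rw [smul_lie, lie_confOp_xOp, lie_confOp_xOp, h, map_smul, map_smul, LinearMap.smul_apply]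
  module

theorem lie_fieldOp_fieldOp (Y Y' : orth Q) :
    ⁅fieldOp Q Y, fieldOp Q Y'⁆ = fieldOp Q ⁅Y, Y'⁆ := by
  refine end_ext hQ ?_ fun a => ?_
  · rw [Ring.lie_def, LinearMap.sub_apply, Module.End.mul_apply, Module.End.mul_apply]
    simp only [fieldOp_one, map_zero, sub_zero]
  · rw [lie_lie]
    simp only [lie_fieldOp_xOp]
    rw [← map_sub]
    rfl

theorem lie_fieldOp_hOp (Y : orth Q) : ⁅fieldOp Q Y, hOp he⁆ = 0 := by
  refine end_ext hQ ?_ fun a => ?_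
  · rw [Ring.lie_def, LinearMap.sub_apply, Module.End.mul_apply, Module.End.mul_apply]
    rw [hOp_one, fieldOp_one, map_zero, Algebra.algebraMap_eq_smul_one, map_smul, fieldOp_one,
      smul_zero, sub_zero]
    rfl
  · rw [lie_lie, zero_lie]
    simp only [lie_fieldOp_xOp, lie_hOp_xOp, sub_self]

theorem lie_hOp_confOp (b : V) : ⁅hOp he, confOp he b⁆ = -confOp he b := by
  refine end_ext hQ ?_ fun a => ?_
  · rw [Ring.lie_def, LinearMap.sub_apply, Module.End.mul_apply, Module.End.mul_apply]
    rw [hOp_one, confOp_one, map_zero, Algebra.algebraMap_eq_smul_one, map_smul, confOp_one,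
      LinearMap.neg_apply, confOp_one, smul_zero, sub_zero, neg_zero]
  · rw [lie_lie, neg_lie]
    simp only [lie_confOp_xOp, lie_hOp_xOp, lie_add, lie_smul, lie_self]
    rw [← lie_skew, lie_fieldOp_hOp he hQ]
    simp

theorem lie_fieldOp_confOp (Y : orth Q) (b : V) :
    ⁅fieldOp Q Y, confOp he b⁆ = confOp he (Y.1 b) := by
  refine end_ext hQ ?_ fun a => ?_
  · rw [Ring.lie_def, LinearMap.sub_apply, Module.End.mul_apply, Module.End.mul_apply]
    simp only [confOp_one, fieldOp_one, map_zero, sub_zero]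
  · have h : ⁅Y, wedge Q b a⁆ = wedge Q (Y.1 b) a + wedge Q b (Y.1 a) := by
      ext v
      change Y.1 ((wedge Q b a).1 v) - (wedge Q b a).1 (Y.1 v)
        = (wedge Q (Y.1 b) a).1 v + (wedge Q b (Y.1 a)).1 v
      have h1 := (mem_orth Q Y.1).1 Y.2
      simp only [wedge_apply, map_sub, map_smul, h1]
      module
    have h1 := (mem_orth Q Y.1).1 Y.2 b a
    rw [lie_lie, lie_fieldOp_xOp, lie_confOp_xOp, lie_confOp_xOp, lie_confOp_xOp, lie_add,
      lie_smul, lie_fieldOp_hOp he hQ, lie_fieldOp_fieldOp hQ, h, map_add, h1]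
    module

theorem lie_confOp_confOp (b b' : V) : ⁅confOp he b, confOp he b'⁆ = 0 := by
  refine end_ext hQ ?_ fun a => ?_
  · rw [Ring.lie_def, LinearMap.sub_apply, Module.End.mul_apply, Module.End.mul_apply]
    simp only [confOp_one, map_zero, sub_zero]
    rfl
  · have h1 : ∀ b, ⁅confOp he b, hOp he⁆ = confOp he b := fun b => by
      rw [← lie_skew, lie_hOp_confOp he hQ, neg_neg]
    have h2 : ∀ b (Y : orth Q), ⁅confOp he b, fieldOp Q Y⁆ = - confOp he (Y.1 b) := fun b Y => by
      rw [← lie_skew, lie_fieldOp_confOp he hQ]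
    have h3 : ∀ b b', confOp he (b - b') = confOp he b - confOp he b' := fun b b' => by
      rw [sub_eq_add_neg, confOp_add he hQ, ← neg_one_smul ℂ b', confOp_smul he hQ]
      module
    rw [lie_lie, zero_lie]
    simp only [lie_confOp_xOp, lie_add, lie_smul, h1, h2, wedge_apply, h3, confOp_smul he hQ]
    rw [polarBilin_comm Q b' b, polarBilin_comm Q a b, polarBilin_comm Q a b']
    module

end ConeOperators

/-! ### Orders of operators on the cone -/

section Order

variable {V : Type*} [AddCommGroup V] [Module ℂ V] [FiniteDimensional ℂ V] {Q : QuadraticForm ℂ V}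

theorem IsDiffOp.neg {A : Type*} [CommRing A] [Algebra ℂ A] {k : ℕ} {D : Module.End ℂ A}
    (h : IsDiffOp k D) : IsDiffOp k (-D) := by
  rw [← neg_one_smul ℂ]; exact h.smul _

theorem isDiffOp_xOp (a : V) : IsDiffOp 0 (xOp Q a) := isDiffOp_mulOp _

theorem isDiffOp_zero_iff (hQ : Q.polarBilin.Nondegenerate) {D : Module.End ℂ (ConeRing Q)} :
    IsDiffOp 0 D ↔ ∀ a, ⁅D, xOp Q a⁆ = 0 := by
  constructor
  · intro h a
    have h1 := h (ell Q a)
    rw [Ring.lie_def, ← neg_sub]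
    exact neg_eq_zero.2 h1
  · intro h
    rw [eq_mulOp_of_lie_xOp hQ h]
    exact isDiffOp_mulOp _

/-- The order of an operator on `𝒪_C` can be tested on commutators with linear functionals. -/
theorem isDiffOp_succ_iff (hQ : Q.polarBilin.Nondegenerate) {k : ℕ}
    {D : Module.End ℂ (ConeRing Q)} :
    IsDiffOp (k + 1) D ↔ ∀ a, IsDiffOp k ⁅D, xOp Q a⁆ := by
  constructor
  · intro h a
    have h1 := (h (ell Q a)).neg
    rwa [neg_sub] at h1
  · intro h f
    induction f using coneRing_induction hQ with
    | hC r =>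
      have h1 : mulOp (algebraMap ℂ (ConeRing Q) r) = algebraMap ℂ (Module.End ℂ _) r := by
        ext f; simp [Algebra.smul_def]
      rw [h1, Algebra.commutes, sub_self]
      exact IsDiffOp.zero k
    | hlin a =>
      have h1 := (h a).neg
      rwa [Ring.lie_def, neg_sub] at h1
    | hadd f g hf hg =>
      have h1 : mulOp (f + g) * D - D * mulOp (f + g)
          = (mulOp f * D - D * mulOp f) + (mulOp g * D - D * mulOp g) := by
        rw [show mulOp (f + g) = mulOp f + mulOp g from map_add (LinearMap.mul ℂ _) f g]
        noncomm_ring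
      rw [h1]
      exact hf.add hg
    | hmul f g hf hg =>
      have h1 : mulOp (f * g) * D - D * mulOp (f * g)
          = mulOp f * (mulOp g * D - D * mulOp g) + (mulOp f * D - D * mulOp f) * mulOp g := by
        rw [show mulOp (f * g) = mulOp f * mulOp g from LinearMap.ext fun h => mul_assoc f g h]
        noncomm_ring
      rw [h1]
      refine IsDiffOp.add ?_ ?_
      · simpa using (isDiffOp_mulOp f).mul hg
      · simpa using hf.mul (isDiffOp_mulOp g)

variable {ι : Type*} [Fintype ι] [DecidableEq ι] {e : Module.Basis ι ℂ V}
variable (he : ∀ i j, Q.polarBilin (e i) (e j) = if i = j then 1 else 0)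

theorem isDiffOp_fieldOp (Y : orth Q) : IsDiffOp 1 (fieldOp Q Y) := coneField_isDiffOp Q Y

theorem isDiffOp_hOp (hQ : Q.polarBilin.Nondegenerate) : IsDiffOp 1 (hOp he) := by
  rw [isDiffOp_succ_iff hQ]
  intro a
  rw [lie_hOp_xOp]
  exact isDiffOp_xOp a

theorem isDiffOp_confOp (hQ : Q.polarBilin.Nondegenerate) (b : V) :
    IsDiffOp 2 (confOp he b) := by
  rw [isDiffOp_succ_iff hQ]
  intro a
  rw [lie_confOp_xOp]
  exact ((isDiffOp_hOp he hQ).smul _).add (isDiffOp_fieldOp _)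

end Order

/-! ### Coordinates on `𝔬(Ṽ, Q̃)` -/

section Coordinates

variable {V : Type*} [AddCommGroup V] [Module ℂ V] (Q : QuadraticForm ℂ V)

/-- The component in `V` of `X v₂`. -/
def aPart : gAlg Q →ₗ[ℂ] V where
  toFun X := (X.1 (vTwo V)).1
  map_add' _ _ := rfl
  map_smul' _ _ := rfl

/-- The component in `V` of `X v₁`. -/
def bPart : gAlg Q →ₗ[ℂ] V where
  toFun X := (X.1 (vOne V)).1
  map_add' _ _ := rfl
  map_smul' _ _ := rfl

/-- The coefficient of `v₁` in `X v₁`. -/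
def cPart : gAlg Q →ₗ[ℂ] ℂ where
  toFun X := (X.1 (vOne V)).2.1
  map_add' _ _ := rfl
  map_smul' _ _ := rfl

/-- The compression of `X` to `V`. -/
def rotPart : gAlg Q →ₗ[ℂ] orth Q where
  toFun X := ⟨LinearMap.fst ℂ V (ℂ × ℂ) ∘ₗ X.1 ∘ₗ LinearMap.inl ℂ V (ℂ × ℂ), by
    rw [mem_orth]
    intro x y
    have h : extBilin Q (X.1 (x, 0)) (y, 0) = - extBilin Q (x, 0) (X.1 (y, 0)) :=
      (mem_orth _ X.1).1 X.2 (x, 0) (y, 0)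
    rw [extBilin_apply, extBilin_apply] at h
    simpa using h⟩
  map_add' X Y := by ext v; rfl
  map_smul' c X := by ext v; rfl

variable {Q}

/-- An element of `𝔬(Ṽ, Q̃)` in terms of its coordinates. -/
theorem gAlg_apply (X : gAlg Q) (v : V) (s t : ℂ) :
    X.1 (v, (s, t)) = ((rotPart Q X).1 v + s • bPart Q X + t • aPart Q X,
      (-Q.polarBilin (aPart Q X) v + s * cPart Q X,
        -Q.polarBilin (bPart Q X) v - t * cPart Q X)) := by
  have hskew : ∀ x y, extBilin Q (X.1 x) y = - extBilin Q x (X.1 y) := (mem_orth _ X.1).1 X.2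
  have h0 : ((v, (s, t)) : V × (ℂ × ℂ)) = (v, 0) + s • vOne V + t • vTwo V := by
    refine Prod.ext ?_ (Prod.ext ?_ ?_) <;> simp [vOne, vTwo]
  have h1 : (X.1 (v, 0)).2.1 = -Q.polarBilin (aPart Q X) v := by
    have h := hskew (vTwo V) (v, 0)
    rw [extBilin_apply, extBilin_apply] at h
    simp only [vTwo, map_zero, LinearMap.zero_apply, zero_mul, one_mul, zero_add,
      Prod.fst_zero, Prod.snd_zero, mul_zero, add_zero] at h
    change Q.polarBilin (aPart Q X) v = _ at h
    rw [h, neg_neg]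
  have h2 : (X.1 (v, 0)).2.2 = -Q.polarBilin (bPart Q X) v := by
    have h := hskew (vOne V) (v, 0)
    rw [extBilin_apply, extBilin_apply] at h
    simp only [vOne, map_zero, LinearMap.zero_apply, zero_mul, one_mul, zero_add,
      Prod.fst_zero, Prod.snd_zero, mul_zero, add_zero] at h
    change Q.polarBilin (bPart Q X) v = _ at h
    rw [h, neg_neg]
  have h3 : (X.1 (vOne V)).2.2 = 0 := by
    have h := hskew (vOne V) (vOne V)
    rw [extBilin_apply, extBilin_apply] at h
    simp only [vOne, map_zero, LinearMap.zero_apply, zero_mul, one_mul, zero_add, mul_one,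
      mul_zero, add_zero] at h
    change (X.1 (vOne V)).2.2 = -(X.1 (vOne V)).2.2 at h
    linear_combination h / 2
  have h4 : (X.1 (vTwo V)).2.1 = 0 := by
    have h := hskew (vTwo V) (vTwo V)
    rw [extBilin_apply, extBilin_apply] at h
    simp only [vTwo, map_zero, LinearMap.zero_apply, zero_mul, one_mul, zero_add, mul_one,
      mul_zero, add_zero] at h
    change (X.1 (vTwo V)).2.1 = -(X.1 (vTwo V)).2.1 at h
    linear_combination h / 2
  have h5 : (X.1 (vTwo V)).2.2 = -(X.1 (vOne V)).2.1 := by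
    have h := hskew (vTwo V) (vOne V)
    rw [extBilin_apply, extBilin_apply] at h
    simp only [vTwo, vOne, map_zero, LinearMap.zero_apply, zero_mul, one_mul, zero_add, mul_one,
      mul_zero] at h
    exact h
  rw [h0, map_add, map_add, map_smul, map_smul]
  refine Prod.ext rfl (Prod.ext ?_ ?_)
  · change (X.1 (v, 0)).2.1 + s * cPart Q X + t * (X.1 (vTwo V)).2.1 = _
    rw [h1, h4, mul_zero, add_zero]
  · change (X.1 (v, 0)).2.2 + s * (X.1 (vOne V)).2.2 + t * (X.1 (vTwo V)).2.2 = _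
    rw [h2, h3, h5]
    change _ = _ - t * (X.1 (vOne V)).2.1
    ring

theorem gAlg_ext {X X' : gAlg Q} (hr : rotPart Q X = rotPart Q X') (ha : aPart Q X = aPart Q X')
    (hb : bPart Q X = bPart Q X') (hc : cPart Q X = cPart Q X') : X = X' := by
  refine Subtype.ext (LinearMap.ext fun ⟨v, s, t⟩ => ?_)
  rw [gAlg_apply, gAlg_apply, hr, ha, hb, hc]

variable (Q) in
/-- The element of `𝔬(Ṽ, Q̃)` with prescribed coordinates. -/
def gMk (Y : orth Q) (a b : V) (c : ℂ) : gAlg Q :=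
  ⟨{ toFun := fun w => (Y.1 w.1 + w.2.1 • b + w.2.2 • a,
      (-Q.polarBilin a w.1 + w.2.1 * c, -Q.polarBilin b w.1 - w.2.2 * c))
     map_add' := fun x y => by
      refine Prod.ext ?_ (Prod.ext ?_ ?_)
      · simp only [Prod.fst_add, Prod.snd_add, map_add]; module
      · simp only [Prod.fst_add, Prod.snd_add, map_add]; ring
      · simp only [Prod.fst_add, Prod.snd_add, map_add]; ring
     map_smul' := fun r x => by
      refine Prod.ext ?_ (Prod.ext ?_ ?_)
      · simp only [Prod.smul_fst, Prod.smul_snd, map_smul, RingHom.id_apply, smul_eq_mul]; module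
      · simp only [Prod.smul_fst, Prod.smul_snd, map_smul, RingHom.id_apply, smul_eq_mul]; ring
      · simp only [Prod.smul_fst, Prod.smul_snd, map_smul, RingHom.id_apply, smul_eq_mul]; ring },
    by
      rw [mem_orth]
      intro x y
      change extBilin Q _ _ = - extBilin Q _ _
      rw [extBilin_apply, extBilin_apply]
      have h := (mem_orth Q Y.1).1 Y.2 x.1 y.1
      simp only [LinearMap.coe_mk, AddHom.coe_mk, map_add, map_smul, LinearMap.add_apply,
        LinearMap.smul_apply, smul_eq_mul, h, polarBilin_comm Q x.1 a, polarBilin_comm Q x.1 b]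
      ring⟩

variable (Y : orth Q) (a b : V) (c : ℂ)

theorem rotPart_gMk : rotPart Q (gMk Q Y a b c) = Y := by
  ext v
  change Y.1 v + (0 : ℂ) • b + (0 : ℂ) • a = Y.1 v
  simp

theorem aPart_gMk : aPart Q (gMk Q Y a b c) = a := by
  change Y.1 0 + (0 : ℂ) • b + (1 : ℂ) • a = a
  simp

theorem bPart_gMk : bPart Q (gMk Q Y a b c) = b := by
  change Y.1 0 + (1 : ℂ) • b + (0 : ℂ) • a = b
  simp

theorem cPart_gMk : cPart Q (gMk Q Y a b c) = c := by
  change -Q.polarBilin a 0 + 1 * c = c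
  simp

variable (X X' : gAlg Q)

theorem lie_apply_gAlg (w : V × (ℂ × ℂ)) : (⁅X, X'⁆ : gAlg Q).1 w = X.1 (X'.1 w) - X'.1 (X.1 w) :=
  rfl

theorem aPart_lie : aPart Q ⁅X, X'⁆ = (rotPart Q X).1 (aPart Q X') - (rotPart Q X').1 (aPart Q X)
    + cPart Q X • aPart Q X' - cPart Q X' • aPart Q X := by
  change ((⁅X, X'⁆ : gAlg Q).1 (0, (0, 1))).1 = _
  rw [lie_apply_gAlg, gAlg_apply X' 0, gAlg_apply X 0, gAlg_apply X, gAlg_apply X']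
  simp only [map_zero, Prod.fst_sub, zero_smul, one_smul, zero_add, neg_zero, zero_mul, one_mul]
  module

theorem bPart_lie : bPart Q ⁅X, X'⁆ = (rotPart Q X).1 (bPart Q X') - (rotPart Q X').1 (bPart Q X)
    + cPart Q X' • bPart Q X - cPart Q X • bPart Q X' := by
  change ((⁅X, X'⁆ : gAlg Q).1 (0, (1, 0))).1 = _
  rw [lie_apply_gAlg, gAlg_apply X' 0, gAlg_apply X 0, gAlg_apply X, gAlg_apply X']
  simp only [map_zero, Prod.fst_sub, zero_smul, one_smul, zero_add, neg_zero, zero_mul, one_mul,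
    add_zero]
  module

theorem cPart_lie : cPart Q ⁅X, X'⁆ = Q.polarBilin (bPart Q X) (aPart Q X')
    - Q.polarBilin (bPart Q X') (aPart Q X) := by
  change ((⁅X, X'⁆ : gAlg Q).1 (0, (1, 0))).2.1 = _
  rw [lie_apply_gAlg, gAlg_apply X' 0, gAlg_apply X 0, gAlg_apply X, gAlg_apply X']
  simp only [map_zero, Prod.fst_sub, Prod.snd_sub, zero_smul, one_smul, zero_add, neg_zero,
    zero_mul, one_mul, add_zero, polarBilin_comm Q (aPart Q X) (bPart Q X'),
    polarBilin_comm Q (aPart Q X') (bPart Q X)]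
  ring

theorem rotPart_lie : rotPart Q ⁅X, X'⁆ = ⁅rotPart Q X, rotPart Q X'⁆
    + wedge Q (bPart Q X) (aPart Q X') - wedge Q (bPart Q X') (aPart Q X) := by
  ext v
  change ((⁅X, X'⁆ : gAlg Q).1 (v, (0, 0))).1 = ((rotPart Q X).1 ((rotPart Q X').1 v)
    - (rotPart Q X').1 ((rotPart Q X).1 v)) + (wedge Q (bPart Q X) (aPart Q X')).1 v
    - (wedge Q (bPart Q X') (aPart Q X)).1 v
  rw [lie_apply_gAlg, gAlg_apply X' v, gAlg_apply X v, gAlg_apply X, gAlg_apply X', wedge_apply,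
    wedge_apply]
  simp only [Prod.fst_sub, zero_smul, add_zero, zero_mul, sub_zero]
  module

theorem scaleG_apply (α : ℂˣ) (w : V × (ℂ × ℂ)) :
    (scaleG Q α X).1 w = torusElt V α (X.1 (torusElt V α⁻¹ w)) := rfl

theorem aPart_scaleG (α : ℂˣ) : aPart Q (scaleG Q α X) = (α : ℂ) • aPart Q X := by
  change ((scaleG Q α X).1 (0, (0, 1))).1 = _
  rw [scaleG_apply]
  have h : torusElt V α⁻¹ (0, (0, 1)) = (0, (0, (α : ℂ))) := by simp [torusElt]
  rw [h, gAlg_apply]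
  simp [torusElt]

theorem bPart_scaleG (α : ℂˣ) : bPart Q (scaleG Q α X) = ((α⁻¹ : ℂˣ) : ℂ) • bPart Q X := by
  change ((scaleG Q α X).1 (0, (1, 0))).1 = _
  rw [scaleG_apply]
  have h : torusElt V α⁻¹ (0, (1, 0)) = (0, (((α⁻¹ : ℂˣ) : ℂ), 0)) := by simp [torusElt]
  rw [h, gAlg_apply]
  simp [torusElt]

theorem cPart_scaleG (α : ℂˣ) : cPart Q (scaleG Q α X) = cPart Q X := by
  change ((scaleG Q α X).1 (0, (1, 0))).2.1 = _
  rw [scaleG_apply]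
  have h : torusElt V α⁻¹ (0, (1, 0)) = (0, (((α⁻¹ : ℂˣ) : ℂ), 0)) := by simp [torusElt]
  rw [h, gAlg_apply]
  simp [torusElt]

theorem rotPart_scaleG (α : ℂˣ) : rotPart Q (scaleG Q α X) = rotPart Q X := by
  ext v
  change ((scaleG Q α X).1 (v, (0, 0))).1 = _
  rw [scaleG_apply]
  have h : torusElt V α⁻¹ (v, (0, 0)) = (v, (0, 0)) := by simp [torusElt]
  rw [h, gAlg_apply]
  simp [torusElt]

end Coordinates

section CoordinateDecomposition

variable {V : Type*} [AddCommGroup V] [Module ℂ V] {Q : QuadraticForm ℂ V}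

theorem lie_gMk (Y : orth Q) (a b a' : V) (c : ℂ) : ⁅gMk Q Y a b c, gMk Q 0 a' 0 0⁆
    = gMk Q (wedge Q b a') (Y.1 a' + c • a') 0 0 + Q.polarBilin b a' • gMk Q 0 0 0 1 := by
  refine gAlg_ext ?_ ?_ ?_ ?_
  · rw [map_add, map_smul, rotPart_lie]
    simp only [rotPart_gMk, aPart_gMk, bPart_gMk, lie_zero, wedge_zero_left]
    module
  · rw [map_add, map_smul, aPart_lie]
    simp only [rotPart_gMk, aPart_gMk, cPart_gMk]
    change _ - (0 : V) + _ - _ = _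
    module
  · rw [map_add, map_smul, bPart_lie]
    simp only [rotPart_gMk, bPart_gMk, cPart_gMk, map_zero]
    change _ - (0 : V) + _ - _ = _
    module
  · rw [map_add, map_smul, cPart_lie]
    simp only [aPart_gMk, bPart_gMk, cPart_gMk, map_zero, LinearMap.zero_apply, smul_eq_mul]
    ring

theorem eq_sum_gMk (X : gAlg Q) : X = gMk Q (rotPart Q X) (aPart Q X) 0 0
    + cPart Q X • gMk Q 0 0 0 1 + gMk Q 0 0 (bPart Q X) 0 := by
  refine gAlg_ext ?_ ?_ ?_ ?_
  · simp only [map_add, map_smul, rotPart_gMk]; module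
  · simp only [map_add, map_smul, aPart_gMk]; module
  · simp only [map_add, map_smul, bPart_gMk]; module
  · simp only [map_add, map_smul, cPart_gMk, smul_eq_mul]; ring

theorem gMk_mem_pAlg (Y : orth Q) (a : V) : gMk Q Y a 0 0 ∈ pAlg Q := by
  change (gMk Q Y a 0 0).1 (0, (1, 0)) = 0
  rw [gAlg_apply, rotPart_gMk, aPart_gMk, bPart_gMk, cPart_gMk]
  simp

end CoordinateDecomposition

/-! ### The representation `ψ` of `𝔬(Ṽ, Q̃)` -/

section Psi

variable {V : Type*} [AddCommGroup V] [Module ℂ V] [FiniteDimensional ℂ V] {Q : QuadraticForm ℂ V}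
variable {ι : Type*} [Fintype ι] [DecidableEq ι] {e : Module.Basis ι ℂ V}
variable (he : ∀ i j, Q.polarBilin (e i) (e j) = if i = j then 1 else 0)
variable (hQ : Q.polarBilin.Nondegenerate)

/-- `b ↦ P_b` as a linear map. -/
def confMap : V →ₗ[ℂ] Module.End ℂ (ConeRing Q) where
  toFun := confOp he
  map_add' := confOp_add he hQ
  map_smul' := confOp_smul he hQ

/-- The operator on `𝒪_C` attached to an element of `𝔬(Ṽ, Q̃)`. -/
def psiOp : gAlg Q →ₗ[ℂ] Module.End ℂ (ConeRing Q) :=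
  fieldOp Q ∘ₗ rotPart Q + xOp Q ∘ₗ aPart Q + (cPart Q).smulRight (hOp he)
    + confMap he hQ ∘ₗ bPart Q

theorem psiOp_apply (X : gAlg Q) : psiOp he hQ X = fieldOp Q (rotPart Q X) + xOp Q (aPart Q X)
    + cPart Q X • hOp he + confOp he (bPart Q X) := rfl

theorem psiOp_gMk (Y : orth Q) (a b : V) (c : ℂ) : psiOp he hQ (gMk Q Y a b c)
    = fieldOp Q Y + xOp Q a + c • hOp he + confOp he b := by
  rw [psiOp_apply, rotPart_gMk, aPart_gMk, bPart_gMk, cPart_gMk]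

include hQ in
theorem confOp_zero : confOp he 0 = 0 := (confMap he hQ).map_zero

theorem psiOp_lie (X X' : gAlg Q) : psiOp he hQ ⁅X, X'⁆ = ⁅psiOp he hQ X, psiOp he hQ X'⁆ := by
  have h1 : ∀ (Y : orth Q) a, ⁅xOp Q a, fieldOp Q Y⁆ = -xOp Q (Y.1 a) := fun Y a => by
    rw [← lie_skew, lie_fieldOp_xOp]
  have h2 : ∀ (Y : orth Q) b, ⁅confOp he b, fieldOp Q Y⁆ = -confOp he (Y.1 b) := fun Y a => by
    rw [← lie_skew, lie_fieldOp_confOp he hQ]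
  have h3 : ∀ (Y : orth Q), ⁅hOp he, fieldOp Q Y⁆ = 0 := fun Y => by
    rw [← lie_skew, lie_fieldOp_hOp he hQ, neg_zero]
  have h4 : ∀ b, ⁅confOp he b, hOp he⁆ = confOp he b := fun b => by
    rw [← lie_skew, lie_hOp_confOp he hQ, neg_neg]
  have h5 : ∀ a, ⁅xOp Q a, hOp he⁆ = -xOp Q a := fun a => by
    rw [← lie_skew, lie_hOp_xOp he]
  have h6 : ∀ a b, ⁅xOp Q a, confOp he b⁆
      = -(Q.polarBilin b a • hOp he + fieldOp Q (wedge Q b a)) := fun a b => by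
    rw [← lie_skew, lie_confOp_xOp he]
  have h7 : confOp he (bPart Q ⁅X, X'⁆)
      = confOp he ((rotPart Q X).1 (bPart Q X')) - confOp he ((rotPart Q X').1 (bPart Q X))
    + cPart Q X' • confOp he (bPart Q X) - cPart Q X • confOp he (bPart Q X') := by
    change confMap he hQ _ = confMap he hQ _ - confMap he hQ _ + _ • confMap he hQ _
      - _ • confMap he hQ _
    rw [bPart_lie]
    simp only [map_sub, map_add, map_smul]
  rw [psiOp_apply, psiOp_apply, psiOp_apply, h7, rotPart_lie, aPart_lie, cPart_lie]
  simp only [add_lie, lie_add, smul_lie, lie_smul, lie_self, lie_fieldOp_fieldOp hQ,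
    lie_fieldOp_xOp, lie_fieldOp_hOp he hQ, lie_fieldOp_confOp he hQ, lie_xOp_xOp, lie_hOp_xOp he,
    lie_hOp_confOp he hQ, lie_confOp_xOp he, lie_confOp_confOp he hQ, h1, h2, h3, h4, h5, h6,
    map_sub, map_add, map_smul]
  module

theorem isDiffOp_psiOp (X : gAlg Q) : IsDiffOp 2 (psiOp he hQ X) := by
  rw [psiOp_apply]
  exact ((((isDiffOp_fieldOp _).mono one_le_two).add ((isDiffOp_xOp _).mono (Nat.zero_le 2))).add
    (((isDiffOp_hOp he hQ).smul _).mono one_le_two)).add (isDiffOp_confOp he hQ _)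

/-- The morphism of Lie algebras `ψ : 𝔬(Ṽ, Q̃) → 𝒟(C)`. -/
def psi : gAlg Q →ₗ⁅ℂ⁆ coneDiffOps Q where
  toFun X := ⟨psiOp he hQ X, 2, isDiffOp_psiOp he hQ X⟩
  map_add' X Y := Subtype.ext (map_add (psiOp he hQ) X Y)
  map_smul' c X := Subtype.ext (map_smul (psiOp he hQ) c X)
  map_lie' := fun {X Y} => Subtype.ext (psiOp_lie he hQ X Y)

theorem psi_coe (X : gAlg Q) : (psi he hQ X).1 = psiOp he hQ X := rfl

theorem psi_extends (X : pAlg Q) : psi he hQ X.1 = psiTilde Q X := by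
  have hv : X.1.1 (vOne V) = 0 := X.2
  have hb : bPart Q X.1 = 0 := by
    change (X.1.1 (vOne V)).1 = 0
    rw [hv]; rfl
  have hc : cPart Q X.1 = 0 := by
    change (X.1.1 (vOne V)).2.1 = 0
    rw [hv]; rfl
  refine Subtype.ext ?_
  rw [psi_coe, psiOp_apply, hb, hc, confOp_zero he hQ, zero_smul, add_zero, add_zero]
  have h : fTwo Q X = Q.polarBilin (aPart Q X.1) := by
    ext v
    change extBilin Q (X.1.1 (vTwo V)) (v, 0) = _
    rw [extBilin_apply]
    change Q.polarBilin (aPart Q X.1) v + _ = _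
    simp
  change _ = fieldOp Q (rotPart Q X.1) + (dualD Q (fTwo Q X)).1
  rw [h]
  rfl

/-! ### Weights of operators -/

/-- Conjugation by rescaling, on all operators on `𝒪_C`. -/
def scaleE (α : ℂˣ) (D : Module.End ℂ (ConeRing Q)) : Module.End ℂ (ConeRing Q) :=
  (scaleC Q (α : ℂ)).toLinearMap ∘ₗ D ∘ₗ (scaleC Q ((α⁻¹ : ℂˣ) : ℂ)).toLinearMap

theorem scaleD_coe (α : ℂˣ) (D : coneDiffOps Q) : (scaleD Q α D).1 = scaleE α D.1 := rfl

theorem scaleE_apply (α : ℂˣ) (D : Module.End ℂ (ConeRing Q)) (f : ConeRing Q) :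
    scaleE α D f = scaleC Q (α : ℂ) (D (scaleC Q ((α⁻¹ : ℂˣ) : ℂ) f)) := rfl

theorem scaleE_one (α : ℂˣ) (D : Module.End ℂ (ConeRing Q)) :
    scaleE α D 1 = scaleC Q (α : ℂ) (D 1) := by rw [scaleE_apply, map_one]

theorem scaleE_mul (α : ℂˣ) (D D' : Module.End ℂ (ConeRing Q)) :
    scaleE α (D * D') = scaleE α D * scaleE α D' := by
  ext f
  rw [scaleE_apply, Module.End.mul_apply, Module.End.mul_apply, scaleE_apply, scaleE_apply,
    scaleC_mul_cancel Q (by simp)]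

theorem scaleE_add (α : ℂˣ) (D D' : Module.End ℂ (ConeRing Q)) :
    scaleE α (D + D') = scaleE α D + scaleE α D' := by
  ext f
  simp only [scaleE_apply, LinearMap.add_apply, map_add]

theorem scaleE_smul (α : ℂˣ) (c : ℂ) (D : Module.End ℂ (ConeRing Q)) :
    scaleE α (c • D) = c • scaleE α D := by
  ext f
  simp only [scaleE_apply, LinearMap.smul_apply, map_smul]

theorem scaleE_lie (α : ℂˣ) (D D' : Module.End ℂ (ConeRing Q)) :
    scaleE α ⁅D, D'⁆ = ⁅scaleE α D, scaleE α D'⁆ := by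
  rw [Ring.lie_def, Ring.lie_def, sub_eq_add_neg, ← neg_one_smul ℂ (D' * D), scaleE_add,
    scaleE_smul, scaleE_mul, scaleE_mul, neg_one_smul, sub_eq_add_neg]

theorem scaleE_xOp (α : ℂˣ) (a : V) : scaleE α (xOp Q a) = (α : ℂ) • xOp Q a := by
  ext f
  rw [scaleE_apply, xOp_apply, map_mul, scaleC_mul_cancel Q (by simp), scaleC_ell,
    LinearMap.smul_apply, xOp_apply, smul_mul_assoc]

theorem xOp_eq_smul_scaleE (α : ℂˣ) (a : V) :
    xOp Q a = ((α⁻¹ : ℂˣ) : ℂ) • scaleE α (xOp Q a) := by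
  rw [scaleE_xOp, smul_smul, ← Units.val_mul, inv_mul_cancel, Units.val_one, one_smul]

/-- Commutators of a rescaled operator with linear functionals. -/
theorem scaleE_lie_xOp (α : ℂˣ) (D : Module.End ℂ (ConeRing Q)) (a : V) :
    ⁅scaleE α D, xOp Q a⁆ = ((α⁻¹ : ℂˣ) : ℂ) • scaleE α ⁅D, xOp Q a⁆ := by
  rw [scaleE_lie, ← lie_smul, ← xOp_eq_smul_scaleE]

include hQ in
theorem scaleE_fieldOp (α : ℂˣ) (Y : orth Q) : scaleE α (fieldOp Q Y) = fieldOp Q Y := by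
  refine end_ext hQ ?_ fun a => ?_
  · rw [scaleE_one, fieldOp_one, map_zero]
  · rw [scaleE_lie_xOp, lie_fieldOp_xOp, ← xOp_eq_smul_scaleE]

include hQ in
theorem scaleE_hOp (α : ℂˣ) : scaleE α (hOp he) = hOp he := by
  refine end_ext hQ ?_ fun a => ?_
  · rw [scaleE_one, hOp_one, AlgHom.commutes]
  · rw [scaleE_lie_xOp, lie_hOp_xOp, ← xOp_eq_smul_scaleE]

include hQ in
theorem scaleE_confOp (α : ℂˣ) (b : V) :
    scaleE α (confOp he b) = ((α⁻¹ : ℂˣ) : ℂ) • confOp he b := by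
  refine end_ext hQ ?_ fun a => ?_
  · rw [scaleE_one, LinearMap.smul_apply, confOp_one, map_zero, smul_zero]
  · rw [scaleE_lie_xOp, smul_lie, lie_confOp_xOp, scaleE_add, scaleE_smul, scaleE_hOp he hQ,
      scaleE_fieldOp hQ]

theorem psi_equivariant (α : ℂˣ) (X : gAlg Q) :
    psi he hQ (scaleG Q α X) = scaleD Q α (psi he hQ X) := by
  refine Subtype.ext ?_
  rw [scaleD_coe, psi_coe, psi_coe, psiOp_apply, psiOp_apply, aPart_scaleG, bPart_scaleG,
    cPart_scaleG, rotPart_scaleG, scaleE_add, scaleE_add, scaleE_add, scaleE_smul, scaleE_xOp,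
    scaleE_fieldOp hQ, scaleE_hOp he hQ, scaleE_confOp he hQ, confOp_smul he hQ, map_smul]

theorem psi_injective (hn : 2 < Module.finrank ℂ V) : Function.Injective (psi he hQ) := by
  have hs : shift V ≠ 0 := by
    rw [shift, sub_ne_zero]
    intro h
    have h1 : (Module.finrank ℂ V : ℂ) = 2 := by linear_combination 2 * h
    have h2 : Module.finrank ℂ V = 2 := by exact_mod_cast h1
    omega
  rw [injective_iff_map_eq_zero]
  intro X hX
  have h0 : fieldOp Q (rotPart Q X) + xOp Q (aPart Q X) + cPart Q X • hOp he
      + confOp he (bPart Q X) = 0 := congrArg Subtype.val hX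
  have h1 := LinearMap.congr_fun h0 1
  simp only [LinearMap.add_apply, fieldOp_one, confOp_one, LinearMap.smul_apply, hOp_one,
    xOp_apply, mul_one, zero_add, add_zero, LinearMap.zero_apply] at h1
  rw [Algebra.smul_def, ← map_mul] at h1
  obtain ⟨ha, hc⟩ := ell_add_const_eq_zero hQ h1
  have hc := (mul_eq_zero.1 hc).resolve_right hs
  rw [ha, hc, map_zero, zero_smul, add_zero, add_zero] at h0
  have h2 : ∀ a, (rotPart Q X).1 a = 0 ∧ Q.polarBilin (bPart Q X) a = 0 := by
    intro a
    have h3 := congrArg (fun D => ⁅D, xOp Q a⁆ 1) h0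
    simp only [add_lie, zero_lie, lie_fieldOp_xOp, lie_confOp_xOp, LinearMap.add_apply,
      LinearMap.smul_apply, fieldOp_one, hOp_one, xOp_apply, mul_one, add_zero,
      LinearMap.zero_apply] at h3
    rw [Algebra.smul_def, ← map_mul] at h3
    obtain ⟨h4, h5⟩ := ell_add_const_eq_zero hQ h3
    exact ⟨h4, (mul_eq_zero.1 h5).resolve_right hs⟩
  refine gAlg_ext ?_ ?_ ?_ ?_
  · ext a
    rw [(h2 a).1]; simp
  · rw [ha, map_zero]
  · rw [map_zero]
    exact eq_zero_of_polarBilin hQ fun a => (h2 a).2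
  · rw [hc, map_zero]

end Psi

/-! ### Operators with constant commutators -/

section ConstantCommutators

variable {V : Type*} [AddCommGroup V] [Module ℂ V] [FiniteDimensional ℂ V] {Q : QuadraticForm ℂ V}
variable {ι : Type*} [Fintype ι] [DecidableEq ι] {e : Module.Basis ι ℂ V}
variable (he : ∀ i j, Q.polarBilin (e i) (e j) = if i = j then 1 else 0)
variable (hQ : Q.polarBilin.Nondegenerate)

include he in
/-- The equation of the cone, as a relation between multiplication operators. -/
theorem sum_xOp_sq : ∑ i, xOp Q (e i) * xOp Q (e i) = 0 := by
  have h0 : coneMk Q (quadPoly Q) = 0 :=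
    (coneMk_eq_zero_iff Q).2 (Ideal.mem_span_singleton_self _)
  have h := congrArg (coneMk Q) (sum_linPoly_sq he)
  rw [map_mul, h0, mul_zero, map_sum] at h
  ext f
  rw [LinearMap.sum_apply]
  simp only [Module.End.mul_apply, xOp_apply, ell_apply, ← mul_assoc, ← map_mul]
  rw [← Finset.sum_mul, h, zero_mul]
  rfl

include he in
theorem sum_lie_xOp (D : Module.End ℂ (ConeRing Q)) :
    ∑ i, (⁅D, xOp Q (e i)⁆ * xOp Q (e i) + xOp Q (e i) * ⁅D, xOp Q (e i)⁆) = 0 := by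
  have h : ∀ i, ⁅D, xOp Q (e i)⁆ * xOp Q (e i) + xOp Q (e i) * ⁅D, xOp Q (e i)⁆
      = D * (xOp Q (e i) * xOp Q (e i)) - (xOp Q (e i) * xOp Q (e i)) * D := fun i => by
    rw [Ring.lie_def]; noncomm_ring
  simp only [h]
  rw [Finset.sum_sub_distrib, ← Finset.mul_sum, ← Finset.sum_mul, sum_xOp_sq he, mul_zero,
    zero_mul, sub_zero]

include hQ in
theorem xOp_injective : Function.Injective (xOp Q) := by
  intro a b h
  have h1 := LinearMap.congr_fun h 1
  rw [xOp_apply, xOp_apply, mul_one, mul_one] at h1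
  exact ell_injective hQ h1

include he hQ in
/-- No nonzero derivative in a constant direction is defined on the cone. -/
theorem lie_xOp_eq_zero_of_const {D : Module.End ℂ (ConeRing Q)} {s : V → ℂ}
    (h : ∀ a, ⁅D, xOp Q a⁆ = algebraMap ℂ _ (s a)) (a : V) : ⁅D, xOp Q a⁆ = 0 := by
  have h1 := sum_lie_xOp he D
  simp only [h, ← Algebra.smul_def, ← Algebra.commutes, ← two_smul ℂ] at h1
  have h2 : xOp Q (∑ i, (2 : ℂ) • s (e i) • e i) = xOp Q 0 := by
    rw [map_zero, ← h1, map_sum]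
    simp only [map_smul]
  have h3 := xOp_injective hQ h2
  have h4 : ∀ i, s (e i) = 0 := fun i => by
    have h5 := Fintype.linearIndependent_iff.1 e.linearIndependent (fun i => 2 * s (e i))
      (by simpa only [mul_smul] using h3) i
    exact (mul_eq_zero.1 h5).resolve_left two_ne_zero
  rw [← sum_polarBilin_smul he a, map_sum, lie_sum]
  refine Finset.sum_eq_zero fun i _ => ?_
  rw [map_smul, lie_smul, h, h4, map_zero, smul_zero]

end ConstantCommutators

/-! ### Uniqueness of the extension -/

section Uniqueness

variable {V : Type*} [AddCommGroup V] [Module ℂ V] [FiniteDimensional ℂ V] {Q : QuadraticForm ℂ V}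
variable {ι : Type*} [Fintype ι] [DecidableEq ι] {e : Module.Basis ι ℂ V}
variable (he : ∀ i j, Q.polarBilin (e i) (e j) = if i = j then 1 else 0)
variable (hQ : Q.polarBilin.Nondegenerate)

include he in
/-- The difference of two extensions is constant on the grading element and therefore sends the
part of weight `-1` to derivatives in constant directions, which do not exist on the cone. -/
theorem eq_psi_of_isEquivariantExtension [Nonempty ι] {ψ' : gAlg Q →ₗ⁅ℂ⁆ coneDiffOps Q}
    (h : IsEquivariantExtension Q ψ') : ψ' = psi he hQ := by
  obtain ⟨hext, hequi⟩ := h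
  have hp : ∀ Y a, ψ' (gMk Q Y a 0 0) = psi he hQ (gMk Q Y a 0 0) := fun Y a =>
    (hext ⟨_, gMk_mem_pAlg Y a⟩).trans (psi_extends he hQ ⟨_, gMk_mem_pAlg Y a⟩).symm
  set d : gAlg Q → Module.End ℂ (ConeRing Q) := fun X => (ψ' X).1 - (psi he hQ X).1 with hd
  have hlie : ∀ X a, ⁅d X, xOp Q a⁆ = d ⁅X, gMk Q 0 a 0 0⁆ := by
    intro X a
    have hx : (psi he hQ (gMk Q 0 a 0 0)).1 = xOp Q a := by
      rw [psi_coe, psiOp_gMk, confOp_zero he hQ, map_zero, zero_smul]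
      simp
    have h1 : d ⁅X, gMk Q 0 a 0 0⁆ = ⁅(ψ' X).1, (ψ' (gMk Q 0 a 0 0)).1⁆
        - ⁅(psi he hQ X).1, (psi he hQ (gMk Q 0 a 0 0)).1⁆ := by
      simp only [hd, LieHom.map_lie]; rfl
    rw [h1, hp, hx, ← sub_lie]
  have hlie' : ∀ Y a b c a', ⁅d (gMk Q Y a b c), xOp Q a'⁆
      = Q.polarBilin b a' • d (gMk Q 0 0 0 1) := by
    intro Y a b c a'
    rw [hlie, lie_gMk]
    simp only [hd, map_add, map_smul, hp]
    change ((psi he hQ _).1 + Q.polarBilin b a' • (ψ' _).1)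
      - ((psi he hQ _).1 + Q.polarBilin b a' • (psi he hQ _).1) = _
    module
  have hscale : ∀ (α : ℂˣ) X, scaleE α (d X) = d (scaleG Q α X) := by
    intro α X
    simp only [hd, hequi, psi_equivariant, scaleD_coe, sub_eq_add_neg, scaleE_add]
    rw [← neg_one_smul ℂ, scaleE_smul, neg_one_smul]
  have hs1 : ∀ α : ℂˣ, scaleG Q α (gMk Q 0 0 0 1) = gMk Q 0 0 0 1 := fun α => by
    refine gAlg_ext ?_ ?_ ?_ ?_
    · rw [rotPart_scaleG]
    · rw [aPart_scaleG, aPart_gMk, smul_zero]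
    · rw [bPart_scaleG, bPart_gMk, smul_zero]
    · rw [cPart_scaleG]
  have hs2 : ∀ (α : ℂˣ) b, scaleG Q α (gMk Q 0 0 b 0) = ((α⁻¹ : ℂˣ) : ℂ) • gMk Q 0 0 b 0 :=
    fun α b => by
      refine gAlg_ext ?_ ?_ ?_ ?_
      · rw [rotPart_scaleG, map_smul, rotPart_gMk, smul_zero]
      · rw [aPart_scaleG, map_smul, aPart_gMk, smul_zero, smul_zero]
      · rw [bPart_scaleG, map_smul, bPart_gMk]
      · rw [cPart_scaleG, map_smul, cPart_gMk, smul_zero]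
  have hh : ∃ s, d (gMk Q 0 0 0 1) = algebraMap ℂ _ s := by
    obtain ⟨s, hs⟩ := eq_const_of_weight_zero (Q := Q) (a := d (gMk Q 0 0 0 1) 1) fun α => by
      rw [← scaleE_one, hscale, hs1]
    refine ⟨s, ?_⟩
    rw [eq_mulOp_of_lie_xOp hQ (D := d (gMk Q 0 0 0 1)) fun a => by
      rw [hlie', map_zero, LinearMap.zero_apply, zero_smul], hs]
    ext f
    rw [LinearMap.mulLeft_apply, ← Algebra.smul_def, Module.algebraMap_end_apply]
  obtain ⟨s, hs⟩ := hh
  have hy0 : ∀ b a, ⁅d (gMk Q 0 0 b 0), xOp Q a⁆ = 0 := fun b a =>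
    lie_xOp_eq_zero_of_const he hQ (s := fun a => Q.polarBilin b a * s) (fun a => by
      rw [hlie', hs, map_mul, ← Algebra.smul_def]) a
  have hh0 : d (gMk Q 0 0 0 1) = 0 := by
    obtain ⟨i⟩ := ‹Nonempty ι›
    have h1 := hy0 (e i) (e i)
    rwa [hlie', he, if_pos rfl, one_smul] at h1
  have hy : ∀ b, d (gMk Q 0 0 b 0) = 0 := by
    intro b
    refine end_ext hQ ?_ fun a => by rw [hy0, zero_lie]
    refine eq_zero_of_neg_weight (l := -1) (by norm_num) fun α => ?_
    have h1 := congrArg (fun D => D 1) (hscale α (gMk Q 0 0 b 0))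
    rw [scaleE_one, hs2] at h1
    rw [h1, zpow_neg_one]
    simp only [hd, map_smul]
    change (((α⁻¹ : ℂˣ) : ℂ) • (ψ' _).1 - ((α⁻¹ : ℂˣ) : ℂ) • (psi he hQ _).1) 1 = _
    rw [← smul_sub]
    rfl
  refine LieHom.ext fun X => ?_
  have hh1 : ψ' (gMk Q 0 0 0 1) = psi he hQ (gMk Q 0 0 0 1) := Subtype.ext (sub_eq_zero.1 hh0)
  have hy1 : ∀ b, ψ' (gMk Q 0 0 b 0) = psi he hQ (gMk Q 0 0 b 0) := fun b =>
    Subtype.ext (sub_eq_zero.1 (hy b))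
  rw [eq_sum_gMk X, map_add, map_add, map_smul, hp, hh1, hy1, ← map_smul, ← map_add, ← map_add]

end Uniqueness

/-! ### The operators of small order and weight, and the image of `ψ` -/

section Image

variable {V : Type*} [AddCommGroup V] [Module ℂ V] [FiniteDimensional ℂ V] {Q : QuadraticForm ℂ V}
variable {ι : Type*} [Fintype ι] [DecidableEq ι] {e : Module.Basis ι ℂ V}
variable (he : ∀ i j, Q.polarBilin (e i) (e j) = if i = j then 1 else 0)
variable (hQ : Q.polarBilin.Nondegenerate)

theorem weight_apply_one {D : Module.End ℂ (ConeRing Q)} {α : ℂˣ} {s : ℂ}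
    (h : scaleE α D = s • D) : scaleC Q (α : ℂ) (D 1) = s • D 1 := by
  rw [← scaleE_one, h, LinearMap.smul_apply]

theorem weight_lie_xOp {D : Module.End ℂ (ConeRing Q)} {α : ℂˣ} {s : ℂ}
    (h : scaleE α D = s • D) (a : V) :
    scaleE α ⁅D, xOp Q a⁆ = ((α : ℂ) * s) • ⁅D, xOp Q a⁆ := by
  rw [scaleE_lie, h, scaleE_xOp, lie_smul, smul_lie, smul_smul]

include hQ

theorem eq_xOp_of_weight_one {D : Module.End ℂ (ConeRing Q)} (hD : IsDiffOp 0 D)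
    (hw : ∀ α : ℂˣ, scaleE α D = (α : ℂ) • D) : ∃ b, D = xOp Q b := by
  obtain ⟨b, hb⟩ := eq_ell_of_weight_one hQ (a := D 1) fun α => weight_apply_one (hw α)
  refine ⟨b, ?_⟩
  rw [eq_mulOp_of_lie_xOp hQ ((isDiffOp_zero_iff hQ).1 hD), hb, xOp_eq_mulOp]

/-- `𝒟^{1,0}(C)` is spanned by the scalars, the Euler operator and `𝔬(V, Q)`: a first-order
operator of weight zero acts on linear functionals by an endomorphism that preserves `Q` up to
a factor. -/
theorem eq_of_weight_zero {D : Module.End ℂ (ConeRing Q)} (hD : IsDiffOp 1 D)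
    (hw : ∀ α : ℂˣ, scaleE α D = D) :
    ∃ (s t : ℂ) (Y : orth Q), D = algebraMap ℂ _ s + t • hOp he + fieldOp Q Y := by
  have hT : ∀ a, ∃ b, ⁅D, xOp Q a⁆ = xOp Q b := fun a =>
    eq_xOp_of_weight_one hQ ((isDiffOp_succ_iff hQ).1 hD a) fun α => by
      have h := weight_lie_xOp (s := 1) (α := α) (by rw [hw, one_smul]) a
      rwa [mul_one] at h
  choose T₀ hT₀ using hT
  let T : Module.End ℂ V :=
    { toFun := T₀
      map_add' := fun a b => xOp_injective hQ (by
        rw [map_add, ← hT₀, ← hT₀, ← hT₀, map_add, lie_add])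
      map_smul' := fun c a => xOp_injective hQ (by
        rw [RingHom.id_apply, map_smul, ← hT₀, ← hT₀, map_smul, lie_smul]) }
  have hT : ∀ a, ⁅D, xOp Q a⁆ = xOp Q (T a) := hT₀
  obtain ⟨s₀, hs₀⟩ := eq_const_of_weight_zero (a := D 1) fun α => by
    have h := weight_apply_one (s := 1) (α := α) (D := D) (by rw [hw, one_smul])
    rwa [one_smul] at h
  -- the quadratic form `B(T v, v)` vanishes on the cone
  have hq : coneMk Q (∑ i, linPoly (Q.polarBilin (T (e i))) * linPoly (Q.polarBilin (e i))) = 0 := by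
    have h1 := LinearMap.congr_fun (sum_lie_xOp he D) 1
    simp only [hT, xOp_mul_comm (e _), ← two_mul] at h1
    rw [← Finset.mul_sum, two_mul, LinearMap.add_apply, LinearMap.sum_apply,
      LinearMap.zero_apply] at h1
    simp only [Module.End.mul_apply, xOp_apply, mul_one, ell_apply, ← map_mul] at h1
    rw [map_sum]
    have h2 : (2 : ℂ) • ∑ i, coneMk Q (linPoly (Q.polarBilin (T (e i)))
        * linPoly (Q.polarBilin (e i))) = 0 := by
      rw [two_smul]
      exact h1
    exact (smul_eq_zero.1 h2).resolve_left two_ne_zero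
  have hval : ∀ v, (∑ i, linPoly (Q.polarBilin (T (e i))) * linPoly (Q.polarBilin (e i))).1 v
      = Q.polarBilin (T v) v := by
    intro v
    rw [AddSubmonoidClass.coe_finsetSum, Finset.sum_apply]
    have h := congrArg (fun w => Q.polarBilin (T w) v) (sum_polarBilin_smul he v)
    simp only [map_sum, LinearMap.sum_apply, map_smul, LinearMap.smul_apply, smul_eq_mul] at h
    rw [← h]
    exact Finset.sum_congr rfl fun i _ => mul_comm _ _
  obtain ⟨t, ht⟩ := quadratic_mem_coneIdeal ((coneMk_eq_zero_iff Q).1 hq) fun α v => by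
    rw [hval, hval, map_smul, map_smul, map_smul, LinearMap.smul_apply, smul_eq_mul, smul_eq_mul]
    ring
  have ht' : ∀ v, Q.polarBilin (T v) v = t * Q v := fun v => by rw [← hval, ht]
  have hY : T - (t / 2) • (1 : Module.End ℂ V) ∈ orth Q := by
    rw [mem_orth]
    intro x y
    have h1 := ht' (x + y)
    rw [quadForm_add, map_add, map_add, map_add, LinearMap.add_apply, LinearMap.add_apply, ht', ht',
      polarBilin_comm Q (T y) x] at h1
    simp only [LinearMap.sub_apply, LinearMap.smul_apply, Module.End.one_apply, map_sub, map_smul,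
      smul_eq_mul]
    linear_combination h1
  refine ⟨s₀ - t / 2 * shift V, t / 2, ⟨_, hY⟩, end_ext hQ ?_ fun a => ?_⟩
  · rw [LinearMap.add_apply, LinearMap.add_apply, LinearMap.smul_apply, fieldOp_one, hOp_one,
      Module.algebraMap_end_apply, hs₀, Algebra.algebraMap_eq_smul_one,
      Algebra.algebraMap_eq_smul_one]
    module
  · rw [add_lie, add_lie, smul_lie, lie_hOp_xOp, lie_fieldOp_xOp, lie_algebraMap, hT, ← map_smul,
      zero_add, ← map_add]
    congr 1
    simp

/-- `𝒟^{2,-1}(C)` consists of the operators `P_b`. The commutators of such an operator with linear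
functionals are determined by their Euler components, by the uniqueness argument for torsion-free
metric connections. -/
theorem eq_confOp_of_weight_neg_one [Nonempty ι] {D : Module.End ℂ (ConeRing Q)}
    (hD : IsDiffOp 2 D) (hw : ∀ α : ℂˣ, scaleE α D = ((α⁻¹ : ℂˣ) : ℂ) • D) :
    ∃ b, D = confOp he b := by
  have hD1 : D 1 = 0 := eq_zero_of_neg_weight (l := -1) (by norm_num) fun α => by
    rw [weight_apply_one (hw α), zpow_neg_one]
  have hG : ∀ a, ∃ (s t : ℂ) (Y : orth Q),
      ⁅D, xOp Q a⁆ = algebraMap ℂ _ s + t • hOp he + fieldOp Q Y := fun a =>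
    eq_of_weight_zero he hQ ((isDiffOp_succ_iff hQ).1 hD a) fun α => by
      rw [weight_lie_xOp (hw α) a, ← Units.val_mul, mul_inv_cancel, Units.val_one, one_smul]
  choose s t Y hG using hG
  have hG2 : ∀ a b, ⁅⁅D, xOp Q a⁆, xOp Q b⁆ = xOp Q (t a • b + (Y a).1 b) := fun a b => by
    rw [hG, add_lie, add_lie, lie_algebraMap, smul_lie, lie_hOp_xOp, lie_fieldOp_xOp, map_add,
      map_smul, zero_add]
  have hskew : ∀ a b c, Q.polarBilin ((Y a).1 b) c = -Q.polarBilin b ((Y a).1 c) := fun a =>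
    (mem_orth Q (Y a).1).1 (Y a).2
  obtain ⟨i⟩ := ‹Nonempty ι›
  have ht : ∀ a, t a = Q.polarBilin (t a • e i + (Y a).1 (e i)) (e i) := by
    intro a
    have h1 := hskew a (e i) (e i)
    rw [polarBilin_comm Q (e i)] at h1
    rw [map_add, LinearMap.add_apply, map_smul, LinearMap.smul_apply, he, if_pos rfl, smul_eq_mul]
    linear_combination -h1 / 2
  let τ : Module.Dual ℂ V :=
    { toFun := t
      map_add' := fun a b => by
        have h1 : t (a + b) • e i + (Y (a + b)).1 (e i)
            = (t a • e i + (Y a).1 (e i)) + (t b • e i + (Y b).1 (e i)) :=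
          xOp_injective hQ (by
            rw [map_add (xOp Q) (_ + _), ← hG2, ← hG2, ← hG2, map_add, lie_add, add_lie])
        rw [ht (a + b), h1, map_add, LinearMap.add_apply, ← ht, ← ht]
      map_smul' := fun c a => by
        have h1 : t (c • a) • e i + (Y (c • a)).1 (e i) = c • (t a • e i + (Y a).1 (e i)) :=
          xOp_injective hQ (by
            rw [map_smul (xOp Q) c (_ + _), ← hG2, ← hG2, map_smul, lie_smul, smul_lie])
        rw [ht (c • a), h1, map_smul, LinearMap.smul_apply, ← ht]
        rfl }
  set β := (LinearMap.BilinForm.toDual Q.polarBilin hQ).symm τ with hβ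
  have hτ : ∀ a, t a = Q.polarBilin β a := fun a =>
    (LinearMap.BilinForm.apply_toDual_symm_apply (hB := hQ) τ a).symm
  -- `Y a` and `β ∧ a` differ by a trilinear form, skew in two arguments and symmetric in two others
  have hZ : ∀ a, Y a = wedge Q β a := by
    have hsymm : ∀ a b, t a • b + (Y a).1 b = t b • a + (Y b).1 a := fun a b =>
      xOp_injective hQ (by
        rw [← hG2, ← hG2, ← sub_eq_zero]
        have h1 := lie_lie D (xOp Q a) (xOp Q b)
        have h2 := leibniz_lie D (xOp Q a) (xOp Q b)
        rw [lie_xOp_xOp, lie_zero] at h2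
        rw [← lie_skew (xOp Q a), ← sub_eq_add_neg] at h2
        exact h2.symm)
    have hZs : ∀ a b, (Y a - wedge Q β a).1 b = (Y b - wedge Q β b).1 a := by
      intro a b
      change (Y a).1 b - (wedge Q β a).1 b = (Y b).1 a - (wedge Q β b).1 a
      rw [wedge_apply, wedge_apply, ← hτ, ← hτ, polarBilin_comm Q b a]
      have h := hsymm a b
      rw [← eq_sub_iff_add_eq'] at h
      rw [h]
      module
    have hZk : ∀ a b c, Q.polarBilin ((Y a - wedge Q β a).1 b) c
        = -Q.polarBilin b ((Y a - wedge Q β a).1 c) := fun a =>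
      (mem_orth Q _).1 (Y a - wedge Q β a).2
    intro a
    rw [← sub_eq_zero]
    ext b
    refine eq_zero_of_polarBilin hQ fun c => ?_
    have h1 := hZk a b c
    rw [hZs a c, polarBilin_comm Q b, hZk c a b, hZs c b, polarBilin_comm Q a, hZk b c a,
      hZs b a, polarBilin_comm Q c] at h1
    linear_combination h1 / 2
  refine ⟨β, ?_⟩
  rw [← sub_eq_zero]
  have hc : ∀ a, ⁅D - confOp he β, xOp Q a⁆ = algebraMap ℂ _ (s a) := fun a => by
    rw [sub_lie, hG, lie_confOp_xOp, hτ, hZ]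
    abel
  refine end_ext hQ ?_ fun a => ?_
  · rw [LinearMap.sub_apply, hD1, confOp_one, sub_zero, LinearMap.zero_apply]
  · rw [lie_xOp_eq_zero_of_const he hQ hc, zero_lie]

/-- The components `𝒟^{0,1}(C)`, `𝒟^{1,0}(C)` and `𝒟^{2,-1}(C)` are contained in the sum of the
image of `ψ` and the scalars. -/
theorem sTilde_le [Nonempty ι] : sTilde Q ≤
    LinearMap.range (psi he hQ : gAlg Q →ₗ[ℂ] coneDiffOps Q) ⊔ Submodule.span ℂ {1} := by
  have key : ∀ (D : coneDiffOps Q) (s : ℂ) (X : gAlg Q),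
      D.1 = algebraMap ℂ _ s + psiOp he hQ X →
      D ∈ LinearMap.range (psi he hQ : gAlg Q →ₗ[ℂ] coneDiffOps Q) ⊔ Submodule.span ℂ {1} := by
    intro D s X h
    refine Submodule.mem_sup.2 ⟨psi he hQ X, ⟨X, rfl⟩, s • 1,
      Submodule.mem_span_singleton.2 ⟨s, rfl⟩, Subtype.ext ?_⟩
    rw [h, add_comm, Algebra.algebraMap_eq_smul_one]
    rfl
  have hw : ∀ {D : coneDiffOps Q} {k l}, D ∈ gradedPiece Q k l →
      ∀ α : ℂˣ, scaleE α D.1 = ((α ^ l : ℂˣ) : ℂ) • D.1 := fun h α =>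
    congrArg Subtype.val (h.2 α)
  refine sup_le (sup_le ?_ ?_) ?_
  · intro D hD
    obtain ⟨b, hb⟩ := eq_xOp_of_weight_one hQ hD.1 fun α => by rw [hw hD, zpow_one]
    refine key D 0 (gMk Q 0 b 0 0) ?_
    rw [psiOp_gMk, hb, confOp_zero he hQ, map_zero, map_zero, zero_smul]
    abel
  · intro D hD
    obtain ⟨s, t, Y, h⟩ := eq_of_weight_zero he hQ hD.1 fun α => by
      rw [hw hD, zpow_zero, Units.val_one, one_smul]
    refine key D s (gMk Q Y 0 0 t) ?_
    rw [psiOp_gMk, h, confOp_zero he hQ, map_zero]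
    abel
  · intro D hD
    obtain ⟨b, hb⟩ := eq_confOp_of_weight_neg_one he hQ hD.1 fun α => by
      rw [hw hD, zpow_neg_one]
    refine key D 0 (gMk Q 0 0 b 0) ?_
    rw [psiOp_gMk, hb, map_zero, map_zero, map_zero, zero_smul]
    abel

theorem psi_mem_sTilde (X : gAlg Q) : psi he hQ X ∈ sTilde Q := by
  have h0 : ∀ a, psi he hQ (gMk Q 0 a 0 0) ∈ gradedPiece Q 0 1 := by
    intro a
    have h : psiOp he hQ (gMk Q 0 a 0 0) = xOp Q a := by
      rw [psiOp_gMk, confOp_zero he hQ, map_zero, zero_smul]; abel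
    refine ⟨by rw [psi_coe, h]; exact isDiffOp_xOp a, fun α => Subtype.ext ?_⟩
    change scaleE α (psiOp he hQ _) = _ • psiOp he hQ _
    rw [h, scaleE_xOp, zpow_one]
  have h1 : ∀ Y c, psi he hQ (gMk Q Y 0 0 c) ∈ gradedPiece Q 1 0 := by
    intro Y c
    have h : psiOp he hQ (gMk Q Y 0 0 c) = fieldOp Q Y + c • hOp he := by
      rw [psiOp_gMk, confOp_zero he hQ, map_zero]; abel
    refine ⟨?_, fun α => Subtype.ext ?_⟩
    · rw [psi_coe, h]
      exact (isDiffOp_fieldOp Y).add ((isDiffOp_hOp he hQ).smul c)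
    · change scaleE α (psiOp he hQ _) = _ • psiOp he hQ _
      rw [h, scaleE_add, scaleE_smul, scaleE_fieldOp hQ, scaleE_hOp he hQ, zpow_zero,
        Units.val_one, one_smul]
  have h2 : ∀ b, psi he hQ (gMk Q 0 0 b 0) ∈ gradedPiece Q 2 (-1) := by
    intro b
    have h : psiOp he hQ (gMk Q 0 0 b 0) = confOp he b := by
      rw [psiOp_gMk, map_zero, map_zero, zero_smul]; abel
    refine ⟨by rw [psi_coe, h]; exact isDiffOp_confOp he hQ b, fun α => Subtype.ext ?_⟩
    change scaleE α (psiOp he hQ _) = _ • psiOp he hQ _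
    rw [h, scaleE_confOp he hQ, zpow_neg_one]
  have hX : X = gMk Q 0 (aPart Q X) 0 0 + gMk Q (rotPart Q X) 0 0 (cPart Q X)
      + gMk Q 0 0 (bPart Q X) 0 := by
    refine gAlg_ext ?_ ?_ ?_ ?_
    · simp only [map_add, rotPart_gMk]; abel
    · simp only [map_add, aPart_gMk]; abel
    · simp only [map_add, bPart_gMk]; abel
    · simp only [map_add, cPart_gMk]; abel
  rw [hX, map_add, map_add]
  exact Submodule.add_mem_sup (Submodule.add_mem_sup (h0 _) (h1 _ _)) (h2 _)

omit [FiniteDimensional ℂ V] hQ in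
include he in
/-- `𝔬(V, Q)` is spanned by the rotations `b ∧ a`. -/
theorem sum_wedge (Y : orth Q) : ∑ i, wedge Q (e i) (Y.1 (e i)) = (2 : ℂ) • Y := by
  ext v
  rw [AddSubmonoidClass.coe_finsetSum, LinearMap.sum_apply]
  change _ = (2 : ℂ) • Y.1 v
  simp only [wedge_apply, (mem_orth Q Y.1).1 Y.2]
  simp only [neg_smul, sub_neg_eq_add, Finset.sum_add_distrib, ← map_smul]
  rw [← map_sum, sum_polarBilin_smul he, sum_polarBilin_smul he, two_smul, map_add]

omit [FiniteDimensional ℂ V] hQ in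
include he in
/-- `𝔬(Ṽ, Q̃)` is perfect. -/
theorem mem_of_lie_mem [Nonempty ι] (S : Submodule ℂ (gAlg Q)) (hS : ∀ X X' : gAlg Q, ⁅X, X'⁆ ∈ S)
    (X : gAlg Q) : X ∈ S := by
  have hlie : ∀ (Y : orth Q) (a b a' : V) (c : ℂ), gMk Q (wedge Q b a') (Y.1 a' + c • a') 0 0
      + Q.polarBilin b a' • gMk Q 0 0 0 1 ∈ S := fun Y a b a' c => by
    rw [← lie_gMk Y a b a' c]; exact hS _ _
  have hz : gMk Q 0 0 0 0 = 0 := gAlg_ext (by rw [rotPart_gMk, map_zero])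
    (by rw [aPart_gMk, map_zero]) (by rw [bPart_gMk, map_zero]) (by rw [cPart_gMk, map_zero])
  have hh : gMk Q 0 0 0 1 ∈ S := by
    obtain ⟨i⟩ := ‹Nonempty ι›
    have h := hlie 0 0 (e i) (e i) 0
    rw [wedge_self, he, if_pos rfl, zero_smul, one_smul, add_zero] at h
    change gMk Q 0 0 0 0 + _ ∈ S at h
    rwa [hz, zero_add] at h
  have hr : ∀ b a, gMk Q (wedge Q b a) 0 0 0 ∈ S := fun b a => by
    have h := hlie 0 0 b a 0
    rw [zero_smul, add_zero] at h
    change gMk Q _ 0 0 0 + _ ∈ S at h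
    exact (Submodule.add_mem_iff_left S (S.smul_mem _ hh)).1 h
  have ha : ∀ a, gMk Q 0 a 0 0 ∈ S := fun a => by
    have h := hlie 0 0 0 a 1
    rw [wedge_zero_left, map_zero, LinearMap.zero_apply, zero_smul, add_zero, one_smul] at h
    change gMk Q 0 (0 + a) 0 0 ∈ S at h
    rwa [zero_add] at h
  have hb : ∀ b, gMk Q 0 0 b 0 ∈ S := fun b => by
    have h := hS (gMk Q 0 0 b 0) (gMk Q 0 0 0 1)
    have h1 : ⁅gMk Q 0 0 b 0, gMk Q 0 0 0 1⁆ = gMk Q 0 0 b 0 := by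
      refine gAlg_ext ?_ ?_ ?_ ?_
      · rw [rotPart_lie]
        simp only [rotPart_gMk, aPart_gMk, bPart_gMk, wedge_zero_right, lie_self]
        simp
      · rw [aPart_lie]
        simp only [rotPart_gMk, aPart_gMk, cPart_gMk]
        simp
      · rw [bPart_lie]
        simp only [rotPart_gMk, bPart_gMk, cPart_gMk]
        simp
      · rw [cPart_lie]
        simp only [aPart_gMk, bPart_gMk, cPart_gMk]
        simp
    rwa [h1] at h
  have hY : ∀ Y, gMk Q Y 0 0 0 ∈ S := fun Y => by
    have h1 : gMk Q Y 0 0 0 = (2⁻¹ : ℂ) • ∑ i, gMk Q (wedge Q (e i) (Y.1 (e i))) 0 0 0 := by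
      refine gAlg_ext ?_ ?_ ?_ ?_
      · simp only [map_smul, map_sum, rotPart_gMk]
        rw [sum_wedge he, smul_smul]
        norm_num
      · simp only [map_smul, map_sum, aPart_gMk]; simp
      · simp only [map_smul, map_sum, bPart_gMk]; simp
      · simp only [map_smul, map_sum, cPart_gMk]; simp
    rw [h1]
    exact S.smul_mem _ (S.sum_mem fun i _ => hr _ _)
  have hX : X = gMk Q (rotPart Q X) 0 0 0 + gMk Q 0 (aPart Q X) 0 0
      + cPart Q X • gMk Q 0 0 0 1 + gMk Q 0 0 (bPart Q X) 0 := by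
    refine gAlg_ext ?_ ?_ ?_ ?_
    · simp only [map_add, map_smul, rotPart_gMk]; module
    · simp only [map_add, map_smul, aPart_gMk]; module
    · simp only [map_add, map_smul, bPart_gMk]; module
    · simp only [map_add, map_smul, cPart_gMk, smul_eq_mul]; ring
  rw [hX]
  exact S.add_mem (S.add_mem (S.add_mem (hY _) (ha _)) (S.smul_mem _ hh)) (hb _)

theorem range_psi [Nonempty ι] :
    LinearMap.range (psi he hQ : gAlg Q →ₗ[ℂ] coneDiffOps Q) = sAlg Q := by
  refine le_antisymm ?_ ?_
  · rintro _ ⟨X, rfl⟩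
    refine mem_of_lie_mem he ((sAlg Q).comap (psi he hQ : gAlg Q →ₗ[ℂ] coneDiffOps Q)) ?_ X
    intro X X'
    change psi he hQ ⁅X, X'⁆ ∈ sAlg Q
    rw [LieHom.map_lie]
    exact Submodule.subset_span ⟨_, psi_mem_sTilde he hQ X, _, psi_mem_sTilde he hQ X', rfl⟩
  · refine Submodule.span_le.2 ?_
    rintro _ ⟨x, hx, y, hy, rfl⟩
    obtain ⟨_, ⟨X, rfl⟩, _, hs, rfl⟩ := Submodule.mem_sup.1 (sTilde_le he hQ hx)
    obtain ⟨s, rfl⟩ := Submodule.mem_span_singleton.1 hs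
    obtain ⟨_, ⟨X', rfl⟩, _, hs', rfl⟩ := Submodule.mem_sup.1 (sTilde_le he hQ hy)
    obtain ⟨s', rfl⟩ := Submodule.mem_span_singleton.1 hs'
    have h1 : ∀ D : coneDiffOps Q, ⁅(1 : coneDiffOps Q), D⁆ = 0 := fun D => by
      change (1 : coneDiffOps Q) * D - D * 1 = 0
      rw [one_mul, mul_one, sub_self]
    have h2 : ∀ D : coneDiffOps Q, ⁅D, (1 : coneDiffOps Q)⁆ = 0 := fun D => by
      change D * (1 : coneDiffOps Q) - 1 * D = 0
      rw [one_mul, mul_one, sub_self]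
    refine ⟨⁅X, X'⁆, ?_⟩
    change psi he hQ ⁅X, X'⁆ = ⁅psi he hQ X + s • (1 : coneDiffOps Q),
      psi he hQ X' + s' • (1 : coneDiffOps Q)⁆
    rw [LieHom.map_lie, add_lie, lie_add, lie_add, smul_lie, lie_smul, smul_lie, lie_smul,
      h1, h1, h2]
    simp

end Image

/-! ### Nilpotency of inner derivations and `𝔰𝔩₂` -/

section Nilpotency

variable {R : Type*} [Ring R] [Algebra ℂ R]

omit [Algebra ℂ R] in
theorem lie_mul_eq (p D D' : R) : ⁅p, D * D'⁆ = ⁅p, D⁆ * D' + D * ⁅p, D'⁆ := by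
  simp only [Ring.lie_def]; noncomm_ring

/-- The inner derivation `ad p` of an associative algebra. -/
def adOp (p : R) : Module.End ℂ R := LinearMap.mulLeft ℂ p - LinearMap.mulRight ℂ p

theorem adOp_apply (p D : R) : adOp p D = ⁅p, D⁆ := rfl

theorem adOp_lie (p q : R) :
    adOp ⁅p, q⁆ = adOp p * adOp q - adOp q * adOp p := by
  ext D
  rw [LinearMap.sub_apply, Module.End.mul_apply, Module.End.mul_apply]
  simp only [adOp_apply, lie_lie]

theorem adOp_add (p q : R) :
    adOp (p + q) = adOp p + adOp q := by
  ext D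
  rw [LinearMap.add_apply]
  simp only [adOp_apply, add_lie]

theorem adOp_smul (c : ℂ) (p : R) :
    adOp (c • p) = c • adOp p := by
  ext D
  rw [LinearMap.smul_apply]
  simp only [adOp_apply, smul_lie]

/-- The elements that are annihilated by a power of `ad p` form a subalgebra. -/
theorem exists_adOp_pow_eq_zero_of_mem_adjoin (p : R) (S : Set R)
    (hS : ∀ D ∈ S, ∃ r : ℕ, (adOp p ^ r) D = 0) {D : R} (hD : D ∈ Algebra.adjoin ℂ S) :
    ∃ r : ℕ, (adOp p ^ r) D = 0 := by
  have hmono : ∀ (D : R) (r s : ℕ), r ≤ s → (adOp p ^ r) D = 0 → (adOp p ^ s) D = 0 := by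
    intro D r s hrs h
    rw [← Nat.sub_add_cancel hrs, pow_add, Module.End.mul_apply, h, map_zero]
  induction hD using Algebra.adjoin_induction with
  | mem D hD => exact hS D hD
  | algebraMap c =>
    refine ⟨1, ?_⟩
    rw [pow_one, adOp_apply, Ring.lie_def, Algebra.commutes, sub_self]
  | add D D' _ _ h h' =>
    obtain ⟨r, hr⟩ := h
    obtain ⟨s, hs⟩ := h'
    refine ⟨max r s, ?_⟩
    rw [map_add, hmono D r _ (le_max_left r s) hr, hmono D' s _ (le_max_right r s) hs, add_zero]
  | mul D D' _ _ h h' =>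
    obtain ⟨r, hr⟩ := h
    obtain ⟨s, hs⟩ := h'
    have key : ∀ (m r s : ℕ) (D D' : R), r + s = m → (adOp p ^ r) D = 0 → (adOp p ^ s) D' = 0 →
        (adOp p ^ m) (D * D') = 0 := by
      intro m
      induction m with
      | zero =>
        intro r s D D' h hr hs
        obtain ⟨rfl, rfl⟩ : r = 0 ∧ s = 0 := by omega
        rw [pow_zero, Module.End.one_apply] at hr ⊢
        rw [hr, zero_mul]
      | succ m ih =>
        intro r s D D' h hr hs
        rw [pow_succ, Module.End.mul_apply, adOp_apply, lie_mul_eq, map_add]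
        have h1 : (adOp p ^ m) (⁅p, D⁆ * D') = 0 := by
          cases r with
          | zero =>
            rw [pow_zero, Module.End.one_apply] at hr
            rw [hr, lie_zero, zero_mul, map_zero]
          | succ r =>
            rw [pow_succ, Module.End.mul_apply] at hr
            exact ih r s _ _ (by omega) hr hs
        have h2 : (adOp p ^ m) (D * ⁅p, D'⁆) = 0 := by
          cases s with
          | zero =>
            rw [pow_zero, Module.End.one_apply] at hs
            rw [hs, lie_zero, mul_zero, map_zero]
          | succ s =>
            rw [pow_succ, Module.End.mul_apply] at hs
            exact ih r s _ _ (by omega) hr hs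
        rw [h1, h2, add_zero]
    exact ⟨r + s, key _ r s D D' rfl hr hs⟩

/-- A sum of commuting endomorphisms is nilpotent on a vector on which both are nilpotent. -/
theorem exists_pow_add_eq_zero {M : Type*} [AddCommGroup M] [Module ℂ M] {f g : Module.End ℂ M}
    (hfg : Commute f g) {w : M} {r s : ℕ} (hf : (f ^ r) w = 0) (hg : (g ^ s) w = 0) :
    ((f + g) ^ (r + s)) w = 0 := by
  rw [hfg.add_pow, LinearMap.sum_apply]
  refine Finset.sum_eq_zero fun m _ => ?_
  rw [← nsmul_eq_mul', LinearMap.smul_apply]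
  have h : (f ^ m * g ^ (r + s - m)) w = 0 := by
    by_cases hm : r ≤ m
    · rw [(hfg.pow_pow m _).eq, Module.End.mul_apply, ← Nat.sub_add_cancel hm, pow_add,
        Module.End.mul_apply, hf, map_zero, map_zero]
    · rw [Module.End.mul_apply, show r + s - m = (r - m) + s by omega, pow_add,
        Module.End.mul_apply, hg, map_zero, map_zero]
  rw [h, smul_zero]

/-- An `𝔰𝔩₂`-argument: modulo a stable subspace `N`, a nonzero vector killed by `e` and by a power
of `f` is not an eigenvector of `h` with an eigenvalue outside `{0, 1/2, 1, …}`. The normalization is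
`[h, f] = -f` and `[e, f] = β h`. -/
theorem mem_of_sl2 {M : Type*} [AddCommGroup M] [Module ℂ M] {E F H : Module.End ℂ M}
    {β : ℂ} (hβ : β ≠ 0) (hHF : H * F = F * H - F) (hEF : E * F = F * E + β • H)
    (N : Submodule ℂ M) (hE : ∀ x ∈ N, E x ∈ N) (hF : ∀ x ∈ N, F x ∈ N)
    {w : M} {c : ℂ} (hw : E w ∈ N) (hc : H w - c • w ∈ N) (hc' : ∀ i : ℕ, c ≠ (i : ℂ) / 2)
    {r : ℕ} (hr : (F ^ r) w ∈ N) : w ∈ N := by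
  have hEr : ∀ r : ℕ, E * F ^ (r + 1) = F ^ (r + 1) * E
      + (β * (r + 1 : ℂ)) • (F ^ r * H - ((r : ℂ) / 2) • F ^ r) := by
    intro r
    induction r with
    | zero => simp [hEF]
    | succ r ih =>
      rw [pow_succ, ← mul_assoc, ih, add_mul, mul_assoc, hEF, smul_mul_assoc, sub_mul, mul_assoc,
        hHF, smul_mul_assoc, ← pow_succ, mul_add, mul_sub, ← mul_assoc (F ^ r) F H, ← pow_succ,
        mul_smul_comm, Nat.cast_succ, ← mul_assoc, ← pow_succ]
      module
  have hFr : ∀ (r : ℕ), ∀ x ∈ N, (F ^ r) x ∈ N := by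
    intro r
    induction r with
    | zero => intro x hx; simpa using hx
    | succ r ih =>
      intro x hx
      rw [pow_succ, Module.End.mul_apply]
      exact ih _ (hF x hx)
  induction r with
  | zero => simpa using hr
  | succ r ih =>
    refine ih ?_
    have h1 := LinearMap.congr_fun (hEr r) w
    simp only [Module.End.mul_apply, LinearMap.add_apply, LinearMap.smul_apply,
      LinearMap.sub_apply] at h1
    have h2 : (β * (r + 1 : ℂ)) • ((F ^ r) (H w) - ((r : ℂ) / 2) • (F ^ r) w) ∈ N := by
      rw [← sub_eq_iff_eq_add'] at h1
      rw [← h1]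
      exact N.sub_mem (hE _ hr) (hFr _ _ hw)
    have hne : β * (r + 1 : ℂ) ≠ 0 := mul_ne_zero hβ (Nat.cast_add_one_ne_zero r)
    have h3 := (N.smul_mem_iff hne).1 h2
    have h4 : (c - (r : ℂ) / 2) • (F ^ r) w ∈ N := by
      have h5 := hFr r _ hc
      rw [map_sub, map_smul] at h5
      have h6 := N.sub_mem h3 h5
      convert h6 using 1
      module
    exact (N.smul_mem_iff (sub_ne_zero.2 (hc' r))).1 h4

end Nilpotency

/-! ### Generation of `𝒟(C)` -/

section Generation

variable {V : Type*} [AddCommGroup V] [Module ℂ V] [FiniteDimensional ℂ V] {Q : QuadraticForm ℂ V}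
variable {ι : Type*} [Fintype ι] [DecidableEq ι] {e : Module.Basis ι ℂ V}
variable (he : ∀ i j, Q.polarBilin (e i) (e j) = if i = j then 1 else 0)
variable (hQ : Q.polarBilin.Nondegenerate)

/-- The subalgebra generated by the linear functionals and the operators `P_b`. -/
def genAlg : Subalgebra ℂ (Module.End ℂ (ConeRing Q)) :=
  Algebra.adjoin ℂ (Set.range (xOp Q) ∪ Set.range (confOp he))

theorem xOp_mem (a : V) : xOp Q a ∈ genAlg he :=
  Algebra.subset_adjoin (Or.inl ⟨a, rfl⟩)

theorem confOp_mem (b : V) : confOp he b ∈ genAlg he :=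
  Algebra.subset_adjoin (Or.inr ⟨b, rfl⟩)

theorem lie_mem_genAlg {D D' : Module.End ℂ (ConeRing Q)} (h : D ∈ genAlg he)
    (h' : D' ∈ genAlg he) : ⁅D, D'⁆ ∈ genAlg he := by
  rw [Ring.lie_def]
  exact sub_mem (mul_mem h h') (mul_mem h' h)

theorem hOp_mem [Nonempty ι] : hOp he ∈ genAlg he := by
  obtain ⟨i⟩ := ‹Nonempty ι›
  have h := lie_mem_genAlg he (confOp_mem he (e i)) (xOp_mem he (e i))
  rwa [lie_confOp_xOp, he, if_pos rfl, one_smul, wedge_self, map_zero, add_zero] at h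

theorem eulerOp_mem [Nonempty ι] : eulerOp he ∈ genAlg he := by
  have h := sub_mem (hOp_mem he) ((genAlg he).algebraMap_mem (shift V))
  rwa [hOp, add_sub_cancel_right] at h

theorem fieldOp_wedge_mem [Nonempty ι] (b a : V) : fieldOp Q (wedge Q b a) ∈ genAlg he := by
  have h := lie_mem_genAlg he (confOp_mem he b) (xOp_mem he a)
  rw [lie_confOp_xOp] at h
  have h' := sub_mem h ((genAlg he).smul_mem (hOp_mem he) (Q.polarBilin b a))
  rwa [add_sub_cancel_left] at h'

/-! ### Euler's identity for the symbol of an operator -/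

include he in
/-- The symbol of an operator is invariant under translations along the position vector, because
`Q = 0` on the cone. -/
theorem isDiffOp_sum_xOp_mul_lie (hQ : Q.polarBilin.Nondegenerate) {k : ℕ}
    {D : Module.End ℂ (ConeRing Q)} (hD : IsDiffOp (k + 2) D) :
    IsDiffOp k (∑ i, xOp Q (e i) * ⁅D, xOp Q (e i)⁆) := by
  have h1 : (∑ i, xOp Q (e i) * ⁅D, xOp Q (e i)⁆)
      = (-(2⁻¹) : ℂ) • ∑ i, ⁅⁅D, xOp Q (e i)⁆, xOp Q (e i)⁆ := by
    have h2 := sum_lie_xOp he D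
    have h3 : ∀ i, ⁅D, xOp Q (e i)⁆ * xOp Q (e i) + xOp Q (e i) * ⁅D, xOp Q (e i)⁆
        = (2 : ℂ) • (xOp Q (e i) * ⁅D, xOp Q (e i)⁆) + ⁅⁅D, xOp Q (e i)⁆, xOp Q (e i)⁆ := fun i => by
      rw [Ring.lie_def ⁅D, xOp Q (e i)⁆, two_smul]; abel
    simp only [h3, Finset.sum_add_distrib, ← Finset.smul_sum] at h2
    rw [add_eq_zero_iff_neg_eq.1 h2 |>.symm, smul_neg, smul_smul]
    norm_num
  rw [h1]
  refine IsDiffOp.smul _ ?_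
  have h4 : ∀ i, IsDiffOp k ⁅⁅D, xOp Q (e i)⁆, xOp Q (e i)⁆ := fun i =>
    (isDiffOp_succ_iff hQ).1 ((isDiffOp_succ_iff hQ).1 hD _) _
  exact Finset.sum_induction _ (IsDiffOp k) (fun _ _ => IsDiffOp.add) (IsDiffOp.zero k)
    fun i _ => h4 i

include he in
theorem sum_xOp_mul_lie_eq_zero (hQ : Q.polarBilin.Nondegenerate)
    {D : Module.End ℂ (ConeRing Q)} (hD : IsDiffOp 1 D) :
    ∑ i, xOp Q (e i) * ⁅D, xOp Q (e i)⁆ = 0 := by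
  have h2 := sum_lie_xOp he D
  have h3 : ∀ i, ⁅D, xOp Q (e i)⁆ * xOp Q (e i) + xOp Q (e i) * ⁅D, xOp Q (e i)⁆
      = (2 : ℂ) • (xOp Q (e i) * ⁅D, xOp Q (e i)⁆) := fun i => by
    have h4 := (isDiffOp_zero_iff hQ).1 ((isDiffOp_succ_iff hQ).1 hD (e i)) (e i)
    rw [Ring.lie_def ⁅D, xOp Q (e i)⁆, sub_eq_zero] at h4
    rw [h4, two_smul]
  simp only [h3, ← Finset.smul_sum] at h2
  exact (smul_eq_zero.1 h2).resolve_left two_ne_zero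

/-- The error term `m B(u, ·) D - ∑ i, (e i ∧ u) [D, B(e i, ·)]` in Euler's identity for an operator
`D` of order `m`; here `e i ∧ u` stands for `fieldOp Q (wedge Q (e i) u)`. -/
def eulerDefect (e : Module.Basis ι ℂ V) (u : V) (m : ℂ) (D : Module.End ℂ (ConeRing Q)) :
    Module.End ℂ (ConeRing Q) :=
  m • (xOp Q u * D) - ∑ i, fieldOp Q (wedge Q (e i) u) * ⁅D, xOp Q (e i)⁆

include he in
theorem lie_eulerDefect (u a : V) (m : ℂ) (D : Module.End ℂ (ConeRing Q)) :
    ⁅eulerDefect e u (m + 1) D, xOp Q a⁆ = eulerDefect e u m ⁅D, xOp Q a⁆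
      + Q.polarBilin u a • ∑ i, xOp Q (e i) * ⁅D, xOp Q (e i)⁆ := by
  have hmul : ∀ A B : Module.End ℂ (ConeRing Q), ⁅A * B, xOp Q a⁆
      = ⁅A, xOp Q a⁆ * B + A * ⁅B, xOp Q a⁆ := fun A B => by
    simp only [Ring.lie_def]; noncomm_ring
  have hcomm : ∀ i, ⁅⁅D, xOp Q (e i)⁆, xOp Q a⁆ = ⁅⁅D, xOp Q a⁆, xOp Q (e i)⁆ := fun i => by
    have h1 := xOp_mul_comm (Q := Q) (e i) a
    simp only [Ring.lie_def, sub_mul, mul_sub, mul_assoc, h1]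
    simp only [← mul_assoc, h1]
    abel
  have hsum : ∑ i, Q.polarBilin (e i) a • xOp Q u * ⁅D, xOp Q (e i)⁆
      = xOp Q u * ⁅D, xOp Q a⁆ := by
    conv_rhs => rw [← sum_polarBilin_smul he a, map_sum, lie_sum, Finset.mul_sum]
    refine Finset.sum_congr rfl fun i _ => ?_
    rw [map_smul, lie_smul, mul_smul_comm, smul_mul_assoc]
  have hfield : ∀ i, ⁅fieldOp Q (wedge Q (e i) u), xOp Q a⁆
      = Q.polarBilin (e i) a • xOp Q u - Q.polarBilin u a • xOp Q (e i) := fun i => by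
    rw [lie_fieldOp_xOp, wedge_apply, map_sub, map_smul, map_smul]
  rw [eulerDefect, eulerDefect, sub_lie, smul_lie, hmul, lie_xOp_xOp, zero_mul, zero_add, sum_lie]
  simp only [hmul, hcomm, hfield, sub_mul, Finset.sum_add_distrib, Finset.sum_sub_distrib, hsum,
    smul_mul_assoc (Q.polarBilin u a), ← Finset.smul_sum]
  module

end Generation

section Surjectivity

variable {V : Type*} [AddCommGroup V] [Module ℂ V] [FiniteDimensional ℂ V] {Q : QuadraticForm ℂ V}
variable {ι : Type*} [Fintype ι] [DecidableEq ι] {e : Module.Basis ι ℂ V}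
variable (he : ∀ i j, Q.polarBilin (e i) (e j) = if i = j then 1 else 0)
variable (hQ : Q.polarBilin.Nondegenerate)

include he in
/-- Euler's identity for the symbol of an operator of order `k + 1`, which is homogeneous of degree
`k + 1` and invariant under translations along the position vector. -/
theorem isDiffOp_eulerDefect (hQ : Q.polarBilin.Nondegenerate) (u : V) {k : ℕ}
    {D : Module.End ℂ (ConeRing Q)} (hD : IsDiffOp (k + 1) D) :
    IsDiffOp k (eulerDefect e u (k + 1) D) := by
  induction k generalizing D with
  | zero =>
    rw [isDiffOp_zero_iff hQ]
    intro a
    rw [lie_eulerDefect he, sum_xOp_mul_lie_eq_zero he hQ hD, smul_zero, add_zero, eulerDefect]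
    have h := (isDiffOp_zero_iff hQ).1 ((isDiffOp_succ_iff hQ).1 hD a)
    simp [h]
  | succ k ih =>
    rw [isDiffOp_succ_iff hQ]
    intro a
    rw [lie_eulerDefect he, Nat.cast_succ]
    exact (ih ((isDiffOp_succ_iff hQ).1 hD a)).add
      ((isDiffOp_sum_xOp_mul_lie he hQ hD).smul _)

/-! ### Operators carried into the generated algebra by the linear functionals -/

/-- The operators that are multiplied into the subalgebra `genAlg` by the linear functionals, on
either side. -/
def primSub : Submodule ℂ (Module.End ℂ (ConeRing Q)) where
  carrier := {D | ∀ a, xOp Q a * D ∈ genAlg he ∧ D * xOp Q a ∈ genAlg he}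
  zero_mem' a := by rw [mul_zero, zero_mul]; exact ⟨zero_mem _, zero_mem _⟩
  add_mem' h h' a := by
    rw [mul_add, add_mul]
    exact ⟨add_mem (h a).1 (h' a).1, add_mem (h a).2 (h' a).2⟩
  smul_mem' c D h a := by
    rw [mul_smul_comm, smul_mul_assoc]
    exact ⟨(genAlg he).smul_mem (h a).1 c, (genAlg he).smul_mem (h a).2 c⟩

theorem mem_primSub_of_order [Nonempty ι] (hQ : Q.polarBilin.Nondegenerate) {k : ℕ}
    (ih : ∀ D : Module.End ℂ (ConeRing Q), IsDiffOp k D → D ∈ genAlg he)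
    {D : Module.End ℂ (ConeRing Q)} (hD : IsDiffOp (k + 1) D) : D ∈ primSub he := by
  intro u
  have h1 : ((k : ℂ) + 1) • (xOp Q u * D) ∈ genAlg he := by
    have h2 := ih _ (isDiffOp_eulerDefect he hQ u hD)
    rw [eulerDefect] at h2
    have h3 : ∑ i, fieldOp Q (wedge Q (e i) u) * ⁅D, xOp Q (e i)⁆ ∈ genAlg he :=
      sum_mem fun i _ => mul_mem (fieldOp_wedge_mem he _ _)
        (ih _ ((isDiffOp_succ_iff hQ).1 hD _))
    simpa using add_mem h2 h3
  have h2 : xOp Q u * D ∈ genAlg he :=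
    ((genAlg he).toSubmodule.smul_mem_iff (Nat.cast_add_one_ne_zero k)).1 h1
  refine ⟨h2, ?_⟩
  have h3 : D * xOp Q u = xOp Q u * D + ⁅D, xOp Q u⁆ := by rw [Ring.lie_def]; abel
  rw [h3]
  exact add_mem h2 (ih _ ((isDiffOp_succ_iff hQ).1 hD u))

variable {he}

theorem eulerOp_mul_mem_primSub [Nonempty ι] {D : Module.End ℂ (ConeRing Q)}
    (h : D ∈ primSub he) : eulerOp he * D ∈ primSub he := by
  intro a
  have h1 := lie_eulerOp_xOp he a
  rw [Ring.lie_def, sub_eq_iff_eq_add, ← sub_eq_iff_eq_add'] at h1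
  constructor
  · rw [← mul_assoc, ← h1, sub_mul, mul_assoc]
    exact sub_mem (mul_mem (eulerOp_mem he) (h a).1) (h a).1
  · rw [mul_assoc]
    exact mul_mem (eulerOp_mem he) (h a).2

theorem mul_eulerOp_mem_primSub [Nonempty ι] {D : Module.End ℂ (ConeRing Q)}
    (h : D ∈ primSub he) : D * eulerOp he ∈ primSub he := by
  intro a
  have h1 := lie_eulerOp_xOp he a
  rw [Ring.lie_def, sub_eq_iff_eq_add] at h1
  constructor
  · rw [← mul_assoc]
    exact mul_mem (h a).1 (eulerOp_mem he)
  · rw [mul_assoc, h1, mul_add, ← mul_assoc]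
    exact add_mem (h a).2 (mul_mem (h a).2 (eulerOp_mem he))

variable (he)

theorem sum_xOp_mul_confOp : ∑ i, xOp Q (e i) * confOp he (e i)
    = eulerOp he * eulerOp he + (shift V - 1) • eulerOp he := by
  ext f
  obtain ⟨f, rfl⟩ := coneMk_surjective Q f
  have h0 : coneMk Q (quadPoly Q) = 0 :=
    (coneMk_eq_zero_iff Q).2 (Ideal.mem_span_singleton_self _)
  have h1 : ∑ i, linPoly (Q.polarBilin (e i)) * polyConf Q e (e i) f
      = eulerField V (eulerField V f) + algebraMap ℂ _ (shift V - 1) * eulerField V f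
        - algebraMap ℂ _ 2⁻¹ * ((2 * quadPoly Q) * laplace e f) := by
    have h2 : ∀ i, linPoly (Q.polarBilin (e i)) * polyConf Q e (e i) f
        = eulerField V (linPoly (Q.polarBilin (e i)) * constField (e i) f)
        + algebraMap ℂ _ (shift V - 1) * (linPoly (Q.polarBilin (e i)) * constField (e i) f)
        - algebraMap ℂ _ 2⁻¹ * (linPoly (Q.polarBilin (e i)) * linPoly (Q.polarBilin (e i))
          * laplace e f) := fun i => by
      rw [polyConf_apply, eulerField_mul_lin, map_sub, map_one]
      ring
    simp only [h2, Finset.sum_sub_distrib, Finset.sum_add_distrib, ← Finset.mul_sum, ← map_sum,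
      sum_linPoly_mul_constField he, ← Finset.sum_mul, sum_linPoly_sq he]
  rw [LinearMap.sum_apply]
  change ∑ i, coneMk Q (linPoly (Q.polarBilin (e i)) * polyConf Q e (e i) f)
    = coneMk Q (eulerField V (eulerField V f)) + (shift V - 1) • coneMk Q (eulerField V f)
  rw [← map_sum, h1, map_sub, map_mul, map_mul, map_mul, h0, mul_zero, zero_mul, mul_zero,
    sub_zero, map_add, ← Algebra.smul_def, map_smul]

theorem sum_confOp_mul_xOp : ∑ i, confOp he (e i) * xOp Q (e i)
    = (eulerOp he + algebraMap ℂ _ (2 * shift V)) * (eulerOp he + algebraMap ℂ _ (shift V + 1)) := by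
  have h : ∀ i, confOp he (e i) * xOp Q (e i) = xOp Q (e i) * confOp he (e i) + hOp he := fun i => by
    have h1 := lie_confOp_xOp he (e i) (e i)
    rw [he, if_pos rfl, one_smul, wedge_self, map_zero, add_zero, Ring.lie_def] at h1
    rw [← h1]; abel
  have hn : (Fintype.card ι : ℂ) = 2 * shift V + 2 := by
    rw [shift, Module.finrank_eq_card_basis e]; ring
  simp only [h, Finset.sum_add_distrib, sum_xOp_mul_confOp, Finset.sum_const, Finset.card_univ]
  rw [← Nat.cast_smul_eq_nsmul ℂ, hn, hOp]
  simp only [Algebra.algebraMap_eq_smul_one, mul_add, add_mul, mul_smul_comm, smul_mul_assoc,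
    mul_one, one_mul]
  module

variable {he} in
/-- The left factor `∑ P_{e i} B(e i, ·)` annihilates `primSub` modulo `genAlg`. -/
theorem left_mem {D : Module.End ℂ (ConeRing Q)} (h : D ∈ primSub he) :
    eulerOp he * (eulerOp he * D - (-(shift V + 1)) • D)
      - (-(2 * shift V)) • (eulerOp he * D - (-(shift V + 1)) • D) ∈ genAlg he := by
  have h1 : (∑ i, confOp he (e i) * xOp Q (e i)) * D ∈ genAlg he := by
    rw [Finset.sum_mul]
    refine sum_mem fun i _ => ?_
    rw [mul_assoc]
    exact mul_mem (confOp_mem he _) (h _).1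
  rw [sum_confOp_mul_xOp] at h1
  convert h1 using 1
  simp only [Algebra.algebraMap_eq_smul_one, mul_add, add_mul, mul_sub, mul_smul_comm,
    smul_mul_assoc, mul_one, one_mul, mul_assoc]
  module

variable {he} in
/-- The right factor `∑ B(e i, ·) P_{e i}` annihilates `primSub` modulo `genAlg`. -/
theorem right_mem {D : Module.End ℂ (ConeRing Q)} (h : D ∈ primSub he) :
    (D * eulerOp he - (0 : ℂ) • D) * eulerOp he
      - (1 - shift V) • (D * eulerOp he - (0 : ℂ) • D) ∈ genAlg he := by
  have h1 : D * (∑ i, xOp Q (e i) * confOp he (e i)) ∈ genAlg he := by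
    rw [Finset.mul_sum]
    refine sum_mem fun i _ => ?_
    rw [← mul_assoc]
    exact mul_mem (h _).2 (confOp_mem he _)
  rw [sum_xOp_mul_confOp] at h1
  convert h1 using 1
  simp only [zero_smul, sub_zero, mul_add, mul_smul_comm, mul_assoc]
  module

/-! ### Nilpotency of `ad P_u` and the exclusion of negative weights -/

theorem exists_adOp_confOp_pow_of_mem (hQ : Q.polarBilin.Nondegenerate) (z : V)
    {D : Module.End ℂ (ConeRing Q)} (hD : D ∈ genAlg he) :
    ∃ r : ℕ, (adOp (confOp he z) ^ r) D = 0 := by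
  refine exists_adOp_pow_eq_zero_of_mem_adjoin _ _ ?_ hD
  rintro _ (⟨a, rfl⟩ | ⟨b, rfl⟩)
  · refine ⟨3, ?_⟩
    rw [pow_succ, pow_succ, pow_one, Module.End.mul_apply, Module.End.mul_apply, adOp_apply,
      adOp_apply, adOp_apply, lie_confOp_xOp, lie_add, lie_smul, ← lie_skew (confOp he z) (hOp he),
      ← lie_skew (confOp he z) (fieldOp Q _), lie_hOp_confOp he hQ, lie_fieldOp_confOp he hQ,
      neg_neg, lie_add,
      lie_smul, lie_neg, lie_confOp_confOp he hQ, lie_confOp_confOp he hQ]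
    simp
  · exact ⟨1, by rw [pow_one, adOp_apply, lie_confOp_confOp he hQ]⟩

/-- For `x` isotropic, `P_x` commutes with `B(x, ·)`, which is not a zero divisor; so `ad P_x` is
nilpotent on `D` as soon as it is on `B(x, ·) D`. -/
theorem exists_adOp_confOp_pow (hQ : Q.polarBilin.Nondegenerate) (hn : 2 < Module.finrank ℂ V)
    {x y : V} (hx : Q x = 0) (hxy : Q.polarBilin x y = 1) {D : Module.End ℂ (ConeRing Q)}
    (hD : D ∈ primSub he) : ∃ r : ℕ, (adOp (confOp he x) ^ r) D = 0 := by
  obtain ⟨r, hr⟩ := exists_adOp_confOp_pow_of_mem he hQ x (hD x).1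
  refine ⟨r, ?_⟩
  have h0 : ⁅confOp he x, xOp Q x⁆ = 0 := by
    rw [lie_confOp_xOp, polarBilin_self, hx, wedge_self, map_zero]; simp
  have h1 : ∀ r : ℕ, (adOp (confOp he x) ^ r) (xOp Q x * D)
      = xOp Q x * (adOp (confOp he x) ^ r) D := by
    intro r
    induction r with
    | zero => rfl
    | succ r ih =>
      rw [pow_succ', Module.End.mul_apply, ih, adOp_apply, lie_mul_eq, h0, zero_mul, zero_add,
        Module.End.mul_apply, adOp_apply]
  rw [h1] at hr
  ext f
  exact ell_mul_eq_zero hQ hn hxy (LinearMap.congr_fun hr f)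

variable {he} in
/-- Modulo `genAlg`, an element of `primSub` is killed by the adjoint action of `B(u, ·)`, and that
of `P_u` is nilpotent on it. So if it is an eigenvector of the left and right multiplications by the
Euler operator, the representation theory of `𝔰𝔩₂` restricts its weight. -/
theorem mem_of_eigen [Nonempty ι] (hQ : Q.polarBilin.Nondegenerate)
    (hn : 2 < Module.finrank ℂ V) {D : Module.End ℂ (ConeRing Q)} (hD : D ∈ primSub he) {l m : ℂ}
    (hl : eulerOp he * D - l • D ∈ genAlg he) (hm : D * eulerOp he - m • D ∈ genAlg he)
    (hlm : ∀ i : ℕ, l - m ≠ (i : ℂ) / 2) : D ∈ genAlg he := by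
  obtain ⟨x, y, hx, hy, hxy⟩ := exists_hyperbolic_pair hQ hn
  obtain ⟨r, hr⟩ := exists_adOp_confOp_pow he hQ hn hx hxy hD
  obtain ⟨s, hs⟩ := exists_adOp_confOp_pow he hQ hn hy (polarBilin_comm Q x y ▸ hxy) hD
  have hcomm : Commute (adOp (confOp he x)) (adOp (confOp he y)) := by
    rw [commute_iff_eq, ← sub_eq_zero, ← adOp_lie, lie_confOp_confOp he hQ]
    ext D
    rw [adOp_apply, zero_lie]; rfl
  have hrs := exists_pow_add_eq_zero hcomm hr hs
  rw [← adOp_add, ← confOp_add he hQ] at hrs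
  have hu : Q.polarBilin (x + y) (x + y) = 2 := by
    rw [polarBilin_self, quadForm_add, hx, hy, hxy]; ring
  refine mem_of_sl2 (E := adOp (xOp Q (x + y))) (F := adOp (confOp he (x + y)))
    (H := adOp (hOp he)) (β := -2) (by norm_num) ?_ ?_ (Subalgebra.toSubmodule (genAlg he)) ?_ ?_
    (c := l - m) ?_ ?_ hlm (r := r + s) ?_
  · have h := adOp_lie (hOp he) (confOp he (x + y))
    rw [lie_hOp_confOp he hQ, ← neg_one_smul ℂ, adOp_smul, neg_one_smul] at h
    rw [sub_eq_add_neg, h]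
    abel
  · rw [← sub_eq_iff_eq_add', ← adOp_lie, ← lie_skew, lie_confOp_xOp, hu, wedge_self, map_zero,
      add_zero, ← neg_smul, adOp_smul]
  · exact fun D hD => lie_mem_genAlg he (xOp_mem he _) hD
  · exact fun D hD => lie_mem_genAlg he (confOp_mem he _) hD
  · exact sub_mem (hD _).1 (hD _).2
  · have h1 : adOp (hOp he) D = eulerOp he * D - D * eulerOp he := by
      rw [adOp_apply, hOp, add_lie, lie_algebraMap, add_zero, Ring.lie_def]
    have h2 : eulerOp he * D - D * eulerOp he - (l - m) • D
        = eulerOp he * D - l • D - (D * eulerOp he - m • D) := by module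
    rw [h1, h2]
    exact sub_mem hl hm
  · rw [hrs]; exact zero_mem _

variable {he} in
/-- The four possible weights of an eigenvector are all negative. -/
theorem mem_of_mem_primSub [Nonempty ι] (hQ : Q.polarBilin.Nondegenerate)
    (hn : 2 < Module.finrank ℂ V) {D : Module.End ℂ (ConeRing Q)} (hD : D ∈ primSub he) :
    D ∈ genAlg he := by
  -- the weights `-n / 2` and `2 - n` are negative since `n > 2`
  have hs : ∀ (i k : ℕ), (2 * (Module.finrank ℂ V : ℂ) + i = k) → 6 ≤ k := fun i k h => by
    have h1 : 2 * Module.finrank ℂ V + i = k := by exact_mod_cast h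
    omega
  have w11 : ∀ i : ℕ, -(shift V + 1) - 0 ≠ (i : ℂ) / 2 := fun i h => by
    have := hs (2 * i) 0 (by rw [shift] at h; push_cast; linear_combination -4 * h)
    omega
  have w12 : ∀ i : ℕ, -(shift V + 1) - (1 - shift V) ≠ (i : ℂ) / 2 := fun i h => by
    have h1 : ((i + 4 : ℕ) : ℂ) = 0 := by push_cast; linear_combination -2 * h
    exact absurd (Nat.cast_eq_zero.1 h1) (by omega)
  have w21 : ∀ i : ℕ, -(2 * shift V) - 0 ≠ (i : ℂ) / 2 := fun i h => by
    have := hs i 4 (by rw [shift] at h; push_cast; linear_combination -2 * h)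
    omega
  have w22 : ∀ i : ℕ, -(2 * shift V) - (1 - shift V) ≠ (i : ℂ) / 2 := fun i h =>
    w11 i (by linear_combination h)
  have hL : ∀ (l : ℂ) {D}, D ∈ primSub he → eulerOp he * D - l • D ∈ primSub he := fun l D h =>
    sub_mem (eulerOp_mul_mem_primSub h) ((primSub he).smul_mem l h)
  have hR : ∀ (l : ℂ) {D}, D ∈ primSub he → D * eulerOp he - l • D ∈ primSub he := fun l D h =>
    sub_mem (mul_eulerOp_mem_primSub h) ((primSub he).smul_mem l h)
  -- left and right factors commute
  have hLR : ∀ (l m : ℂ) (D : Module.End ℂ (ConeRing Q)), eulerOp he * D - l • D ∈ genAlg he →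
      eulerOp he * (D * eulerOp he - m • D) - l • (D * eulerOp he - m • D) ∈ genAlg he := by
    intro l m D h
    have h1 := sub_mem (mul_mem h (eulerOp_mem he)) ((genAlg he).smul_mem h m)
    convert h1 using 1
    simp only [sub_mul, mul_sub, smul_sub, smul_mul_assoc, mul_smul_comm, mul_assoc]
    module
  -- the factors of the two quadratic polynomials are removed one at a time
  have h1 := hL (-(shift V + 1)) hD
  have h1' : eulerOp he * D - (-(shift V + 1)) • D ∈ genAlg he :=
    mem_of_eigen hQ hn h1 (left_mem hD)
      (mem_of_eigen hQ hn (hR 0 h1) (hLR _ _ _ (left_mem hD)) (right_mem h1) w22) w21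
  exact mem_of_eigen hQ hn hD h1'
    (mem_of_eigen hQ hn (hR 0 hD) (hLR _ _ _ h1') (right_mem hD) w12) w11

/-- Every differential operator on the cone lies in the subalgebra generated by the linear
functionals and the operators `P_b`, by induction on the order. -/
theorem mem_genAlg [Nonempty ι] (hQ : Q.polarBilin.Nondegenerate) (hn : 2 < Module.finrank ℂ V)
    {k : ℕ} {D : Module.End ℂ (ConeRing Q)} (hD : IsDiffOp k D) : D ∈ genAlg he := by
  induction k generalizing D with
  | zero =>
    rw [eq_mulOp_of_lie_xOp hQ ((isDiffOp_zero_iff hQ).1 hD)]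
    generalize D 1 = f
    induction f using coneRing_induction hQ with
    | hC r =>
      have h1 : mulOp (algebraMap ℂ (ConeRing Q) r) = algebraMap ℂ (Module.End ℂ _) r := by
        ext f; simp [Algebra.smul_def]
      rw [h1]
      exact (genAlg he).algebraMap_mem r
    | hlin a => exact xOp_mem he a
    | hadd f g hf hg =>
      rw [show mulOp (f + g) = mulOp f + mulOp g from map_add (LinearMap.mul ℂ _) f g]
      exact add_mem hf hg
    | hmul f g hf hg =>
      rw [show mulOp (f * g) = mulOp f * mulOp g from LinearMap.ext fun h => mul_assoc f g h]
      exact mul_mem hf hg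
  | succ k ih => exact mem_of_mem_primSub hQ hn (mem_primSub_of_order he hQ (fun _ => ih) hD)

theorem lift_psi_surjective [Nonempty ι] (hn : 2 < Module.finrank ℂ V) :
    Function.Surjective (UniversalEnvelopingAlgebra.lift ℂ (psi he hQ)) := by
  set Φ := (coneDiffOps Q).val.comp (UniversalEnvelopingAlgebra.lift ℂ (psi he hQ)) with hΦ
  have hψ : ∀ X, psiOp he hQ X ∈ Φ.range := fun X =>
    ⟨UniversalEnvelopingAlgebra.ι ℂ X, by
      rw [hΦ]
      change (UniversalEnvelopingAlgebra.lift ℂ (psi he hQ) _).1 = _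
      rw [UniversalEnvelopingAlgebra.lift_ι_apply, psi_coe]⟩
  have hle : genAlg he ≤ Φ.range := by
    refine Algebra.adjoin_le ?_
    rintro _ (⟨a, rfl⟩ | ⟨b, rfl⟩)
    · have h := hψ (gMk Q 0 a 0 0)
      rw [psiOp_gMk, confOp_zero he hQ, map_zero, zero_smul] at h
      simpa using h
    · have h := hψ (gMk Q 0 0 b 0)
      rw [psiOp_gMk, map_zero, map_zero, zero_smul] at h
      simpa using h
  rintro ⟨D, k, hk⟩
  obtain ⟨x, hx⟩ := hle (mem_genAlg he hQ hn hk)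
  exact ⟨x, Subtype.ext hx⟩

end Surjectivity

end QuadCone

end

theorem mainTheorem6 {V : Type*} [AddCommGroup V] [Module ℂ V] [FiniteDimensional ℂ V]
    (Q : QuadraticForm ℂ V) (hQ : Q.polarBilin.Nondegenerate) (hn : 2 < Module.finrank ℂ V) :
    ∃ ψ : QuadCone.gAlg Q →ₗ⁅ℂ⁆ QuadCone.coneDiffOps Q,
      QuadCone.IsEquivariantExtension Q ψ ∧
      (∀ ψ' : QuadCone.gAlg Q →ₗ⁅ℂ⁆ QuadCone.coneDiffOps Q,
        QuadCone.IsEquivariantExtension Q ψ' → ψ' = ψ) ∧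
      Function.Injective ψ ∧
      LinearMap.range (ψ : QuadCone.gAlg Q →ₗ[ℂ] QuadCone.coneDiffOps Q) = QuadCone.sAlg Q ∧
      Function.Surjective (UniversalEnvelopingAlgebra.lift ℂ ψ) := by
  obtain ⟨e, he⟩ := QuadCone.exists_orthonormal_basis hQ
  have : Nonempty (Fin (Module.finrank ℂ V)) := ⟨⟨0, by omega⟩⟩
  exact ⟨QuadCone.psi he hQ, ⟨QuadCone.psi_extends he hQ, QuadCone.psi_equivariant he hQ⟩,
    fun ψ' h => QuadCone.eq_psi_of_isEquivariantExtension he hQ h,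
    QuadCone.psi_injective he hQ hn, QuadCone.range_psi he hQ,
    QuadCone.lift_psi_surjective he hQ hn⟩
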